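/- \textbf{Setting.} For a real integrable function $f$ on $\mathbb{R}^3$ let $\tilde f(\vec k)=\int d^3x\,e^{-i\vec k\cdot\vec x}f(\vec x)$, and put $(f,g)_s=\int\frac{d^3k}{(2\pi)^3}|\vec k|^{2s}\tilde f(\vec k)\,\tilde g(\vec k)^*$ and $\|f\|_s^2=(f,f)_s\in[0,\infty]$. Consider a scalar field of mass $m$ in the Bunch--Davies vacuum on the Poincaré patch of de Sitter spacetime with Hubble rate $H$, $a(\eta)=-1/(H\eta)$, at the time $\eta=-1/H$ at which $a=1$, and put $\mu^2=\frac32-\sqrt{\frac94-\frac{m^2}{H^2}}$. The mode functions are $e_k(\eta)=\sqrt{-\pi\eta/(4a(\eta)^2)}\;H^{(1)}_{3/2-\mu^2}(-k\eta)$. For the field $\hat\Phi$ and the canonical momentum $\hat\Pi$ consider the correlators (for $H>0$) $$\langle\{\hat\Phi[f],\hat\Phi[f]\}\rangle=\frac{\pi}{2H}\int\frac{d^3k}{(2\pi)^3}\Big|H^{(1)}_{\frac32-\mu^2}\big(\tfrac kH\big)\Big|^2|\tilde f|^2,\qquad \langle\{\hat\Pi[g],\hat\Pi[g]\}\rangle=\frac{\pi}{2H}\int\frac{d^3k}{(2\pi)^3}k^2\Big|H^{(1)}_{\frac12-\mu^2}\big(\tfrac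 kH\big)\Big|^2|\tilde g|^2,$$ $$\langle\{\hat\Phi[f],\hat\Pi[g]\}\rangle=-\frac{\pi}{2H}\int\frac{d^3k}{(2\pi)^3}\,k\,\mathrm{Re}\Big(H^{(1)}_{\frac32-\mu^2}\big(\tfrac kH\big)H^{(2)}_{\frac12-\mu^2}\big(\tfrac kH\big)\Big)\mathrm{Re}(\tilde f\,\tilde g^*).\tag{1}$$ These are the Bunch--Davies two-point functions up to one term: the momentum mode is $\partial_\eta e_k$ at $\eta=-1/H$ with its term $-\mu^2H\,e_k$ left out. Keeping this term gives the exact correlators $$\langle\{\hat\Phi[f],\hat\Pi[g]\}\rangle=2\int\frac{d^3k}{(2\pi)^3}\mathrm{Re}(e_k\,\overline{\partial_\eta e_k})\,\mathrm{Re}(\tilde f\tilde g^*),\qquad \langle\{\hat\Pi[g],\hat\Pi[g]\}\rangle=2\int\frac{d^3k}{(2\pi)^3}|\partial_\eta e_k|^2|\tilde g|^2,\tag{2}$$ with $\langle\{\hat\Phi[f],\hat\Phi[f]\}\rangle$ as in (1). Let $$\nu_A^2=\langle\{\hat\Phi[f],\hat\Phi[f]\}\rangle\,\langle\{\hat\Pi[g],\hat\Pi[g]\}\rangle-\langle\{\hat\Phi[f],\hat\Pi[g]\}\rangle^2,$$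 and let $S(\nu_A)=\frac{\nu_A+1}2\log_2\frac{\nu_A+1}2-\frac{\nu_A-1}2\log_2\frac{\nu_A-1}2$ be the von Neumann entropy of the single-mode subsystem generated by $(\hat\Phi[f],\hat\Pi[g])$. At $H=0$ the correlators are those of the massless field in the Minkowski vacuum, so that $\nu_A^2=\|f\|_{-1/2}^2\|g\|_{1/2}^2$. \textbf{Proposition.} Let $R>0$ and let $f,g$ be real integrable functions on $\mathbb{R}^3$ with $\|f\|_{-1/2}<\infty$, $\|g\|_{1/2}<\infty$ and $\int fg\,d^3x=1$ (so that $\hat\Phi[f],\hat\Pi[g]$ are a canonical pair). Assume that $f$ and $g$ do not saturate Hölder's inequality in the light-field limit $\mu\to0$, that is, $\mathrm{Re}(f,g)_{-1/2}^2\neq\|f\|_{-3/2}^2\,\|g\|_{1/2}^2$ in $[0,\infty]$ (which holds automatically when $\|f\|_{-3/2}=\infty$). (i) There is $\varepsilon>0$ such that for every fixed ratio $0<m/H<\varepsilon$ the entropy $S(\nu_A)$ defined by the correlators (1) is a strictly increasing function of $RH$ on all of $[0,\infty)$. (ii) For every $L$ there is $\varepsilon>0$ such that for every fixed ratio $0<m/H<\varepsilon$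 the entropy $S(\nu_A)$ defined by the exact correlators (2) is a strictly increasing function of $RH$ on $[0,L]$. -/

import Mathlib

noncomputable section

/-- Three-dimensional Euclidean space: comoving positions and wave vectors. -/
abbrev Space3 : Type := EuclideanSpace ℝ (Fin 3)

/-- The Fourier transform `f̃(k) = ∫ d³x e^{-i k·x} f(x)` of a real smearing function. -/
def smearFourier (f : Space3 → ℝ) (k : Space3) : ℂ :=
  ∫ x : Space3, Complex.exp (-(Complex.I * ((inner ℝ k x : ℝ) : ℂ))) * ((f x : ℝ) : ℂ)

/-- The Sobolev product `(f, g)_s = ∫ d³k/(2π)³ |k|^{2s} f̃(k) g̃(k)^*`. -/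
def sobolevProd (s : ℝ) (f g : Space3 → ℝ) : ℂ :=
  ∫ k : Space3, ((((2 * Real.pi) ^ 3)⁻¹ * ‖k‖ ^ (2 * s) : ℝ) : ℂ) *
    (smearFourier f k * (starRingEnd ℂ) (smearFourier g k))

/-- The squared homogeneous Sobolev norm `‖f‖_s² = ∫ d³k/(2π)³ |k|^{2s} |f̃(k)|²`,
with values in `[0, ∞]`. -/
def sobolevNormSq (s : ℝ) (f : Space3 → ℝ) : ENNReal :=
  ∫⁻ k : Space3,
    ENNReal.ofReal (((2 * Real.pi) ^ 3)⁻¹ * ‖k‖ ^ (2 * s) * ‖smearFourier f k‖ ^ 2)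

/-- `f` and `g` saturate Hölder's inequality (with mass parameter `μ² = musq`):
`Re(f, g)²_{-(1-μ²)/2} = ‖f‖²_{-3/2+μ²} ‖g‖²_{1/2}`, as an equality in `[0, ∞]`. -/
def SaturatesHolder (musq : ℝ) (f g : Space3 → ℝ) : Prop :=
  ENNReal.ofReal ((sobolevProd (-(1 - musq) / 2) f g).re ^ 2) =
    sobolevNormSq (-3 / 2 + musq) f * sobolevNormSq (1 / 2) g

/-- The Hankel function of the first kind `H^{(1)}_ν(x)`, for `ν > -1/2` and `x > 0`, by
Hankel's integral:
`√(2/(π x)) e^{i (x - νπ/2 - π/4)} / Γ(ν + 1/2) · ∫₀^∞ e^{-t} t^{ν-1/2} (1 + i t/(2x))^{ν-1/2} dt`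
(principal branch). It is the solution `J_ν + i Y_ν` of Bessel's equation of order `ν`
that is asymptotic to `√(2/(π x)) e^{i (x - νπ/2 - π/4)}` as `x → ∞`. Only orders near `3/2` and
near `1/2` and positive arguments occur below. -/
def hankelOne (ν x : ℝ) : ℂ :=
  ((Real.sqrt (2 / (Real.pi * x)) / Real.Gamma (ν + 1 / 2) : ℝ) : ℂ) *
    Complex.exp (Complex.I * ((x - ν * Real.pi / 2 - Real.pi / 4 : ℝ) : ℂ)) *
    ∫ t in Set.Ioi (0 : ℝ), ((Real.exp (-t) * t ^ (ν - 1 / 2) : ℝ) : ℂ) *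
      (1 + Complex.I * ((t / (2 * x) : ℝ) : ℂ)) ^ ((ν - 1 / 2 : ℝ) : ℂ)

/-- The order `√(9/4 - m²/H²)` of the Bunch–Davies modes; `r = m / H`. -/
def bdIndex (r : ℝ) : ℝ := Real.sqrt (9 / 4 - r ^ 2)

/-- `μ² = 3/2 - √(9/4 - m²/H²)`; `r = m / H`. -/
def muSq (r : ℝ) : ℝ := 3 / 2 - bdIndex r

/-- The scale factor `a(η) = -1/(H η)` of the Poincaré patch, `η < 0`. -/
def scaleFactor (H η : ℝ) : ℝ := -1 / (H * η)

/-- The Bunch–Davies mode function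
`e_k(η) = √(-π η / (4 a(η)²)) H^{(1)}_{√(9/4 - m²/H²)}(-k η)`. -/
def bdMode (r H k η : ℝ) : ℂ :=
  ((Real.sqrt (-Real.pi * η / (4 * scaleFactor H η ^ 2)) : ℝ) : ℂ) *
    hankelOne (bdIndex r) (-k * η)

/-- The field modes at the time `η = -1/H`, at which `a = 1`. -/
def fieldMode (r H k : ℝ) : ℂ := bdMode r H k (-1 / H)

/-- The modes of the canonical momentum `√h n^a ∇_a φ = a² ∂_η φ` at the time `η = -1/H`. -/
def momentumMode (r H k : ℝ) : ℂ :=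
  ((scaleFactor H (-1 / H) ^ 2 : ℝ) : ℂ) * deriv (fun η : ℝ => bdMode r H k η) (-1 / H)

/-- The momentum modes `-√(π/4) H^{-1/2} k H^{(1)}_{1/2-μ²}(k/H)`, which are obtained from
the recurrence of the Hankel functions when the term `-μ² H e_k` of the time derivative is
dropped. -/
def lightMomentumMode (r H k : ℝ) : ℂ :=
  -((Real.sqrt (Real.pi / (4 * H)) * k : ℝ) : ℂ) * hankelOne (1 / 2 - muSq r) (k / H)

/-- The symmetrized vacuum expectation value `⟨{U[f], V[g]}⟩` of two smeared operators with
(isotropic) mode functions `u` and `v`: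
`∫ d³k/(2π)³ 2 Re(u_k v_k^*) Re(f̃(k) g̃(k)^*)`. -/
def modeCorr (u v : ℝ → ℂ) (f g : Space3 → ℝ) : ℝ :=
  ∫ k : Space3, ((2 * Real.pi) ^ 3)⁻¹ *
    (2 * (u ‖k‖ * (starRingEnd ℂ) (v ‖k‖)).re) *
    (smearFourier f k * (starRingEnd ℂ) (smearFourier g k)).re

/-- The covariance matrix of the canonical pair `(Φ[f], Π[g])` when the field has modes `u`
and the momentum has modes `v`. -/
def pairCovariance (u v : ℝ → ℂ) (f g : Space3 → ℝ) : Matrix (Fin 2) (Fin 2) ℝ :=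
  !![modeCorr u u f f, modeCorr u v f g; modeCorr u v f g, modeCorr v v g g]

/-- The covariance matrix of `(Φ[f], Π[g])` in the Minkowski vacuum of the massless field. -/
def minkowskiCovariance (f g : Space3 → ℝ) : Matrix (Fin 2) (Fin 2) ℝ :=
  !![(sobolevProd (-1 / 2) f f).re, 0; 0, (sobolevProd (1 / 2) g g).re]

/-- The von Neumann entropy of a single mode in a Gaussian state with symplectic
eigenvalue `ν`. -/
def vnEntropy (ν : ℝ) : ℝ :=
  (ν + 1) / 2 * Real.logb 2 ((ν + 1) / 2) - (ν - 1) / 2 * Real.logb 2 ((ν - 1) / 2)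

/-- The entropy of a single mode with covariance matrix `σ`; its symplectic eigenvalue
is `√(det σ)`. -/
def covEntropy (σ : Matrix (Fin 2) (Fin 2) ℝ) : ℝ := vnEntropy (Real.sqrt σ.det)

/-- The entropy of the mode `(Φ[f], Π[g])` at Hubble rate `H` and mass `m = r H`, with the
two-point functions
`⟨{Φ[f],Φ[f]}⟩ = π/(2H) ∫ d³k/(2π)³ |H^{(1)}_{3/2-μ²}(k/H)|² |f̃|²`,
`⟨{Π[g],Π[g]}⟩ = π/(2H) ∫ d³k/(2π)³ k² |H^{(1)}_{1/2-μ²}(k/H)|² |g̃|²`,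
`⟨{Φ[f],Π[g]}⟩ = -π/(2H) ∫ d³k/(2π)³ k Re(H^{(1)}_{3/2-μ²} H^{(2)}_{1/2-μ²})(k/H) Re(f̃ g̃^*)`.
At `H = 0` it is the Minkowski value. -/
def lightEntropy (r H : ℝ) (f g : Space3 → ℝ) : ℝ :=
  if H = 0 then covEntropy (minkowskiCovariance f g)
  else covEntropy (pairCovariance (fieldMode r H) (lightMomentumMode r H) f g)

/-- The entropy of the mode `(Φ[f], Π[g])` at Hubble rate `H` and mass `m = r H`, with the
momentum modes given by the exact time derivative of the Bunch–Davies modes. At `H = 0` it is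
the Minkowski value. -/
def exactEntropy (r H : ℝ) (f g : Space3 → ℝ) : ℝ :=
  if H = 0 then covEntropy (minkowskiCovariance f g)
  else covEntropy (pairCovariance (fieldMode r H) (momentumMode r H) f g)

end

/-! Write a = μ² and x = k/H. Up to a common phase and the factor √(2/(πx)), the Hankel functions of
orders 1/2 - a and 3/2 - a are slowly varying amplitudes G and -iK (`lowerAmp`, `upperAmp`). All
correlators are integrals of Q = |G|², P = |K|² and C = Im(K G*), taken at k/H, against weights
|k|^n Re(f̃ g̃*). At a = 0 one has Q = 1, C = 1/x, P = 1 + 1/x², so that ν_A² =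
‖f‖²_{-1/2}‖g‖²_{1/2} + H²(‖f‖²_{-3/2}‖g‖²_{1/2} - Re(f,g)²_{-1/2}) when the norms are finite, and
strictness in Hölder's inequality is what makes it grow. The theorem is a perturbation of this
formula, but it has to be uniform in H and to allow ‖f‖_{-3/2} = ∞. This calls for relative errors.

The relative errors come from `modulus_expansion`: C, P and -x ∂ₓP are Q/x, Q + Q/x² and 2Q/x², with
relative error O(a) in the terms Q/x and Q/x², while x ∂ₓQ is at most of order a Q/(1 + x²)
(`abs_euler_modQ_le`). The inputs are the representation of G as a mean of (1 + it/(2x))^{-a} under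
a Gamma law, and the Wronskian Re(K G*) = 1, which gives PQ = 1 + C². In addition Q ≤ 8x^{2a}, which
makes Q/x² barely integrable at k = 0 against |k|⁻¹ in three dimensions; this is where a > 0 is
needed.

Put N = ∫(Q/x²)|f̃|²/k, B = ∫Q k|g̃|² and X = ∫(Q/x) Re(f̃ g̃*). With the correlators (1), H ∂_H
ν_A² = 2(NB - X²) + O(a)NB. Since Q(k/H)/Q(1/H) lies between small powers of k, the gap X² ≤ (1 -
δ)NB holds with one δ for all H (`exists_uniform_gap`), and the derivative is positive
(`gram_growth_bound`, `exists_light_growth`). With the correlators (2), the term -aH e_k adds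
nonnegative terms with nonnegative derivative to ⟨ΠΠ⟩. The new part of ⟨ΦΠ⟩ is controlled by
Cauchy–Schwarz through a²H² N ∫(Q/x²)|g̃|²/k. The last integral grows at most like 1/a
(`exists_infrared_bound`), so one power of a survives, multiplied by powers of 1 + H; hence the
bounded range (`exists_exact_growth`).

The entropy is increasing in ν only for ν ≥ 1, so the uncertainty relation 1 = (∫fg)² ≤
‖f‖²_{-1/2}‖g‖²_{1/2} is needed at H = 0 (`one_le_sobolev_mul`). For merely integrable f and g it is
proved by truncating g, which does not increase ‖g‖_{1/2} by the Gagliardo form of that norm, and by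
mollifying the truncation. -/

noncomputable section
open MeasureTheory Filter Topology Set

/-! ### Powers of `1 + i y` -/

/-- The point `1 + i y`. -/
def onePlusI (y : ℝ) : ℂ := 1 + Complex.I * (y : ℂ)

lemma onePlusI_re (y : ℝ) : (onePlusI y).re = 1 := by simp [onePlusI]

lemma onePlusI_im (y : ℝ) : (onePlusI y).im = y := by simp [onePlusI]

lemma onePlusI_ne_zero (y : ℝ) : onePlusI y ≠ 0 := fun h => by
  have := onePlusI_re y
  rw [h] at this
  simp at this

lemma onePlusI_mem_slitPlane (y : ℝ) : onePlusI y ∈ Complex.slitPlane := by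
  left; rw [onePlusI_re]; exact one_pos

lemma one_le_norm_onePlusI (y : ℝ) : 1 ≤ ‖onePlusI y‖ := by
  have h := Complex.abs_re_le_norm (onePlusI y)
  rwa [onePlusI_re, abs_one] at h

lemma le_norm_onePlusI (y : ℝ) : y ≤ ‖onePlusI y‖ := by
  have h := Complex.abs_im_le_norm (onePlusI y)
  rw [onePlusI_im] at h
  exact (le_abs_self y).trans h

lemma norm_onePlusI_le {y : ℝ} (hy : 0 ≤ y) : ‖onePlusI y‖ ≤ 1 + y := by
  refine (norm_add_le _ _).trans ?_
  simp [abs_of_nonneg hy]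

lemma norm_sq_onePlusI (y : ℝ) : ‖onePlusI y‖ ^ 2 = 1 + y ^ 2 := by
  rw [← Complex.normSq_eq_norm_sq, Complex.normSq_apply, onePlusI_re, onePlusI_im]; ring

/-- The real power `(1 + i y) ^ s`. -/
def onePlusIPow (s y : ℝ) : ℂ := onePlusI y ^ (s : ℂ)

lemma norm_onePlusIPow (s y : ℝ) : ‖onePlusIPow s y‖ = ‖onePlusI y‖ ^ s := by
  rw [onePlusIPow, Complex.norm_cpow_of_ne_zero (onePlusI_ne_zero y)]
  simp

lemma continuous_onePlusI : Continuous onePlusI := by unfold onePlusI; fun_prop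

lemma continuous_onePlusIPow (s : ℝ) : Continuous (onePlusIPow s) := by
  rw [continuous_iff_continuousAt]
  intro y
  exact (continuous_onePlusI.continuousAt).cpow continuousAt_const (onePlusI_mem_slitPlane y)

lemma onePlusIPow_zero_right (s : ℝ) : onePlusIPow s 0 = 1 := by
  simp [onePlusIPow, onePlusI]

lemma onePlusIPow_add (s u y : ℝ) :
    onePlusIPow (s + u) y = onePlusIPow s y * onePlusIPow u y := by
  unfold onePlusIPow
  rw [← Complex.cpow_add _ _ (onePlusI_ne_zero y)]
  push_cast; rfl

lemma onePlusIPow_one (y : ℝ) : onePlusIPow 1 y = onePlusI y := by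
  simp [onePlusIPow]

lemma norm_onePlusIPow_le_one {s : ℝ} (hs : s ≤ 0) (y : ℝ) : ‖onePlusIPow s y‖ ≤ 1 := by
  rw [norm_onePlusIPow]
  exact Real.rpow_le_one_of_one_le_of_nonpos (one_le_norm_onePlusI y) hs

lemma norm_onePlusIPow_le {s y : ℝ} (hs : s ≤ 1) (hy : 0 ≤ y) : ‖onePlusIPow s y‖ ≤ 1 + y := by
  rw [norm_onePlusIPow]
  refine (Real.rpow_le_rpow_of_exponent_le (one_le_norm_onePlusI y) hs).trans ?_
  rw [Real.rpow_one]
  exact norm_onePlusI_le hy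

lemma hasDerivAt_onePlusIPow (s y : ℝ) :
    HasDerivAt (onePlusIPow s) ((s : ℂ) * onePlusIPow (s - 1) y * Complex.I) y := by
  have h1 : HasDerivAt onePlusI Complex.I y := by
    have h := ((hasDerivAt_id y).ofReal_comp.const_mul Complex.I).const_add 1
    rw [Complex.ofReal_one, mul_one] at h
    exact h
  have h2 := (Complex.hasStrictDerivAt_cpow_const
    (onePlusI_mem_slitPlane y) (c := (s : ℂ))).hasDerivAt.comp (𝕜 := ℝ) y h1
  have h3 : onePlusIPow (s - 1) y = onePlusI y ^ ((s : ℂ) - 1) := by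
    simp [onePlusIPow]
  rw [h3]
  exact h2

lemma abs_arg_onePlusI_le {y : ℝ} (hy : 0 ≤ y) : |(onePlusI y).arg| ≤ y := by
  have h0 : 0 ≤ (onePlusI y).arg := by
    rw [Complex.arg_nonneg_iff, onePlusI_im]; exact hy
  rw [abs_of_nonneg h0]
  have h1 : (onePlusI y).arg < Real.pi / 2 := by
    have := (Complex.abs_arg_lt_pi_div_two_iff (z := onePlusI y)).2
      (Or.inl (by rw [onePlusI_re]; exact one_pos))
    exact (abs_lt.1 this).2
  have h2 : Real.tan (onePlusI y).arg = y := by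
    rw [Complex.tan_arg, onePlusI_re, onePlusI_im, div_one]
  calc (onePlusI y).arg ≤ Real.tan (onePlusI y).arg := Real.le_tan h0 h1
    _ = y := h2

lemma onePlusIPow_re_im (s y : ℝ) :
    (onePlusIPow s y).re = ‖onePlusIPow s y‖ * Real.cos (s * (onePlusI y).arg) ∧
    (onePlusIPow s y).im = ‖onePlusIPow s y‖ * Real.sin (s * (onePlusI y).arg) := by
  have h : onePlusIPow s y = ((‖onePlusI y‖ ^ s : ℝ) : ℂ) *
      Complex.exp (((s * (onePlusI y).arg : ℝ) : ℂ) * Complex.I) := by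
    rw [onePlusIPow, Complex.cpow_def_of_ne_zero (onePlusI_ne_zero y), Complex.log,
      Real.rpow_def_of_pos (norm_pos_iff.2 (onePlusI_ne_zero y)), Complex.ofReal_exp,
      ← Complex.exp_add]
    congr 1
    push_cast
    ring
  rw [norm_onePlusIPow]
  constructor
  · rw [h, Complex.re_ofReal_mul, Complex.exp_ofReal_mul_I_re]
  · rw [h, Complex.im_ofReal_mul, Complex.exp_ofReal_mul_I_im]

/-- The argument of (1 + iy)^{-a} is at most (1/4)(π/2) < π/3 in modulus. All values lie in a narrow
cone, so averaging them produces no cancellation. -/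
lemma half_norm_le_re_onePlusIPow {a : ℝ} (ha : 0 ≤ a) (ha' : a ≤ 1 / 4) (y : ℝ) :
    ‖onePlusIPow (-a) y‖ / 2 ≤ (onePlusIPow (-a) y).re := by
  rw [(onePlusIPow_re_im (-a) y).1]
  have h1 : |(onePlusI y).arg| ≤ Real.pi / 2 := by
    rw [Complex.abs_arg_le_pi_div_two_iff, onePlusI_re]; exact zero_le_one
  have h2 : 1 / 2 ≤ Real.cos (-a * (onePlusI y).arg) := by
    rw [← Real.cos_pi_div_three, ← Real.cos_abs (-a * _)]
    apply Real.cos_le_cos_of_nonneg_of_le_pi (abs_nonneg _)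
    · linarith [Real.pi_pos]
    · rw [abs_mul, abs_neg, abs_of_nonneg ha]
      have : a * |(onePlusI y).arg| ≤ 1 / 4 * (Real.pi / 2) := by gcongr
      linarith [Real.pi_pos]
  nlinarith [norm_nonneg (onePlusIPow (-a) y)]

/-- The bound rests on arg(1 + iy) ≤ tan arg(1 + iy) = y; the exponent supplies the factor a. -/
lemma abs_im_onePlusIPow_le {a y : ℝ} (ha : 0 ≤ a) (hy : 0 ≤ y) :
    |(onePlusIPow (-a) y).im| ≤ a * y := by
  rw [(onePlusIPow_re_im (-a) y).2, abs_mul, abs_of_nonneg (norm_nonneg _)]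
  have h1 := norm_onePlusIPow_le_one (neg_nonpos.2 ha) y
  have h2 : |Real.sin (-a * (onePlusI y).arg)| ≤ a * y := by
    refine Real.abs_sin_le_abs.trans ?_
    rw [abs_mul, abs_neg, abs_of_nonneg ha]
    gcongr
    exact abs_arg_onePlusI_le hy
  calc _ ≤ 1 * (a * y) := by gcongr
    _ = _ := one_mul _

lemma one_sub_sq_le_norm_onePlusIPow {a : ℝ} (ha' : a ≤ 1) (y : ℝ) :
    1 - y ^ 2 ≤ ‖onePlusIPow (-a) y‖ := by
  rw [norm_onePlusIPow]
  have h1 : ‖onePlusI y‖ ^ (-2 : ℝ) ≤ ‖onePlusI y‖ ^ (-a) :=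
    Real.rpow_le_rpow_of_exponent_le (one_le_norm_onePlusI y) (by linarith)
  refine le_trans ?_ h1
  rw [Real.rpow_neg (norm_nonneg _), Real.rpow_two, norm_sq_onePlusI, ← one_div,
    le_div_iff₀ (by positivity)]
  nlinarith [sq_nonneg (y ^ 2)]

lemma norm_onePlusIPow_le_rpow {a y : ℝ} (ha : 0 ≤ a) (hy : 0 < y) :
    ‖onePlusIPow (-a) y‖ ≤ y ^ (-a) := by
  rw [norm_onePlusIPow]
  exact Real.rpow_le_rpow_of_nonpos hy (le_norm_onePlusI y) (by linarith)

/-! ### The Gamma distribution -/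

/-- The Gamma distribution of shape `1 - a`. -/
def gammaLaw (a : ℝ) : Measure ℝ :=
  (volume.restrict (Ioi (0 : ℝ))).withDensity
    (fun t => ENNReal.ofReal ((Real.Gamma (1 - a))⁻¹ * (Real.exp (-t) * t ^ (-a))))

lemma measurable_gammaDensity (a : ℝ) :
    Measurable fun t : ℝ => (Real.Gamma (1 - a))⁻¹ * (Real.exp (-t) * t ^ (-a)) := by
  fun_prop

lemma gammaDensity_nonneg {a t : ℝ} (ha : a < 1) (ht : 0 < t) :
    0 ≤ (Real.Gamma (1 - a))⁻¹ * (Real.exp (-t) * t ^ (-a)) := by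
  have := Real.Gamma_pos_of_pos (show 0 < 1 - a by linarith)
  positivity

section
variable {E : Type*} [NormedAddCommGroup E] [NormedSpace ℝ E]

lemma integral_gammaLaw {a : ℝ} (ha : a < 1) (F : ℝ → E) :
    ∫ t, F t ∂(gammaLaw a) =
      (Real.Gamma (1 - a))⁻¹ • ∫ t in Ioi (0 : ℝ), (Real.exp (-t) * t ^ (-a)) • F t := by
  rw [gammaLaw, integral_withDensity_eq_integral_toReal_smul
    (measurable_gammaDensity a).ennreal_ofReal (by simp), ← integral_smul]
  refine setIntegral_congr_fun measurableSet_Ioi fun t ht => ?_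
  rw [ENNReal.toReal_ofReal (gammaDensity_nonneg ha ht), mul_smul]

lemma integrable_gammaLaw_iff {a : ℝ} (ha : a < 1) (F : ℝ → E) :
    Integrable F (gammaLaw a) ↔
      IntegrableOn (fun t => (Real.exp (-t) * t ^ (-a)) • F t) (Ioi 0) := by
  rw [gammaLaw, integrable_withDensity_iff_integrable_smul'
    (measurable_gammaDensity a).ennreal_ofReal (by simp)]
  have hG : (Real.Gamma (1 - a))⁻¹ ≠ 0 :=
    inv_ne_zero (Real.Gamma_pos_of_pos (show 0 < 1 - a by linarith)).ne'
  rw [IntegrableOn, ← integrable_fun_smul_iff (μ := volume.restrict (Ioi 0)) hG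
    (fun t => (Real.exp (-t) * t ^ (-a)) • F t)]
  refine integrable_congr ?_
  filter_upwards [ae_restrict_mem measurableSet_Ioi] with t ht
  rw [ENNReal.toReal_ofReal (gammaDensity_nonneg ha ht), mul_smul]

end

lemma ae_gammaLaw_pos (a : ℝ) : ∀ᵐ t ∂(gammaLaw a), 0 < t :=
  (withDensity_absolutelyContinuous _ _).ae_le (ae_restrict_mem measurableSet_Ioi)

lemma integrable_gammaLaw_rpow {a u : ℝ} (ha : a < 1) (hu : 0 < 1 - a + u) :
    Integrable (fun t : ℝ => t ^ u) (gammaLaw a) := by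
  rw [integrable_gammaLaw_iff ha]
  refine (Real.GammaIntegral_convergent hu).congr_fun (fun t ht => ?_) measurableSet_Ioi
  simp only [smul_eq_mul]
  rw [mul_assoc, ← Real.rpow_add ht]
  congr 2; ring

lemma integral_gammaLaw_rpow {a u : ℝ} (ha : a < 1) (hu : 0 < 1 - a + u) :
    ∫ t : ℝ, t ^ u ∂(gammaLaw a) = Real.Gamma (1 - a + u) / Real.Gamma (1 - a) := by
  rw [integral_gammaLaw ha, Real.Gamma_eq_integral hu, smul_eq_mul, div_eq_inv_mul]
  congr 1
  refine setIntegral_congr_fun measurableSet_Ioi (fun t ht => ?_)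
  simp only [smul_eq_mul]
  rw [mul_assoc, ← Real.rpow_add ht]
  congr 2; ring

lemma isProbabilityMeasure_gammaLaw {a : ℝ} (ha : a < 1) :
    IsProbabilityMeasure (gammaLaw a) := by
  have hG := Real.Gamma_pos_of_pos (show 0 < 1 - a by linarith)
  have h1 := integrable_gammaLaw_rpow (u := 0) ha (by linarith)
  have h2 := integral_gammaLaw_rpow (u := 0) ha (by linarith)
  simp only [Real.rpow_zero, add_zero, div_self hG.ne'] at h1 h2
  rw [integrable_const_iff_isFiniteMeasure one_ne_zero] at h1
  rw [integral_const, smul_eq_mul, mul_one] at h2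
  refine ⟨?_⟩
  rw [Measure.real] at h2
  rw [← ENNReal.ofReal_toReal (measure_ne_top (gammaLaw a) univ), h2, ENNReal.ofReal_one]

lemma integrable_gammaLaw_id {a : ℝ} (ha : a < 1) : Integrable (fun t : ℝ => t) (gammaLaw a) := by
  simpa using integrable_gammaLaw_rpow (u := 1) ha (by linarith)

lemma integrable_gammaLaw_sq {a : ℝ} (ha : a < 1) :
    Integrable (fun t : ℝ => t ^ 2) (gammaLaw a) := by
  simpa using integrable_gammaLaw_rpow (u := 2) ha (by linarith)

lemma integral_gammaLaw_id {a : ℝ} (ha : a < 1) : ∫ t : ℝ, t ∂(gammaLaw a) = 1 - a := by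
  have hG := Real.Gamma_pos_of_pos (show 0 < 1 - a by linarith)
  have h := integral_gammaLaw_rpow (u := 1) ha (by linarith)
  rw [Real.Gamma_add_one (by linarith), mul_div_cancel_right₀ _ hG.ne'] at h
  simpa using h

lemma integral_gammaLaw_sq {a : ℝ} (ha : a < 1) :
    ∫ t : ℝ, t ^ 2 ∂(gammaLaw a) = (2 - a) * (1 - a) := by
  have hG := Real.Gamma_pos_of_pos (show 0 < 1 - a by linarith)
  have h := integral_gammaLaw_rpow (u := 2) ha (by linarith)
  rw [show 1 - a + 2 = (1 - a + 1) + 1 by ring, Real.Gamma_add_one (by linarith),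
    Real.Gamma_add_one (by linarith), ← mul_assoc, mul_div_cancel_right₀ _ hG.ne'] at h
  rw [show (2 - a) = 1 - a + 1 by ring]
  simpa using h

end

noncomputable section
open MeasureTheory Filter Topology Set

/-! ### Amplitudes of the Hankel functions -/

/-- The slowly varying amplitude of `H^{(1)}_{1/2 - a}`. -/
def lowerAmp (a x : ℝ) : ℂ := ∫ t, onePlusIPow (-a) (t / (2 * x)) ∂(gammaLaw a)

/-- The slowly varying amplitude of `H^{(1)}_{3/2 - a}`. -/
def upperAmp (a x : ℝ) : ℂ :=
  (((1 - a)⁻¹ : ℝ) : ℂ) * ∫ t, (t : ℂ) * onePlusIPow (1 - a) (t / (2 * x)) ∂(gammaLaw a)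

/-- The first moment of the kernel of `lowerAmp`. -/
def lowerMoment (a x : ℝ) : ℂ := ∫ t, (t : ℂ) * onePlusIPow (-a) (t / (2 * x)) ∂(gammaLaw a)

/-- The kernel of the Euler derivative of `lowerAmp`. -/
def eulerKernel (a y : ℝ) : ℂ := (a : ℂ) * (onePlusIPow (-a - 1) y * (Complex.I * (y : ℂ)))

/-- The Euler derivative `x ∂ₓ` of `lowerAmp`. -/
def lowerEuler (a x : ℝ) : ℂ := ∫ t, eulerKernel a (t / (2 * x)) ∂(gammaLaw a)

lemma aestronglyMeasurable_onePlusIPow (s x : ℝ) (μ : Measure ℝ) :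
    AEStronglyMeasurable (fun t => onePlusIPow s (t / (2 * x))) μ :=
  ((continuous_onePlusIPow s).comp (continuous_id.div_const _)).aestronglyMeasurable

lemma integrable_onePlusIPow {a s : ℝ} (ha : a < 1) (hs : s ≤ 0) (x : ℝ) :
    Integrable (fun t => onePlusIPow s (t / (2 * x))) (gammaLaw a) := by
  have := isProbabilityMeasure_gammaLaw ha
  exact Integrable.of_bound (aestronglyMeasurable_onePlusIPow s x _) 1
    (Eventually.of_forall fun t => norm_onePlusIPow_le_one hs _)

lemma integrable_mul_onePlusIPow {a s x : ℝ} (ha : a < 1) (hs : s ≤ 1) (hx : 0 < x) :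
    Integrable (fun t : ℝ => (t : ℂ) * onePlusIPow s (t / (2 * x))) (gammaLaw a) := by
  have hb : Integrable (fun t : ℝ => t + (2 * x)⁻¹ * t ^ 2) (gammaLaw a) :=
    (integrable_gammaLaw_id ha).add ((integrable_gammaLaw_sq ha).const_mul _)
  refine hb.mono' (Complex.continuous_ofReal.aestronglyMeasurable.mul
    (aestronglyMeasurable_onePlusIPow s x _)) ?_
  filter_upwards [ae_gammaLaw_pos a] with t ht
  rw [norm_mul, Complex.norm_real, Real.norm_of_nonneg ht.le]
  calc t * ‖onePlusIPow s (t / (2 * x))‖ ≤ t * (1 + t / (2 * x)) := by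
        gcongr; exact norm_onePlusIPow_le hs (by positivity)
    _ = _ := by field_simp

lemma continuous_eulerKernel (a : ℝ) : Continuous (eulerKernel a) := by
  unfold eulerKernel
  have := continuous_onePlusIPow (-a - 1)
  fun_prop

lemma eulerKernel_eq (a y : ℝ) :
    eulerKernel a y = (a : ℂ) * (onePlusIPow (-a) y * (Complex.I * y / onePlusI y)) := by
  have h : onePlusIPow (-a) y = onePlusIPow (-a - 1) y * onePlusI y := by
    rw [← onePlusIPow_one, ← onePlusIPow_add]; congr 1; ring
  rw [eulerKernel, h]
  have := onePlusI_ne_zero y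
  field_simp

lemma norm_eulerKernel_le {a y : ℝ} (ha : 0 ≤ a) (hy : 0 ≤ y) :
    ‖eulerKernel a y‖ ≤ a * ‖onePlusIPow (-a) y‖ := by
  rw [eulerKernel_eq, norm_mul, norm_mul, Complex.norm_real, Real.norm_of_nonneg ha]
  have h : ‖Complex.I * y / onePlusI y‖ ≤ 1 := by
    rw [norm_div, norm_mul, Complex.norm_I, Complex.norm_real, Real.norm_of_nonneg hy, one_mul]
    exact div_le_one_of_le₀ (le_norm_onePlusI y) (norm_nonneg _)
  gcongr
  exact mul_le_of_le_one_right (norm_nonneg _) h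

lemma norm_eulerKernel_le' {a y : ℝ} (ha : 0 ≤ a) (hy : 0 ≤ y) :
    ‖eulerKernel a y‖ ≤ a * y := by
  rw [eulerKernel, norm_mul, norm_mul, norm_mul, Complex.norm_I, Complex.norm_real,
    Complex.norm_real, Real.norm_of_nonneg ha, Real.norm_of_nonneg hy, one_mul]
  gcongr
  exact mul_le_of_le_one_left hy (norm_onePlusIPow_le_one (by linarith) y)

/-- Since iy/(1 + iy) = (y² + iy)/(1 + y²), the real part pairs Re with y² and Im, itself O(ay),
with y. The gain of one order in y over the modulus gives the decay a/x² of x ∂ₓQ at large x. -/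
lemma abs_re_eulerKernel_le {a y : ℝ} (ha : 0 ≤ a) (ha' : a ≤ 1) (hy : 0 ≤ y) :
    |(eulerKernel a y).re| ≤ 2 * a * y ^ 2 := by
  have h0 : eulerKernel a y = ((a / (1 + y ^ 2) : ℝ) : ℂ) *
      (onePlusIPow (-a) y * ⟨y ^ 2, y⟩) := by
    have h1 : Complex.I * y / onePlusI y = ((1 / (1 + y ^ 2) : ℝ) : ℂ) * ⟨y ^ 2, y⟩ := by
      rw [div_eq_iff (onePlusI_ne_zero y)]
      have hy2 : 1 + y ^ 2 ≠ 0 := by positivity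
      apply Complex.ext
      · rw [mul_assoc, Complex.re_ofReal_mul]
        simp [onePlusI]; ring_nf; simp
      · rw [mul_assoc, Complex.im_ofReal_mul]
        simp [onePlusI]; field_simp; ring
    rw [eulerKernel_eq, h1]
    push_cast; ring
  have h1 := norm_onePlusIPow_le_one (neg_nonpos.2 ha) y
  have h2 := (Complex.abs_re_le_norm (onePlusIPow (-a) y)).trans h1
  have h3 := abs_im_onePlusIPow_le ha hy
  rw [h0, Complex.re_ofReal_mul, abs_mul, abs_of_nonneg (by positivity), Complex.mul_re]
  have h4 : a / (1 + y ^ 2) ≤ a := div_le_self ha (by nlinarith [sq_nonneg y])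
  have h5 : |(onePlusIPow (-a) y).re * y ^ 2 - (onePlusIPow (-a) y).im * y| ≤ 2 * y ^ 2 := by
    refine (abs_sub _ _).trans ?_
    rw [abs_mul, abs_mul, abs_of_nonneg hy, abs_of_nonneg (sq_nonneg y)]
    have : |(onePlusIPow (-a) y).re| * y ^ 2 ≤ 1 * y ^ 2 := by gcongr
    have : |(onePlusIPow (-a) y).im| * y ≤ a * y * y := by gcongr
    nlinarith [sq_nonneg y]
  calc _ ≤ a * (2 * y ^ 2) := by gcongr
    _ = _ := by ring

lemma integrable_eulerKernel {a : ℝ} (ha : 0 ≤ a) (ha' : a < 1) {x : ℝ} (hx : 0 < x) :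
    Integrable (fun t => eulerKernel a (t / (2 * x))) (gammaLaw a) := by
  have := isProbabilityMeasure_gammaLaw ha'
  refine Integrable.of_bound (((continuous_eulerKernel a).comp
    (continuous_id.div_const _)).aestronglyMeasurable) a ?_
  filter_upwards [ae_gammaLaw_pos a] with t ht
  refine (norm_eulerKernel_le ha (by positivity)).trans ?_
  exact mul_le_of_le_one_right ha (norm_onePlusIPow_le_one (by linarith) _)

lemma integral_sub_add {μ : Measure ℝ} {f g h : ℝ → ℂ} (hf : Integrable f μ)
    (hg : Integrable g μ) (hh : Integrable h μ) :
    ∫ t, (f t - g t + h t) ∂μ = ∫ t, f t ∂μ - ∫ t, g t ∂μ + ∫ t, h t ∂μ := by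
  rw [integral_add (f := fun t => f t - g t) (hf.sub hg) hh, integral_sub hf hg]

/-- Integration by parts against the Gamma distribution. -/
lemma integral_gammaLaw_by_parts {a s x : ℝ} (ha : a < 1) (hs : s ≤ 1) (hx : 0 < x) :
    ∫ t : ℝ, (((1 - a : ℝ) : ℂ) * onePlusIPow s (t / (2 * x)) -
        (t : ℂ) * onePlusIPow s (t / (2 * x)) +
        (t : ℂ) * onePlusIPow (s - 1) (t / (2 * x)) * (s * Complex.I / (2 * x)))
      ∂(gammaLaw a) = 0 := by
  have hint1 : Integrable (fun t => onePlusIPow s (t / (2 * x))) (gammaLaw a) := by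
    have := isProbabilityMeasure_gammaLaw ha
    have hb : Integrable (fun t : ℝ => 1 + (2 * x)⁻¹ * t) (gammaLaw a) :=
      (integrable_const _).add ((integrable_gammaLaw_id ha).const_mul _)
    refine hb.mono' (aestronglyMeasurable_onePlusIPow s x _) ?_
    filter_upwards [ae_gammaLaw_pos a] with t ht
    refine (norm_onePlusIPow_le hs (by positivity)).trans (le_of_eq ?_)
    field_simp
  have hint : Integrable (fun t : ℝ => ((1 - a : ℝ) : ℂ) * onePlusIPow s (t / (2 * x)) -
        (t : ℂ) * onePlusIPow s (t / (2 * x)) +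
        (t : ℂ) * onePlusIPow (s - 1) (t / (2 * x)) * (s * Complex.I / (2 * x))) (gammaLaw a) :=
    ((hint1.const_mul _).sub (integrable_mul_onePlusIPow ha hs hx)).add
      ((integrable_mul_onePlusIPow ha (by linarith) hx).mul_const _)
  rw [integral_gammaLaw ha]
  rw [integrable_gammaLaw_iff ha] at hint
  -- Up to normalization, the integrand is the derivative of e^{-t} t^{1-a} (1 + it/(2x))^s, which
  -- vanishes at 0 because a < 1 and at infinity because s ≤ 1 allows at most linear growth of the
  -- power.
  have hF : ∀ t ∈ Ioi (0 : ℝ), HasDerivAt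
      (fun t : ℝ => ((Real.exp (-t) * t ^ (1 - a) : ℝ) : ℂ) * onePlusIPow s (t / (2 * x)))
      ((Real.exp (-t) * t ^ (-a)) • (((1 - a : ℝ) : ℂ) * onePlusIPow s (t / (2 * x)) -
        (t : ℂ) * onePlusIPow s (t / (2 * x)) +
        (t : ℂ) * onePlusIPow (s - 1) (t / (2 * x)) * (s * Complex.I / (2 * x)))) t := by
    intro t ht
    have ht' : (0 : ℝ) < t := ht
    have h1 : HasDerivAt (fun t : ℝ => Real.exp (-t) * t ^ (1 - a))
        (Real.exp (-t) * -1 * t ^ (1 - a) + Real.exp (-t) * ((1 - a) * t ^ (1 - a - 1))) t :=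
      ((hasDerivAt_neg t).exp).mul (Real.hasDerivAt_rpow_const (Or.inl ht'.ne'))
    have h2 : HasDerivAt (fun t : ℝ => onePlusIPow s (t / (2 * x)))
        (((2 * x)⁻¹ : ℝ) • ((s : ℂ) * onePlusIPow (s - 1) (t / (2 * x)) * Complex.I)) t := by
      have h3 : HasDerivAt (fun t : ℝ => t / (2 * x)) ((2 * x)⁻¹) t := by
        simpa using (hasDerivAt_id t).div_const (2 * x)
      exact (hasDerivAt_onePlusIPow s (t / (2 * x))).scomp t h3
    refine (h1.ofReal_comp.mul h2).congr_deriv ?_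
    have h4 : t ^ (1 - a) = t ^ (-a) * t := by
      rw [← Real.rpow_add_one ht'.ne']; congr 1; ring
    have h5 : 1 - a - 1 = -a := by ring
    rw [h5, h4]
    simp only [Complex.real_smul]
    push_cast
    have : (x : ℂ) ≠ 0 := by exact_mod_cast hx.ne'
    field_simp
    ring
  have hcont : ContinuousWithinAt
      (fun t : ℝ => ((Real.exp (-t) * t ^ (1 - a) : ℝ) : ℂ) * onePlusIPow s (t / (2 * x)))
      (Ici 0) 0 := by
    have h1 : Continuous (fun t : ℝ => t ^ (1 - a)) :=
      Real.continuous_rpow_const (by linarith)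
    have h2 := (continuous_onePlusIPow s).comp (continuous_id.div_const (2 * x))
    have h3 : Continuous (fun t : ℝ => ((Real.exp (-t) * t ^ (1 - a) : ℝ) : ℂ) *
        onePlusIPow s (t / (2 * x))) :=
      (Complex.continuous_ofReal.comp ((Real.continuous_exp.comp continuous_neg).mul h1)).mul h2
    exact h3.continuousWithinAt
  have hlim : Tendsto
      (fun t : ℝ => ((Real.exp (-t) * t ^ (1 - a) : ℝ) : ℂ) * onePlusIPow s (t / (2 * x)))
      atTop (𝓝 0) := by
    have hb : Tendsto (fun t : ℝ => t ^ (1 - a) * Real.exp (-1 * t) +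
        (2 * x)⁻¹ * (t ^ (2 - a) * Real.exp (-1 * t))) atTop (𝓝 0) := by
      simpa using (tendsto_rpow_mul_exp_neg_mul_atTop_nhds_zero (1 - a) 1 one_pos).add
        ((tendsto_rpow_mul_exp_neg_mul_atTop_nhds_zero (2 - a) 1 one_pos).const_mul _)
    refine squeeze_zero_norm' ?_ hb
    filter_upwards [eventually_gt_atTop 0] with t ht
    rw [norm_mul, Complex.norm_real, Real.norm_of_nonneg (by positivity)]
    have h4 : t ^ (2 - a) = t ^ (1 - a) * t := by
      rw [← Real.rpow_add_one ht.ne']; congr 1; ring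
    calc _ ≤ Real.exp (-t) * t ^ (1 - a) * (1 + t / (2 * x)) := by
          gcongr; exact norm_onePlusIPow_le hs (by positivity)
      _ = _ := by rw [h4, neg_one_mul]; field_simp
  have key := integral_Ioi_of_hasDerivAt_of_tendsto hcont hF hint hlim
  rw [key]
  simp [Real.zero_rpow (show 1 - a ≠ 0 by linarith)]

/-- Integration by parts with exponent -a; differentiating the power yields minus the Euler kernel.
-/
lemma lowerMoment_eq {a x : ℝ} (ha : 0 ≤ a) (ha' : a < 1) (hx : 0 < x) :
    lowerMoment a x = ((1 - a : ℝ) : ℂ) * lowerAmp a x - lowerEuler a x := by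
  have h := integral_gammaLaw_by_parts (s := -a) ha' (by linarith) hx
  have hx' : (x : ℂ) ≠ 0 := by exact_mod_cast hx.ne'
  have e : ∀ t : ℝ, (t : ℂ) * onePlusIPow (-a - 1) (t / (2 * x)) *
      (((-a : ℝ) : ℂ) * Complex.I / (2 * x)) = - eulerKernel a (t / (2 * x)) := by
    intro t
    rw [eulerKernel]; push_cast; field_simp
  simp only [e] at h
  rw [integral_sub_add ((integrable_onePlusIPow ha' (by linarith) x).const_mul _)
      (integrable_mul_onePlusIPow ha' (by linarith) hx)
      (h := fun t => - eulerKernel a (t / (2 * x))) (integrable_eulerKernel ha ha' hx).neg,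
    integral_neg, integral_const_mul] at h
  unfold lowerMoment lowerAmp lowerEuler
  linear_combination -h

/-- Integration by parts with exponent 1 - a, combined with (1 + iy)^{1-a} = (1 + iy)^{-a}(1 + iy).
Everything about K is thereby reduced to moments of the kernel of G. -/
lemma upperAmp_eq {a x : ℝ} (ha : 0 ≤ a) (ha' : a < 1) (hx : 0 < x) :
    upperAmp a x = lowerAmp a x + Complex.I / x * lowerMoment a x := by
  have h := integral_gammaLaw_by_parts (s := 1 - a) ha' (by linarith) hx
  have hx' : (x : ℂ) ≠ 0 := by exact_mod_cast hx.ne'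
  have ha1 : ((1 - a : ℝ) : ℂ) ≠ 0 := by
    exact_mod_cast (show (1 - a : ℝ) ≠ 0 by linarith)
  have e : ∀ t : ℝ, onePlusIPow (1 - a) (t / (2 * x)) =
      onePlusIPow (-a) (t / (2 * x)) + (2 * x : ℂ)⁻¹ * Complex.I *
        ((t : ℂ) * onePlusIPow (-a) (t / (2 * x))) := by
    intro t
    rw [show 1 - a = -a + 1 by ring, onePlusIPow_add, onePlusIPow_one, onePlusI]
    push_cast; field_simp
  have hi := integrable_onePlusIPow (a := a) (s := -a) ha' (by linarith) x
  have hj := integrable_mul_onePlusIPow (a := a) (s := -a) ha' (by linarith) hx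
  have hk : ∫ t : ℝ, onePlusIPow (1 - a) (t / (2 * x)) ∂(gammaLaw a) =
      lowerAmp a x + (2 * x : ℂ)⁻¹ * Complex.I * lowerMoment a x := by
    simp only [e]
    rw [integral_add hi (hj.const_mul _), integral_const_mul]
    rfl
  have hl : Integrable (fun t => onePlusIPow (1 - a) (t / (2 * x))) (gammaLaw a) := by
    simp only [e]
    exact hi.add (hj.const_mul _)
  have hs : (1 - a - 1 : ℝ) = -a := by ring
  rw [hs] at h
  have hm := integrable_mul_onePlusIPow (a := a) (s := 1 - a) ha' (by linarith) hx
  rw [integral_sub_add (hl.const_mul _) hm (hj.mul_const _), integral_const_mul, integral_mul_const, hk] at h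
  unfold upperAmp
  rw [Complex.ofReal_inv, inv_mul_eq_iff_eq_mul₀ ha1]
  have hn : ∫ t : ℝ, (t : ℂ) * onePlusIPow (-a) (t / (2 * x)) ∂(gammaLaw a) =
    lowerMoment a x := rfl
  rw [hn] at h
  generalize (1 - a : ℝ) = b at *
  field_simp at h ⊢
  linear_combination -h / 2

end

/-! ### Differential equations and asymptotics of the amplitudes -/

noncomputable section
open MeasureTheory Filter Topology Set

lemma hasDerivAt_div_two_mul {t x : ℝ} (hx : x ≠ 0) :
    HasDerivAt (fun x : ℝ => t / (2 * x)) (-(t / (2 * x)) / x) x := by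
  have h := ((hasDerivAt_inv hx).const_mul (t / 2))
  refine (h.congr_deriv ?_).congr_of_eventuallyEq ?_
  · field_simp
  · exact Eventually.of_forall fun y => by simp only; rw [div_mul_eq_div_div, div_eq_mul_inv _ y]

lemma hasDerivAt_lowerAmp {a x : ℝ} (ha : 0 ≤ a) (ha' : a < 1) (hx : 0 < x) :
    HasDerivAt (lowerAmp a) ((x : ℂ)⁻¹ * lowerEuler a x) x := by
  have hprob := isProbabilityMeasure_gammaLaw ha'
  have h := hasDerivAt_integral_of_dominated_loc_of_deriv_le (𝕜 := ℝ) (μ := gammaLaw a)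
    (F := fun x t => onePlusIPow (-a) (t / (2 * x)))
    (F' := fun x t => (x : ℂ)⁻¹ * eulerKernel a (t / (2 * x)))
    (bound := fun _ => (x / 2)⁻¹ * a) (x₀ := x) (Ioi_mem_nhds (half_lt_self hx))
    (Eventually.of_forall fun y => aestronglyMeasurable_onePlusIPow _ _ _)
    (integrable_onePlusIPow ha' (by linarith) x)
    (((continuous_eulerKernel a).comp
      (continuous_id.div_const _)).aestronglyMeasurable.const_mul _) ?_
    (integrable_const _) ?_
  · rw [integral_const_mul] at h
    exact h.2
  · filter_upwards [ae_gammaLaw_pos a] with t ht y hy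
    have hy' : x / 2 < y := hy
    have hy0 : 0 < y := by linarith
    rw [norm_mul, norm_inv, Complex.norm_real, Real.norm_of_nonneg hy0.le]
    gcongr
    refine (norm_eulerKernel_le ha (by positivity)).trans ?_
    exact mul_le_of_le_one_right ha (norm_onePlusIPow_le_one (by linarith) _)
  · filter_upwards with t y hy
    have hy' : x / 2 < y := hy
    have hy0 : y ≠ 0 := by linarith
    refine ((hasDerivAt_onePlusIPow (-a) (t / (2 * y))).scomp y
      (hasDerivAt_div_two_mul hy0)).congr_deriv ?_
    rw [eulerKernel, Complex.real_smul]
    have : (y : ℂ) ≠ 0 := by exact_mod_cast hy0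
    push_cast; field_simp

/-- Eliminating `lowerEuler` closes (G, K) into a linear first-order system: the Hankel recurrences
with phase and √x split off. -/
lemma hasDerivAt_lowerAmp' {a x : ℝ} (ha : 0 ≤ a) (ha' : a < 1) (hx : 0 < x) :
    HasDerivAt (lowerAmp a) (((1 - a : ℝ) : ℂ) / x * lowerAmp a x +
      Complex.I * (upperAmp a x - lowerAmp a x)) x := by
  refine (hasDerivAt_lowerAmp ha ha' hx).congr_deriv ?_
  have hx' : (x : ℂ) ≠ 0 := by exact_mod_cast hx.ne'
  rw [upperAmp_eq ha ha' hx, lowerMoment_eq ha ha' hx]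
  field_simp
  linear_combination (((1 - a : ℝ) : ℂ) * lowerAmp a x - lowerEuler a x) * (-Complex.I_sq)

lemma hasDerivAt_upperAmp {a x : ℝ} (ha : 0 ≤ a) (ha' : a < 1) (hx : 0 < x) :
    HasDerivAt (upperAmp a) (-(((1 - a : ℝ) : ℂ) / x) * upperAmp a x +
      Complex.I * (lowerAmp a x - upperAmp a x)) x := by
  have hx' : (x : ℂ) ≠ 0 := by exact_mod_cast hx.ne'
  have hb : (1 - (a : ℂ)) ≠ 0 := by
    exact_mod_cast (show (1 - a : ℝ) ≠ 0 by linarith)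
  have hm := integrable_mul_onePlusIPow (a := a) (s := 1 - a) ha' (by linarith) hx
  have h := hasDerivAt_integral_of_dominated_loc_of_deriv_le (𝕜 := ℝ) (μ := gammaLaw a)
    (F := fun x t => (t : ℂ) * onePlusIPow (1 - a) (t / (2 * x)))
    (F' := fun x t => (1 - a : ℂ) / x * ((t : ℂ) * onePlusIPow (-a) (t / (2 * x)) -
      (t : ℂ) * onePlusIPow (1 - a) (t / (2 * x))))
    (bound := fun t => (1 - a) / (2 * (x / 2) * (x / 2)) * t ^ 2) (x₀ := x)
    (Ioi_mem_nhds (half_lt_self hx))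
    (Eventually.of_forall fun y => Complex.continuous_ofReal.aestronglyMeasurable.mul
      (aestronglyMeasurable_onePlusIPow _ _ _))
    hm
    (((Complex.continuous_ofReal.aestronglyMeasurable.mul
      (aestronglyMeasurable_onePlusIPow _ _ _)).sub
      (Complex.continuous_ofReal.aestronglyMeasurable.mul
      (aestronglyMeasurable_onePlusIPow _ _ _))).const_mul _) ?_
    ((integrable_gammaLaw_sq ha').const_mul _) ?_
  · have h2 := h.2.const_mul (((1 - a)⁻¹ : ℝ) : ℂ)
    refine HasDerivAt.congr_deriv (f := upperAmp a) h2 ?_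
    rw [integral_const_mul, integral_sub
      (integrable_mul_onePlusIPow ha' (by linarith) hx) hm]
    have e1 : ∫ t, (t : ℂ) * onePlusIPow (1 - a) (t / (2 * x)) ∂(gammaLaw a) =
        (1 - a : ℂ) * upperAmp a x := by
      rw [upperAmp]; push_cast; field_simp
    have e2 : ∫ t, (t : ℂ) * onePlusIPow (-a) (t / (2 * x)) ∂(gammaLaw a) =
        -Complex.I * x * (upperAmp a x - lowerAmp a x) := by
      rw [upperAmp_eq ha ha' hx]
      change lowerMoment a x = _
      field_simp
      linear_combination lowerMoment a x * Complex.I_sq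
    rw [e1, e2]
    push_cast
    field_simp
    ring
  · filter_upwards [ae_gammaLaw_pos a] with t ht y hy
    have hy' : x / 2 < y := hy
    have hy0 : 0 < y := by linarith
    -- The two powers differ by the factor 1 + it/(2y), so their difference carries one more t and
    -- is dominated by a multiple of t², uniformly for y > x/2.
    have h1 : (t : ℂ) * onePlusIPow (-a) (t / (2 * y)) -
      (t : ℂ) * onePlusIPow (1 - a) (t / (2 * y)) = -((t : ℂ) * onePlusIPow (-a) (t / (2 * y)) *
        (Complex.I * ((t / (2 * y) : ℝ) : ℂ))) := by
      rw [show 1 - a = -a + 1 by ring, onePlusIPow_add, onePlusIPow_one, onePlusI]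
      ring
    rw [h1]
    have h2 : ((1 - a : ℂ) / y) = (((1 - a) / y : ℝ) : ℂ) := by push_cast; rfl
    have h3 := norm_onePlusIPow_le_one (s := -a) (by linarith) (t / (2 * y))
    have h4 : 0 ≤ 1 - a := by linarith
    rw [h2, norm_mul, norm_neg, norm_mul, norm_mul, norm_mul, Complex.norm_I, one_mul,
      Complex.norm_real, Complex.norm_real, Complex.norm_real, Real.norm_of_nonneg ht.le,
      Real.norm_of_nonneg (by positivity), Real.norm_of_nonneg (by positivity)]
    calc (1 - a) / y * (t * ‖onePlusIPow (-a) (t / (2 * y))‖ * (t / (2 * y)))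
        ≤ (1 - a) / y * (t * 1 * (t / (2 * y))) := by gcongr
      _ = (1 - a) / (2 * y * y) * t ^ 2 := by field_simp
      _ ≤ _ := by gcongr
  · filter_upwards with t y hy
    have hy' : x / 2 < y := hy
    have hy0 : y ≠ 0 := by linarith
    refine (((hasDerivAt_onePlusIPow (1 - a) (t / (2 * y))).scomp y
      (hasDerivAt_div_two_mul hy0)).const_mul (t : ℂ)).congr_deriv ?_
    rw [show 1 - a - 1 = -a by ring, show onePlusIPow (1 - a) (t / (2 * y)) =
      onePlusIPow (-a) (t / (2 * y)) * onePlusI (t / (2 * y)) by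
        rw [show 1 - a = -a + 1 by ring, onePlusIPow_add, onePlusIPow_one], onePlusI,
      Complex.real_smul]
    have : (y : ℂ) ≠ 0 := by exact_mod_cast hy0
    push_cast; field_simp; ring

lemma tendsto_lowerAmp {a : ℝ} (ha : 0 ≤ a) (ha' : a < 1) :
    Tendsto (lowerAmp a) atTop (𝓝 1) := by
  have hprob := isProbabilityMeasure_gammaLaw ha'
  have h := tendsto_integral_filter_of_dominated_convergence (μ := gammaLaw a) (l := atTop)
    (F := fun x t => onePlusIPow (-a) (t / (2 * x))) (f := fun _ => (1 : ℂ)) (fun _ => 1)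
    (Eventually.of_forall fun x => aestronglyMeasurable_onePlusIPow _ _ _)
    (Eventually.of_forall fun x => Eventually.of_forall fun t =>
      norm_onePlusIPow_le_one (by linarith) _)
    (integrable_const _) (Eventually.of_forall fun t => ?_)
  · rw [integral_const, probReal_univ, one_smul] at h
    exact h
  · rw [← onePlusIPow_zero_right (-a)]
    refine ((continuous_onePlusIPow (-a)).tendsto 0).comp ?_
    have h1 : Tendsto (fun x : ℝ => 2 * x) atTop atTop :=
      tendsto_id.const_mul_atTop two_pos
    exact tendsto_const_nhds.div_atTop h1

lemma norm_lowerAmp_le_one {a : ℝ} (ha : 0 ≤ a) (ha' : a < 1) (x : ℝ) : ‖lowerAmp a x‖ ≤ 1 := by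
  have hprob := isProbabilityMeasure_gammaLaw ha'
  refine (norm_integral_le_of_norm_le_const (C := 1)
    (Eventually.of_forall fun t => norm_onePlusIPow_le_one (by linarith) _)).trans ?_
  simp

lemma norm_lowerMoment_le {a x : ℝ} (ha : 0 ≤ a) (ha' : a < 1) : ‖lowerMoment a x‖ ≤ 1 := by
  have h : ‖lowerMoment a x‖ ≤ ∫ t : ℝ, t ∂(gammaLaw a) := by
    refine norm_integral_le_of_norm_le (integrable_gammaLaw_id ha') ?_
    filter_upwards [ae_gammaLaw_pos a] with t ht
    rw [norm_mul, Complex.norm_real, Real.norm_of_nonneg ht.le]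
    exact mul_le_of_le_one_right ht.le (norm_onePlusIPow_le_one (by linarith) _)
  rw [integral_gammaLaw_id ha'] at h
  linarith

lemma tendsto_upperAmp {a : ℝ} (ha : 0 ≤ a) (ha' : a < 1) :
    Tendsto (upperAmp a) atTop (𝓝 1) := by
  have h1 : Tendsto (fun x : ℝ => Complex.I / x * lowerMoment a x) atTop (𝓝 0) := by
    refine squeeze_zero_norm' (a := fun x : ℝ => x⁻¹) ?_ tendsto_inv_atTop_zero
    filter_upwards [eventually_gt_atTop 0] with x hx
    rw [norm_mul, norm_div, Complex.norm_I, Complex.norm_real, Real.norm_of_nonneg hx.le, one_div]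
    exact mul_le_of_le_one_right (by positivity) (norm_lowerMoment_le ha ha')
  have h2 := (tendsto_lowerAmp ha ha').add h1
  rw [add_zero] at h2
  refine h2.congr' ?_
  filter_upwards [eventually_gt_atTop 0] with x hx
  rw [upperAmp_eq ha ha' hx]

/-- The Wronskian of the Hankel functions. -/
lemma re_upperAmp_mul_conj {a x : ℝ} (ha : 0 ≤ a) (ha' : a < 1) (hx : 0 < x) :
    (upperAmp a x * (starRingEnd ℂ) (lowerAmp a x)).re = 1 := by
  -- The system gives (K G*)' = i(|G|² - |K|²). The real part is therefore constant, and its value 1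
  -- is read off at infinity.
  have hd : ∀ y ∈ Ioi (0 : ℝ), HasDerivAt
      (fun y => (upperAmp a y * (starRingEnd ℂ) (lowerAmp a y)).re) 0 y := by
    intro y hy
    have h1 := hasDerivAt_upperAmp ha ha' hy
    have h2 := hasDerivAt_lowerAmp' ha ha' hy
    have h4 := (Complex.reCLM.hasFDerivAt.comp_hasDerivAt y (h1.mul h2.star))
    refine h4.congr_deriv ?_
    have hy' : y ≠ 0 := ne_of_gt hy
    generalize upperAmp a y = K
    generalize lowerAmp a y = G
    have e : ((1 - a : ℝ) : ℂ) / y = (((1 - a) / y : ℝ) : ℂ) := by push_cast; rfl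
    rw [e]
    simp
    ring
  have hconst : ∀ y ∈ Ioi (0 : ℝ), (upperAmp a y * (starRingEnd ℂ) (lowerAmp a y)).re =
      (upperAmp a x * (starRingEnd ℂ) (lowerAmp a x)).re := by
    intro y hy
    refine (convex_Ioi (0 : ℝ)).is_const_of_fderivWithin_eq_zero (𝕜 := ℝ)
      (fun z hz => (hd z hz).differentiableAt.differentiableWithinAt) (fun z hz => ?_) hy hx
    have h5 := (hd z hz).hasFDerivAt.hasFDerivWithinAt.fderivWithin
      (isOpen_Ioi.uniqueDiffWithinAt hz)
    rw [h5]
    ext; simp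
  have hlim : Tendsto (fun y => (upperAmp a y * (starRingEnd ℂ) (lowerAmp a y)).re) atTop
      (𝓝 1) := by
    have h := (Complex.continuous_re.tendsto _).comp ((tendsto_upperAmp ha ha').mul
      ((Complex.continuous_conj.tendsto _).comp (tendsto_lowerAmp ha ha')))
    simpa [Function.comp_def] using h
  refine tendsto_nhds_unique (tendsto_const_nhds.congr' ?_) hlim
  filter_upwards [eventually_gt_atTop 0] with y hy
  exact (hconst y hy).symm

/-! ### Modulus functions -/

/-- The modulus function `(π / 2) x |H^{(1)}_{1/2 - a}(x)|²`. -/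
def modQ (a x : ℝ) : ℝ := ‖lowerAmp a x‖ ^ 2

/-- The modulus function `(π / 2) x |H^{(1)}_{3/2 - a}(x)|²`. -/
def modP (a x : ℝ) : ℝ := ‖upperAmp a x‖ ^ 2

/-- The mixed function `(π / 2) x Re (H^{(1)}_{3/2 - a}(x) H^{(2)}_{1/2 - a}(x))`. -/
def modC (a x : ℝ) : ℝ := (upperAmp a x * (starRingEnd ℂ) (lowerAmp a x)).im

lemma norm_sq_eq_re_sq_add_im_sq (z : ℂ) : ‖z‖ ^ 2 = z.re * z.re + z.im * z.im := by
  rw [← Complex.normSq_eq_norm_sq, Complex.normSq_apply]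

/-- Both sides are |K G*|², whose real part is 1 by the Wronskian. Hence P is determined by Q and C,
and only G has to be estimated. -/
lemma modP_mul_modQ {a x : ℝ} (ha : 0 ≤ a) (ha' : a < 1) (hx : 0 < x) :
    modP a x * modQ a x = 1 + modC a x ^ 2 := by
  have h := re_upperAmp_mul_conj ha ha' hx
  have h2 : modP a x * modQ a x =
      ‖upperAmp a x * (starRingEnd ℂ) (lowerAmp a x)‖ ^ 2 := by
    rw [norm_mul, RCLike.norm_conj, modP, modQ]; ring
  rw [h2, norm_sq_eq_re_sq_add_im_sq, h, modC]; ring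

lemma modQ_pos {a x : ℝ} (ha : 0 ≤ a) (ha' : a < 1) (hx : 0 < x) : 0 < modQ a x := by
  have h := modP_mul_modQ ha ha' hx
  have h0 : 0 ≤ modQ a x := sq_nonneg _
  rcases h0.eq_or_lt with h1 | h1
  · rw [← h1, mul_zero] at h
    nlinarith [sq_nonneg (modC a x)]
  · exact h1

lemma modQ_le_one {a x : ℝ} (ha : 0 ≤ a) (ha' : a < 1) : modQ a x ≤ 1 :=
  pow_le_one₀ (norm_nonneg _) (norm_lowerAmp_le_one ha ha' x)

lemma hasDerivAt_modQ {a x : ℝ} (ha : 0 ≤ a) (ha' : a < 1) (hx : 0 < x) :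
    HasDerivAt (modQ a) (2 * ((1 - a) * modQ a x / x - modC a x)) x := by
  have h1 := hasDerivAt_lowerAmp' ha ha' hx
  have h2 := Complex.reCLM.hasFDerivAt.comp_hasDerivAt x (h1.mul h1.star)
  have h3 : modQ a = fun y => (lowerAmp a y * star (lowerAmp a y)).re := by
    funext y
    rw [modQ, norm_sq_eq_re_sq_add_im_sq]
    simp
  rw [h3]
  refine h2.congr_deriv ?_
  simp only [modC]
  have hx' : x ≠ 0 := hx.ne'
  generalize upperAmp a x = K
  generalize lowerAmp a x = G
  have e : ((1 - a : ℝ) : ℂ) / x = (((1 - a) / x : ℝ) : ℂ) := by push_cast; rfl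
  rw [e]
  simp
  ring

lemma hasDerivAt_modP {a x : ℝ} (ha : 0 ≤ a) (ha' : a < 1) (hx : 0 < x) :
    HasDerivAt (modP a) (2 * (modC a x - (1 - a) * modP a x / x)) x := by
  have h1 := hasDerivAt_upperAmp ha ha' hx
  have h2 := Complex.reCLM.hasFDerivAt.comp_hasDerivAt x (h1.mul h1.star)
  have h3 : modP a = fun y => (upperAmp a y * star (upperAmp a y)).re := by
    funext y
    rw [modP, norm_sq_eq_re_sq_add_im_sq]
    simp
  rw [h3]
  refine h2.congr_deriv ?_
  simp only [modC]
  have hx' : x ≠ 0 := hx.ne'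
  generalize upperAmp a x = K
  generalize lowerAmp a x = G
  have e : ((1 - a : ℝ) : ℂ) / x = (((1 - a) / x : ℝ) : ℂ) := by push_cast; rfl
  rw [e]
  simp
  ring

lemma hasDerivAt_modC {a x : ℝ} (ha : 0 ≤ a) (ha' : a < 1) (hx : 0 < x) :
    HasDerivAt (modC a) (modQ a x - modP a x) x := by
  have h1 := hasDerivAt_upperAmp ha ha' hx
  have h2 := hasDerivAt_lowerAmp' ha ha' hx
  have h4 := (Complex.imCLM.hasFDerivAt.comp_hasDerivAt x (h1.mul h2.star))
  refine HasDerivAt.congr_deriv (f := modC a) h4 ?_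
  rw [modQ, modP, norm_sq_eq_re_sq_add_im_sq, norm_sq_eq_re_sq_add_im_sq]
  generalize upperAmp a x = K
  generalize lowerAmp a x = G
  have e : ((1 - a : ℝ) : ℂ) / x = (((1 - a) / x : ℝ) : ℂ) := by push_cast; rfl
  rw [e]
  simp
  ring

lemma tendsto_modQ {a : ℝ} (ha : 0 ≤ a) (ha' : a < 1) : Tendsto (modQ a) atTop (𝓝 1) := by
  have h := (tendsto_lowerAmp ha ha').norm.pow 2
  rw [norm_one, one_pow] at h
  exact h

lemma tendsto_modP {a : ℝ} (ha : 0 ≤ a) (ha' : a < 1) : Tendsto (modP a) atTop (𝓝 1) := by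
  have h := (tendsto_upperAmp ha ha').norm.pow 2
  rw [norm_one, one_pow] at h
  exact h

lemma tendsto_modC {a : ℝ} (ha : 0 ≤ a) (ha' : a < 1) : Tendsto (modC a) atTop (𝓝 0) := by
  have h := (Complex.continuous_im.tendsto _).comp ((tendsto_upperAmp ha ha').mul
    ((Complex.continuous_conj.tendsto _).comp (tendsto_lowerAmp ha ha')))
  rw [map_one, mul_one, Complex.one_im] at h
  exact h

end

noncomputable section
open MeasureTheory Filter Topology Set

/-! ### Estimates for the modulus functions -/

/-- The left side is half of x ∂ₓQ. The right side exhibits the factor a hidden in it, since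
`lowerEuler` is proportional to a. -/
lemma euler_modQ_eq {a x : ℝ} (ha : 0 ≤ a) (ha' : a < 1) (hx : 0 < x) :
    (1 - a) * modQ a x - x * modC a x =
      ((starRingEnd ℂ) (lowerAmp a x) * lowerEuler a x).re := by
  have hx' : (x : ℂ) ≠ 0 := by exact_mod_cast hx.ne'
  have h1 : lowerEuler a x = ((1 - a : ℝ) : ℂ) * lowerAmp a x +
      x * (Complex.I * (upperAmp a x - lowerAmp a x)) := by
    rw [upperAmp_eq ha ha' hx, lowerMoment_eq ha ha' hx]
    field_simp
    linear_combination (((1 - a : ℝ) : ℂ) * lowerAmp a x - lowerEuler a x) * (-Complex.I_sq)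
  rw [h1, modC, modQ, norm_sq_eq_re_sq_add_im_sq]
  generalize upperAmp a x = K
  generalize lowerAmp a x = G
  simp
  ring

/-- The mean of the modulus of the kernel of `lowerAmp`. -/
def lowerMean (a x : ℝ) : ℝ := ∫ t, ‖onePlusIPow (-a) (t / (2 * x))‖ ∂(gammaLaw a)

/-- Combined with `norm_lowerEuler_le` this bounds `lowerEuler` by 2a|G|. Such a relative bound is
still useful for x → 0, where G may be small. -/
lemma half_lowerMean_le {a x : ℝ} (ha : 0 ≤ a) (ha' : a ≤ 1 / 4) :
    lowerMean a x / 2 ≤ (lowerAmp a x).re := by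
  have hi := integrable_onePlusIPow (a := a) (s := -a) (by linarith) (by linarith) x
  have h : (lowerAmp a x).re = ∫ t, (onePlusIPow (-a) (t / (2 * x))).re ∂(gammaLaw a) :=
    (integral_re hi).symm
  rw [h, lowerMean, ← integral_div]
  exact integral_mono (hi.norm.div_const _) hi.re
    fun t => half_norm_le_re_onePlusIPow ha ha' _

lemma norm_lowerEuler_le {a x : ℝ} (ha : 0 ≤ a) (ha' : a < 1) (hx : 0 < x) :
    ‖lowerEuler a x‖ ≤ a * lowerMean a x := by
  have hi := integrable_onePlusIPow (a := a) (s := -a) ha' (by linarith) x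
  rw [lowerMean, ← integral_const_mul]
  refine norm_integral_le_of_norm_le (hi.norm.const_mul _) ?_
  filter_upwards [ae_gammaLaw_pos a] with t ht
  exact norm_eulerKernel_le ha (by positivity)

lemma norm_lowerEuler_le' {a x : ℝ} (ha : 0 ≤ a) (ha' : a < 1) (hx : 0 < x) :
    ‖lowerEuler a x‖ ≤ a / (2 * x) := by
  have h : ‖lowerEuler a x‖ ≤ ∫ t, a / (2 * x) * t ∂(gammaLaw a) := by
    refine norm_integral_le_of_norm_le ((integrable_gammaLaw_id ha').const_mul _) ?_
    filter_upwards [ae_gammaLaw_pos a] with t ht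
    refine (norm_eulerKernel_le' ha (by positivity)).trans (le_of_eq ?_)
    field_simp
  rw [integral_const_mul, integral_gammaLaw_id ha'] at h
  refine h.trans (mul_le_of_le_one_right (by positivity) (by linarith))

lemma abs_re_lowerEuler_le {a x : ℝ} (ha : 0 ≤ a) (ha' : a < 1) (hx : 0 < x) :
    |(lowerEuler a x).re| ≤ a / x ^ 2 := by
  have hi := integrable_eulerKernel ha ha' hx
  have h0 : (lowerEuler a x).re = ∫ t, (eulerKernel a (t / (2 * x))).re ∂(gammaLaw a) :=
    (integral_re hi).symm
  have h : |(lowerEuler a x).re| ≤ ∫ t, a / (2 * x ^ 2) * t ^ 2 ∂(gammaLaw a) := by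
    rw [h0, ← Real.norm_eq_abs]
    refine norm_integral_le_of_norm_le ((integrable_gammaLaw_sq ha').const_mul _) ?_
    filter_upwards [ae_gammaLaw_pos a] with t ht
    refine (abs_re_eulerKernel_le ha ha'.le (by positivity)).trans (le_of_eq ?_)
    field_simp
  rw [integral_const_mul, integral_gammaLaw_sq ha'] at h
  refine h.trans ?_
  have : (2 - a) * (1 - a) ≤ 2 := by nlinarith
  calc a / (2 * x ^ 2) * ((2 - a) * (1 - a)) ≤ a / (2 * x ^ 2) * 2 := by gcongr
    _ = _ := by field_simp

lemma abs_im_lowerAmp_le {a x : ℝ} (ha : 0 ≤ a) (ha' : a < 1) (hx : 0 < x) :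
    |(lowerAmp a x).im| ≤ a / (2 * x) := by
  have hi := integrable_onePlusIPow (a := a) (s := -a) ha' (by linarith) x
  have h0 : (lowerAmp a x).im = ∫ t, (onePlusIPow (-a) (t / (2 * x))).im ∂(gammaLaw a) :=
    (integral_im hi).symm
  have h : |(lowerAmp a x).im| ≤ ∫ t, a / (2 * x) * t ∂(gammaLaw a) := by
    rw [h0, ← Real.norm_eq_abs]
    refine norm_integral_le_of_norm_le ((integrable_gammaLaw_id ha').const_mul _) ?_
    filter_upwards [ae_gammaLaw_pos a] with t ht
    refine (abs_im_onePlusIPow_le ha (by positivity)).trans (le_of_eq ?_)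
    field_simp
  rw [integral_const_mul, integral_gammaLaw_id ha'] at h
  refine h.trans (mul_le_of_le_one_right (by positivity) (by linarith))

/-- The kernel is at least 1 - (t/(2x))² in modulus, and the second moment (2 - a)(1 - a) of the
Gamma law is at most 2. -/
lemma half_le_lowerMean {a x : ℝ} (ha' : a < 1) (hx : 1 ≤ x) (ha : 0 ≤ a) :
    1 / 2 ≤ lowerMean a x := by
  have hprob := isProbabilityMeasure_gammaLaw ha'
  have hi := integrable_onePlusIPow (a := a) (s := -a) ha' (by linarith) x
  have h : ∫ t : ℝ, (1 - (2 * x)⁻¹ ^ 2 * t ^ 2) ∂(gammaLaw a) ≤ lowerMean a x := by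
    refine integral_mono ((integrable_const _).sub ((integrable_gammaLaw_sq ha').const_mul _))
      hi.norm fun t => ?_
    refine le_trans (le_of_eq ?_) (one_sub_sq_le_norm_onePlusIPow ha'.le _)
    rw [div_pow, inv_pow]; ring
  rw [integral_sub (integrable_const _) ((integrable_gammaLaw_sq ha').const_mul _),
    integral_const_mul, integral_gammaLaw_sq ha', integral_const, probReal_univ, one_smul] at h
  refine le_trans ?_ h
  have h1 : (2 - a) * (1 - a) ≤ 2 := by nlinarith
  have h2 : (2 * x)⁻¹ ^ 2 ≤ 1 / 4 := by
    rw [inv_pow, ← one_div]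
    apply one_div_le_one_div_of_le (by norm_num)
    nlinarith
  nlinarith [mul_le_mul h2 h1 (by nlinarith) (by norm_num)]

/-- For x ≤ 1 the absence of cancellation gives a bound relative to Q. For x ≥ 1 both products in
Re(G* `lowerEuler`) are O(a/x²), and Q ≥ 1/16 turns the absolute bound 6a into 96 a Q. -/
lemma abs_euler_modQ_le {a x : ℝ} (ha : 0 ≤ a) (ha' : a ≤ 1 / 4) (hx : 0 < x) :
    |2 * ((1 - a) * modQ a x - x * modC a x)| ≤ 96 * a * modQ a x / (1 + x ^ 2) := by
  have ha1 : a < 1 := by linarith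
  rw [euler_modQ_eq ha ha1 hx]
  have hM := half_lowerMean_le (x := x) ha ha'
  have hre := Complex.re_le_norm (lowerAmp a x)
  have hM0 : 0 ≤ lowerMean a x := integral_nonneg fun t => norm_nonneg _
  have hq : modQ a x = ‖lowerAmp a x‖ ^ 2 := rfl
  rw [le_div_iff₀ (by positivity)]
  rcases le_total x 1 with h | h
  · have h1 : |((starRingEnd ℂ) (lowerAmp a x) * lowerEuler a x).re| ≤
        ‖lowerAmp a x‖ * (a * (2 * ‖lowerAmp a x‖)) := by
      refine (Complex.abs_re_le_norm _).trans ?_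
      rw [norm_mul, RCLike.norm_conj]
      gcongr
      refine (norm_lowerEuler_le ha ha1 hx).trans ?_
      gcongr
      linarith
    rw [abs_mul, abs_two]
    have h2 : 1 + x ^ 2 ≤ 2 := by nlinarith
    calc 2 * |((starRingEnd ℂ) (lowerAmp a x) * lowerEuler a x).re| * (1 + x ^ 2)
        ≤ 2 * (‖lowerAmp a x‖ * (a * (2 * ‖lowerAmp a x‖))) * 2 := by gcongr
      _ = 8 * a * modQ a x := by rw [hq]; ring
      _ ≤ _ := by
        have : 0 ≤ a * modQ a x := mul_nonneg ha (sq_nonneg _)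
        nlinarith
  · have h4 := half_le_lowerMean ha1 h ha
    have h5 : 1 / 16 ≤ modQ a x := by
      rw [hq]
      have : 1 / 4 ≤ ‖lowerAmp a x‖ := by linarith
      nlinarith
    have h6 : |((starRingEnd ℂ) (lowerAmp a x) * lowerEuler a x).re| ≤ 3 / 2 * a / x ^ 2 := by
      rw [Complex.mul_re, Complex.conj_re, Complex.conj_im]
      have e1 := (Complex.abs_re_le_norm _).trans (norm_lowerAmp_le_one ha ha1 x)
      have e2 := abs_re_lowerEuler_le ha ha1 hx
      have e3 := abs_im_lowerAmp_le ha ha1 hx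
      have e4 := (Complex.abs_im_le_norm _).trans (norm_lowerEuler_le' ha ha1 hx)
      refine (abs_sub _ _).trans ?_
      rw [abs_mul, abs_mul, abs_neg]
      calc _ ≤ 1 * (a / x ^ 2) + a / (2 * x) * (a / (2 * x)) := by gcongr
        _ = (a + a * a / 4) / x ^ 2 := by field_simp; ring
        _ ≤ _ := by gcongr; nlinarith
    rw [abs_mul, abs_two]
    calc 2 * |((starRingEnd ℂ) (lowerAmp a x) * lowerEuler a x).re| * (1 + x ^ 2)
        ≤ 2 * (3 / 2 * a / x ^ 2) * (x ^ 2 + x ^ 2) := by gcongr; nlinarith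
      _ = 6 * a := by field_simp; ring
      _ ≤ _ := by nlinarith

/-- As a function of log x, log Q is Lipschitz with constant 96a. -/
lemma modQ_le_exp_mul {a x y : ℝ} (ha : 0 ≤ a) (ha' : a ≤ 1 / 4) (hx : 0 < x) (hy : 0 < y) :
    modQ a x ≤ modQ a y * Real.exp (96 * a * |Real.log x - Real.log y|) := by
  have ha1 : a < 1 := by linarith
  have hd : ∀ u : ℝ, HasDerivAt (fun u => Real.log (modQ a (Real.exp u)))
      (2 * ((1 - a) * modQ a (Real.exp u) / Real.exp u - modC a (Real.exp u)) * Real.exp u /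
        modQ a (Real.exp u)) u := fun u =>
    ((hasDerivAt_modQ ha ha1 (Real.exp_pos u)).comp u (Real.hasDerivAt_exp u)).log
      (modQ_pos ha ha1 (Real.exp_pos u)).ne'
  have hb : ∀ u : ℝ, ‖2 * ((1 - a) * modQ a (Real.exp u) / Real.exp u - modC a (Real.exp u)) *
      Real.exp u / modQ a (Real.exp u)‖ ≤ 96 * a := by
    intro u
    have h1 := abs_euler_modQ_le ha ha' (Real.exp_pos u)
    have h2 := modQ_pos ha ha1 (Real.exp_pos u)
    have h3 := Real.exp_pos u
    generalize Real.exp u = z at *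
    have e : 2 * ((1 - a) * modQ a z / z - modC a z) * z =
      2 * ((1 - a) * modQ a z - z * modC a z) := by field_simp
    rw [e, norm_div, Real.norm_eq_abs, Real.norm_of_nonneg h2.le, div_le_iff₀ h2]
    refine h1.trans (div_le_self (by positivity) (by nlinarith))
  have h := Convex.norm_image_sub_le_of_norm_hasDerivWithin_le (s := univ) (C := 96 * a)
    (fun u _ => (hd u).hasDerivWithinAt) (fun u _ => hb u) convex_univ
    (mem_univ (Real.log y)) (mem_univ (Real.log x))
  simp only [Real.exp_log hx, Real.exp_log hy, Real.norm_eq_abs] at h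
  have hqx := modQ_pos ha ha1 hx
  have hqy := modQ_pos ha ha1 hy
  have h2 := (le_abs_self _).trans h
  rw [← Real.log_le_log_iff hqx (by positivity), Real.log_mul hqy.ne' (Real.exp_pos _).ne',
    Real.log_exp]
  linarith

/-- The derivative of 48a log(1 + x⁻²) is -96a/(x(1 + x²)), which compensates the largest possible
growth of log Q. The sum is antitone and tends to 0 at infinity, hence is nonnegative. -/
lemma rpow_neg_le_modQ {a x : ℝ} (ha : 0 ≤ a) (ha' : a ≤ 1 / 4) (hx : 0 < x) :
    (1 + (x ^ 2)⁻¹) ^ (-(48 * a)) ≤ modQ a x := by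
  have ha1 : a < 1 := by linarith
  have hd : ∀ y ∈ Ioi (0 : ℝ), HasDerivAt
      (fun y => Real.log (modQ a y) + 48 * a * Real.log (1 + (y ^ 2)⁻¹))
      (2 * ((1 - a) * modQ a y / y - modC a y) / modQ a y +
        48 * a * (-(2 * y) / (y ^ 2) ^ 2 / (1 + (y ^ 2)⁻¹))) y := by
    intro y hy
    have hy' : (0 : ℝ) < y := hy
    have h1 := (hasDerivAt_modQ ha ha1 hy').log (modQ_pos ha ha1 hy').ne'
    have h2 : HasDerivAt (fun y : ℝ => 1 + (y ^ 2)⁻¹) (-(2 * y) / (y ^ 2) ^ 2) y := by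
      have h3 := ((hasDerivAt_pow 2 y).inv (by positivity)).const_add 1
      simpa using h3
    exact h1.add ((h2.log (by positivity)).const_mul _)
  have hanti : AntitoneOn (fun y => Real.log (modQ a y) + 48 * a * Real.log (1 + (y ^ 2)⁻¹))
      (Ioi 0) := by
    refine antitoneOn_of_deriv_nonpos (convex_Ioi 0)
      (fun y hy => (hd y hy).continuousAt.continuousWithinAt) ?_ ?_
    · rw [interior_Ioi]
      exact fun y hy => (hd y hy).differentiableAt.differentiableWithinAt
    · rw [interior_Ioi]
      intro y hy
      rw [(hd y hy).deriv]
      have hy' : (0 : ℝ) < y := hy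
      have h1 := (le_abs_self _).trans (abs_euler_modQ_le ha ha' hy')
      have h2 := modQ_pos ha ha1 hy'
      have e1 : 48 * a * (-(2 * y) / (y ^ 2) ^ 2 / (1 + (y ^ 2)⁻¹)) =
          -(96 * a * modQ a y / (1 + y ^ 2)) / (y * modQ a y) := by
        field_simp; ring
      have e2 : 2 * ((1 - a) * modQ a y / y - modC a y) / modQ a y =
          2 * ((1 - a) * modQ a y - y * modC a y) / (y * modQ a y) := by
        field_simp
      rw [e1, e2, ← add_div]
      exact div_nonpos_of_nonpos_of_nonneg (by linarith) (by positivity)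
  have hlim : Tendsto (fun y => Real.log (modQ a y) + 48 * a * Real.log (1 + (y ^ 2)⁻¹))
      atTop (𝓝 0) := by
    have h1 := (tendsto_modQ ha ha1).log one_ne_zero
    have h2 : Tendsto (fun y : ℝ => 1 + (y ^ 2)⁻¹) atTop (𝓝 1) := by
      simpa using (tendsto_inv_atTop_zero.comp
        (tendsto_pow_atTop (α := ℝ) two_ne_zero)).const_add 1
    have h3 := (h2.log one_ne_zero).const_mul (48 * a)
    simpa using h1.add h3
  have h0 : 0 ≤ Real.log (modQ a x) + 48 * a * Real.log (1 + (x ^ 2)⁻¹) := by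
    refine le_of_tendsto hlim ?_
    filter_upwards [eventually_ge_atTop x] with y hy
    exact hanti hx (hx.trans_le hy) hy
  rw [Real.rpow_def_of_pos (by positivity), ← Real.le_log_iff_exp_le (modQ_pos ha ha1 hx)]
  linarith

/-- Squaring the previous lower bound and applying Bernoulli's inequality with exponent 96a ≤ 1. It
says that 1/Q² - 1 ≤ 96a/x². -/
lemma sq_le_modQ_sq_mul {a x : ℝ} (ha : 0 ≤ a) (ha' : 96 * a ≤ 1) (hx : 0 < x) :
    1 ≤ modQ a x ^ 2 * (1 + 96 * a / x ^ 2) := by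
  have h1 := rpow_neg_le_modQ ha (by linarith) hx
  have h2 : (1 + (x ^ 2)⁻¹) ^ (96 * a) ≤ 1 + 96 * a * (x ^ 2)⁻¹ :=
    rpow_one_add_le_one_add_mul_self (by have : 0 < (x ^ 2)⁻¹ := by positivity
                                         linarith) (by positivity) ha'
  have h3 : ((1 + (x ^ 2)⁻¹) ^ (-(48 * a))) ^ 2 * (1 + (x ^ 2)⁻¹) ^ (96 * a) = 1 := by
    rw [← Real.rpow_natCast, ← Real.rpow_mul (by positivity), ← Real.rpow_add (by positivity)]
    rw [show -(48 * a) * ((2 : ℕ) : ℝ) + 96 * a = 0 by push_cast; ring, Real.rpow_zero]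
  rw [div_eq_mul_inv]
  refine h3.symm.le.trans ?_
  gcongr

/-- The modulus functions in terms of `modQ`, with relative errors of order `a`. -/
lemma modulus_expansion {a x : ℝ} (ha : 0 ≤ a) (ha' : a ≤ 1 / 1000) (hx : 0 < x) :
    ∃ d e w : ℝ, |d| ≤ 49 * a ∧ 0 ≤ e ∧ e ≤ 96 * a ∧ |w| ≤ 96 * a ∧
      modC a x = modQ a x / x * (1 + d) ∧
      modP a x = modQ a x + modQ a x / x ^ 2 * (e + (1 + d) ^ 2) ∧
      2 * ((1 - a) * modP a x - x * modC a x) =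
        modQ a x / x ^ 2 * (w + 2 * (1 - a) * (e + (1 + d) ^ 2)) := by
  have ha1 : a < 1 := by linarith
  have hq := modQ_pos ha ha1 hx
  have hq1 := modQ_le_one (x := x) ha ha1
  have hE := abs_euler_modQ_le ha (by linarith) hx
  have hB := sq_le_modQ_sq_mul ha (by linarith) hx
  have hpq := modP_mul_modQ ha ha1 hx
  generalize modQ a x = q at *
  generalize modC a x = c at *
  generalize modP a x = p at *
  have hp : p = (1 + c ^ 2) / q := by rw [eq_div_iff hq.ne']; exact hpq
  have hE1 : |2 * ((1 - a) * q - x * c)| ≤ 96 * a * q :=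
    hE.trans (div_le_self (by positivity) (by nlinarith))
  have hE2 : |2 * ((1 - a) * q - x * c)| ≤ 96 * a * q / x ^ 2 :=
    hE.trans (div_le_div_of_nonneg_left (by positivity) (by positivity) (by linarith))
  -- Here d is the relative error of C, e = x²(1/Q² - 1), and w is x ∂ₓQ in units of Q/x². The
  -- formulas for P follow from P = (1 + C²)/Q.
  refine ⟨(x * c - q) / q, x ^ 2 * (1 - q ^ 2) / q ^ 2,
    2 * ((1 - a) * q - x * c) * x ^ 2 / q, ?_, ?_, ?_, ?_, ?_, ?_, ?_⟩
  · rw [abs_div, abs_of_pos hq, div_le_iff₀ hq]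
    rw [abs_le] at hE1 ⊢
    constructor <;> nlinarith [hE1.1, hE1.2]
  · have : 0 ≤ 1 - q ^ 2 := by nlinarith
    positivity
  · rw [div_le_iff₀ (by positivity)]
    have : x ^ 2 * 1 ≤ x ^ 2 * (q ^ 2 * (1 + 96 * a / x ^ 2)) := by gcongr
    have e1 : x ^ 2 * (q ^ 2 * (1 + 96 * a / x ^ 2)) = q ^ 2 * (x ^ 2 + 96 * a) := by
      field_simp
    nlinarith
  · rw [abs_div, abs_mul, abs_of_pos hq, abs_of_pos (pow_pos hx 2), div_le_iff₀ hq]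
    rwa [le_div_iff₀ (by positivity)] at hE2
  · field_simp; ring
  · rw [hp]; field_simp; ring
  · rw [hp]; field_simp; ring

/-- The factor 500 is not sharp; it serves all three relative errors at once. -/
lemma abs_modC_sub_le {a x : ℝ} (ha : 0 ≤ a) (ha' : a ≤ 1 / 1000) (hx : 0 < x) :
    |modC a x - modQ a x / x| ≤ 500 * a * (modQ a x / x) := by
  obtain ⟨d, e, w, hd, -, -, -, hc, -, -⟩ := modulus_expansion ha ha' hx
  have hq := modQ_pos ha (by linarith) hx
  rw [hc, show modQ a x / x * (1 + d) - modQ a x / x = d * (modQ a x / x) by ring, abs_mul,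
    abs_of_pos (show 0 < modQ a x / x by positivity)]
  gcongr
  linarith

lemma abs_euler_modC_sub_le {a x : ℝ} (ha : 0 ≤ a) (ha' : a ≤ 1 / 1000) (hx : 0 < x) :
    |x * (modP a x - modQ a x) - modQ a x / x| ≤ 500 * a * (modQ a x / x) := by
  obtain ⟨d, e, w, hd, he, he', -, -, hp, -⟩ := modulus_expansion ha ha' hx
  have hq := modQ_pos ha (by linarith) hx
  rw [hp, show x * (modQ a x + modQ a x / x ^ 2 * (e + (1 + d) ^ 2) - modQ a x) - modQ a x / x =
    (e + 2 * d + d ^ 2) * (modQ a x / x) by field_simp; ring, abs_mul,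
    abs_of_pos (show 0 < modQ a x / x by positivity)]
  gcongr
  have := abs_le.1 hd
  rw [abs_le]
  constructor <;> nlinarith [this.1, this.2]

lemma abs_euler_modP_sub_le {a x : ℝ} (ha : 0 ≤ a) (ha' : a ≤ 1 / 1000) (hx : 0 < x) :
    |2 * ((1 - a) * modP a x - x * modC a x) - 2 * (modQ a x / x ^ 2)| ≤
      500 * a * (modQ a x / x ^ 2) := by
  obtain ⟨d, e, w, hd, he, he', hw, -, -, hP⟩ := modulus_expansion ha ha' hx
  have hq := modQ_pos ha (by linarith) hx
  rw [hP, show modQ a x / x ^ 2 * (w + 2 * (1 - a) * (e + (1 + d) ^ 2)) - 2 * (modQ a x / x ^ 2) =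
    (w + 2 * (1 - a) * (e + (1 + d) ^ 2) - 2) * (modQ a x / x ^ 2) by ring, abs_mul,
    abs_of_pos (show 0 < modQ a x / x ^ 2 by positivity)]
  gcongr
  have hd2 : d ^ 2 ≤ 3 * a := by
    rw [← sq_abs]; nlinarith [abs_nonneg d]
  have hd0 := sq_nonneg d
  have := abs_le.1 hd
  have := abs_le.1 hw
  have h1 : |e + 2 * d + d ^ 2| ≤ 197 * a := by
    rw [abs_le]; constructor <;> linarith
  have h2 := abs_le.1 h1
  rw [abs_le]
  have e1 : w + 2 * (1 - a) * (e + (1 + d) ^ 2) - 2 =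
    w + 2 * (e + 2 * d + d ^ 2) - 2 * a - 2 * (a * (e + 2 * d + d ^ 2)) := by ring
  have h3 : |a * (e + 2 * d + d ^ 2)| ≤ a := by
    rw [abs_mul, abs_of_nonneg ha]
    exact mul_le_of_le_one_right ha (by linarith)
  have h4 := abs_le.1 h3
  rw [e1]
  constructor <;> linarith

lemma modP_le {a x : ℝ} (ha : 0 ≤ a) (ha' : a ≤ 1 / 1000) (hx : 0 < x) :
    modP a x ≤ modQ a x + 2 * (modQ a x / x ^ 2) := by
  obtain ⟨d, e, w, hd, he, he', -, -, hp, -⟩ := modulus_expansion ha ha' hx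
  have hq := modQ_pos ha (by linarith) hx
  have := abs_le.1 hd
  rw [hp, mul_comm 2]
  gcongr
  nlinarith

/-- From |1 + iy|^{-a} ≤ y^{-a} one gets |G| ≤ (2x)^a Γ(1 - 2a)/Γ(1 - a), and the quotient tends to
1 as a → 0. The power x^{2a} is the infrared regularization due to the mass. -/
lemma exists_modQ_le_rpow : ∃ ε : ℝ, 0 < ε ∧ ∀ a, 0 ≤ a → a < ε → ∀ x, 0 < x →
    modQ a x ≤ 8 * x ^ (2 * a) := by
  have hcont : Tendsto (fun a : ℝ => Real.Gamma (1 - a + -a) / Real.Gamma (1 - a)) (𝓝 0)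
      (𝓝 1) := by
    have h1 : ContinuousAt Real.Gamma 1 :=
      (Real.differentiableAt_Gamma fun m => by
        have : (0 : ℝ) ≤ m := Nat.cast_nonneg m
        linarith).continuousAt
    have h2 : Tendsto (fun a : ℝ => Real.Gamma (1 - a + -a)) (𝓝 0) (𝓝 1) := by
      have : Tendsto (fun a : ℝ => 1 - a + -a) (𝓝 0) (𝓝 1) := by
        have : Continuous (fun a : ℝ => 1 - a + -a) := by fun_prop
        simpa using this.tendsto 0
      have h := h1.tendsto.comp this
      rwa [Real.Gamma_one] at h
    have h3 : Tendsto (fun a : ℝ => Real.Gamma (1 - a)) (𝓝 0) (𝓝 1) := by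
      have : Tendsto (fun a : ℝ => 1 - a) (𝓝 0) (𝓝 1) := by
        have : Continuous (fun a : ℝ => 1 - a) := by fun_prop
        simpa using this.tendsto 0
      have h := h1.tendsto.comp this
      rwa [Real.Gamma_one] at h
    have h := h2.div h3 one_ne_zero
    rwa [div_one] at h
  obtain ⟨δ, hδ, h⟩ := Metric.eventually_nhds_iff.1
    (hcont.eventually (gt_mem_nhds (show (1 : ℝ) < 2 by norm_num)))
  refine ⟨min δ (1 / 4), by positivity, fun a ha ha' x hx => ?_⟩
  have ha4 : a < 1 / 4 := ha'.trans_le (min_le_right _ _)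
  have hG := h (y := a) (by
    rw [Real.dist_eq, sub_zero, abs_of_nonneg ha]; exact ha'.trans_le (min_le_left _ _))
  have h1 : ‖lowerAmp a x‖ ≤ ∫ t, (2 * x) ^ a * t ^ (-a) ∂(gammaLaw a) := by
    refine norm_integral_le_of_norm_le
      ((integrable_gammaLaw_rpow (by linarith) (by linarith)).const_mul _) ?_
    filter_upwards [ae_gammaLaw_pos a] with t ht
    refine (norm_onePlusIPow_le_rpow ha (by positivity)).trans (le_of_eq ?_)
    rw [Real.div_rpow ht.le (by positivity), Real.rpow_neg (by positivity : (0 : ℝ) ≤ 2 * x),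
      div_inv_eq_mul, mul_comm]
  rw [integral_const_mul, integral_gammaLaw_rpow (by linarith) (by linarith)] at h1
  have h2 : ‖lowerAmp a x‖ ≤ (2 * x) ^ a * 2 := h1.trans (by gcongr)
  have h3 : (2 : ℝ) ^ (2 * a) ≤ 2 := by
    calc (2 : ℝ) ^ (2 * a) ≤ 2 ^ (1 : ℝ) :=
          Real.rpow_le_rpow_of_exponent_le (by norm_num) (by linarith)
      _ = 2 := Real.rpow_one 2
  calc modQ a x ≤ ((2 * x) ^ a * 2) ^ 2 := by unfold modQ; gcongr
    _ = 4 * ((2 : ℝ) ^ (2 * a) * x ^ (2 * a)) := by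
      rw [mul_pow, ← Real.rpow_natCast, ← Real.rpow_mul (by positivity),
        ← Real.mul_rpow (by norm_num) hx.le, mul_comm a]
      norm_num
      ring
    _ ≤ 4 * (2 * x ^ (2 * a)) := by gcongr
    _ = _ := by ring

end

noncomputable section
open MeasureTheory Filter Topology Set

/-! ### Hankel functions and Bunch–Davies modes -/

/-- The phase factor of `H^{(1)}_{1/2 - a}`. -/
def hankelPhase (a x : ℝ) : ℂ :=
  Complex.exp (Complex.I * ((x - (1 / 2 - a) * Real.pi / 2 - Real.pi / 4 : ℝ) : ℂ))

lemma hankelPhase_mul_conj (a x : ℝ) :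
    hankelPhase a x * (starRingEnd ℂ) (hankelPhase a x) = 1 := by
  rw [Complex.mul_conj, hankelPhase, mul_comm Complex.I, Complex.normSq_eq_norm_sq,
    Complex.norm_exp_ofReal_mul_I]
  simp

lemma hasDerivAt_hankelPhase (a x : ℝ) :
    HasDerivAt (hankelPhase a) (Complex.I * hankelPhase a x) x := by
  have h1 : HasDerivAt (fun x : ℝ => x - (1 / 2 - a) * Real.pi / 2 - Real.pi / 4) 1 x :=
    ((hasDerivAt_id x).sub_const _).sub_const _
  refine HasDerivAt.congr_deriv (f := hankelPhase a) ((h1.ofReal_comp.const_mul Complex.I).cexp) ?_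
  rw [hankelPhase]
  push_cast
  ring

lemma hankelOne_lower {a : ℝ} (ha : a < 1) (x : ℝ) :
    hankelOne (1 / 2 - a) x =
      ((Real.sqrt (2 / (Real.pi * x)) : ℝ) : ℂ) * (hankelPhase a x * lowerAmp a x) := by
  rw [hankelOne, lowerAmp, integral_gammaLaw ha, hankelPhase]
  have e1 : (1 / 2 - a + 1 / 2 : ℝ) = 1 - a := by ring
  have e2 : (1 / 2 - a - 1 / 2 : ℝ) = -a := by ring
  rw [e1, e2]
  have e3 : ∀ t : ℝ, ((Real.exp (-t) * t ^ (-a) : ℝ) : ℂ) *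
      (1 + Complex.I * ((t / (2 * x) : ℝ) : ℂ)) ^ ((-a : ℝ) : ℂ) =
      (Real.exp (-t) * t ^ (-a)) • onePlusIPow (-a) (t / (2 * x)) := by
    intro t; rw [Complex.real_smul]; rfl
  simp only [e3]
  rw [Complex.real_smul]
  push_cast
  ring

/-- Raising the order by one turns the phase by -π/2 and replaces Γ(1 - a) by (1 - a)Γ(1 - a). The
extra power of t becomes the factor t in `upperAmp`, so the same Gamma law serves both orders. -/
lemma hankelOne_upper {a : ℝ} (ha : a < 1) (x : ℝ) :
    hankelOne (3 / 2 - a) x = ((Real.sqrt (2 / (Real.pi * x)) : ℝ) : ℂ) *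
      (-Complex.I * (hankelPhase a x * upperAmp a x)) := by
  rw [hankelOne, upperAmp, integral_gammaLaw ha, hankelPhase]
  have e1 : (3 / 2 - a + 1 / 2 : ℝ) = 1 - a + 1 := by ring
  have e2 : (3 / 2 - a - 1 / 2 : ℝ) = 1 - a := by ring
  rw [e1, e2, Real.Gamma_add_one (by linarith)]
  have e3 : ∫ t in Ioi (0 : ℝ), ((Real.exp (-t) * t ^ (1 - a) : ℝ) : ℂ) *
      (1 + Complex.I * ((t / (2 * x) : ℝ) : ℂ)) ^ ((1 - a : ℝ) : ℂ) =
      ∫ t in Ioi (0 : ℝ), (Real.exp (-t) * t ^ (-a)) •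
        ((t : ℂ) * onePlusIPow (1 - a) (t / (2 * x))) := by
    refine setIntegral_congr_fun measurableSet_Ioi fun t ht => ?_
    have ht' : (0 : ℝ) < t := ht
    rw [Complex.real_smul, show (1 - a) = -a + 1 by ring, Real.rpow_add_one ht'.ne', onePlusIPow,
      onePlusI]
    push_cast
    ring
  have e4 : Complex.exp (Complex.I *
      ((x - (3 / 2 - a) * Real.pi / 2 - Real.pi / 4 : ℝ) : ℂ)) = -Complex.I *
      Complex.exp (Complex.I * ((x - (1 / 2 - a) * Real.pi / 2 - Real.pi / 4 : ℝ) : ℂ)) := by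
    have h : Complex.exp (-(Real.pi / 2 * Complex.I)) = -Complex.I := by
      rw [Complex.exp_neg, Complex.exp_pi_div_two_mul_I, Complex.inv_I]
    rw [← h, ← Complex.exp_add]
    congr 1
    push_cast
    ring
  rw [e3, e4, Complex.real_smul]
  push_cast
  rw [div_eq_mul_inv, mul_inv]
  ring

lemma bdIndex_eq (r : ℝ) : bdIndex r = 3 / 2 - muSq r := by rw [muSq]; ring

/-- The factor √(1/(2k)) is the Minkowski normalization and -Hη is the inverse scale factor. -/
lemma bdMode_eq {r H k η : ℝ} (ha : muSq r < 1) (hH : 0 < H) (hk : 0 < k) (hη : η < 0) :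
    bdMode r H k η = ((Real.sqrt (1 / (2 * k)) : ℝ) : ℂ) * (((-(H * η) : ℝ) : ℂ) *
      (-Complex.I * (hankelPhase (muSq r) (-k * η) * upperAmp (muSq r) (-k * η)))) := by
  have he : Real.sqrt (-Real.pi * η / (4 * scaleFactor H η ^ 2)) *
      Real.sqrt (2 / (Real.pi * (-k * η))) = Real.sqrt (1 / (2 * k)) * -(H * η) := by
    have hη' : 0 < -η := by linarith
    have hHη : 0 < -(H * η) := by nlinarith
    have e : -(H * η) = Real.sqrt ((-(H * η)) ^ 2) := (Real.sqrt_sq hHη.le).symm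
    have h1 : 0 ≤ -Real.pi * η / (4 * scaleFactor H η ^ 2) := by
      have : 0 ≤ -Real.pi * η := by nlinarith [Real.pi_pos]
      positivity
    rw [e, ← Real.sqrt_mul h1, ← Real.sqrt_mul (by positivity)]
    congr 1
    rw [scaleFactor]
    have := Real.pi_pos
    have := hη.ne
    field_simp
    norm_num
  rw [bdMode, bdIndex_eq, hankelOne_upper ha, ← mul_assoc, ← Complex.ofReal_mul, he]
  push_cast
  ring

lemma fieldMode_eq {r H k : ℝ} (ha : muSq r < 1) (hH : 0 < H) (hk : 0 < k) :
    fieldMode r H k = ((Real.sqrt (1 / (2 * k)) : ℝ) : ℂ) *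
      (-Complex.I * (hankelPhase (muSq r) (k / H) * upperAmp (muSq r) (k / H))) := by
  rw [fieldMode, bdMode_eq ha hH hk (by rw [neg_div]; simp [hH])]
  have e1 : -k * (-1 / H) = k / H := by ring
  have e2 : -(H * (-1 / H)) = 1 := by field_simp
  rw [e1, e2, Complex.ofReal_one, one_mul]

lemma lightMomentumMode_eq {r H k : ℝ} (ha : muSq r < 1) (hH : 0 < H) (hk : 0 < k) :
    lightMomentumMode r H k = -(((Real.sqrt (1 / (2 * k)) * k : ℝ) : ℂ) *
      (hankelPhase (muSq r) (k / H) * lowerAmp (muSq r) (k / H))) := by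
  have he : Real.sqrt (Real.pi / (4 * H)) * k * Real.sqrt (2 / (Real.pi * (k / H))) =
      Real.sqrt (1 / (2 * k)) * k := by
    have := Real.pi_pos
    rw [mul_right_comm, ← Real.sqrt_mul (by positivity)]
    congr 2
    field_simp
    norm_num
  rw [lightMomentumMode, hankelOne_lower ha, neg_mul, ← mul_assoc, ← Complex.ofReal_mul, he]

/-- In ∂_η the derivative of the phase cancels the term -iK of K'. The term -(1 - a)K/x combines
with the derivative of the scale factor into aK/x, which is the term left out of the light modes. -/
lemma momentumMode_eq {r H k : ℝ} (ha0 : 0 ≤ muSq r) (ha : muSq r < 1) (hH : 0 < H) (hk : 0 < k) :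
    momentumMode r H k = lightMomentumMode r H k - ((muSq r * H : ℝ) : ℂ) * fieldMode r H k := by
  have hη : -1 / H < 0 := by rw [neg_div]; simp [hH]
  have e1 : -k * (-1 / H) = k / H := by ring
  have e2 : -(H * (-1 / H)) = 1 := by field_simp
  have hx : 0 < k / H := by positivity
  have hxη : HasDerivAt (fun η : ℝ => -k * η) (-k) (-1 / H) := by
    simpa using (hasDerivAt_id (-1 / H)).const_mul (-k)
  have hK : HasDerivAt (fun η : ℝ => upperAmp (muSq r) (-k * η)) _ (-1 / H) :=
    HasDerivAt.scomp (g₁ := upperAmp (muSq r)) (-1 / H)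
      (by rw [e1]; exact hasDerivAt_upperAmp ha0 ha hx) hxη
  have hθ : HasDerivAt (fun η : ℝ => hankelPhase (muSq r) (-k * η)) _ (-1 / H) :=
    HasDerivAt.scomp (g₁ := hankelPhase (muSq r)) (-1 / H)
      (by rw [e1]; exact hasDerivAt_hankelPhase (muSq r) (k / H)) hxη
  have hlin : HasDerivAt (fun η : ℝ => ((-(H * η) : ℝ) : ℂ)) (((-H : ℝ) : ℂ)) (-1 / H) := by
    have h : HasDerivAt (fun η : ℝ => -(H * η)) (-H) (-1 / H) := by
      simpa using (hasDerivAt_id (-1 / H)).const_mul (-H)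
    exact h.ofReal_comp
  have hall := (hlin.mul ((hθ.mul hK).const_mul (-Complex.I))).const_mul
    ((Real.sqrt (1 / (2 * k)) : ℝ) : ℂ)
  have hev : (fun η => bdMode r H k η) =ᶠ[𝓝 (-1 / H)] _ :=
    (gt_mem_nhds hη).mono fun η hη' => bdMode_eq ha hH hk hη'
  have hd := (hall.congr_of_eventuallyEq hev).deriv
  rw [momentumMode, hd, fieldMode_eq ha hH hk, lightMomentumMode_eq ha hH hk]
  have e3 : scaleFactor H (-1 / H) = 1 := by rw [scaleFactor]; field_simp
  simp only [Pi.mul_apply]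
  rw [e3, e1, e2]
  generalize upperAmp (muSq r) (k / H) = K
  generalize lowerAmp (muSq r) (k / H) = G
  generalize hankelPhase (muSq r) (k / H) = θ
  have hH' : (H : ℂ) ≠ 0 := by exact_mod_cast hH.ne'
  have hk' : (k : ℂ) ≠ 0 := by exact_mod_cast hk.ne'
  simp only [Complex.real_smul]
  push_cast
  field_simp
  ring_nf
  simp only [Complex.I_sq]
  ring

lemma two_re_fieldMode_fieldMode {r H k : ℝ} (ha : muSq r < 1) (hH : 0 < H) (hk : 0 < k) :
    2 * (fieldMode r H k * (starRingEnd ℂ) (fieldMode r H k)).re =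
      modP (muSq r) (k / H) * k⁻¹ := by
  rw [fieldMode_eq ha hH hk, Complex.mul_conj, Complex.ofReal_re, Complex.normSq_eq_norm_sq, modP]
  have h := congrArg (‖·‖) (hankelPhase_mul_conj (muSq r) (k / H))
  simp only [norm_mul, RCLike.norm_conj, norm_one] at h
  simp only [norm_mul, norm_neg, Complex.norm_I, Complex.norm_real, mul_pow, Real.norm_eq_abs,
    sq_abs, Real.sq_sqrt (show 0 ≤ 1 / (2 * k) by positivity)]
  rw [pow_two ‖hankelPhase _ _‖, h]
  field_simp

lemma two_re_light_light {r H k : ℝ} (ha : muSq r < 1) (hH : 0 < H) (hk : 0 < k) :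
    2 * (lightMomentumMode r H k * (starRingEnd ℂ) (lightMomentumMode r H k)).re =
      modQ (muSq r) (k / H) * k := by
  rw [lightMomentumMode_eq ha hH hk, Complex.mul_conj, Complex.ofReal_re,
    Complex.normSq_eq_norm_sq, modQ]
  have h := congrArg (‖·‖) (hankelPhase_mul_conj (muSq r) (k / H))
  simp only [norm_mul, RCLike.norm_conj, norm_one] at h
  simp only [norm_mul, norm_neg, Complex.norm_real, mul_pow, Real.norm_eq_abs,
    sq_abs, Real.sq_sqrt (show 0 ≤ 1 / (2 * k) by positivity)]
  rw [pow_two ‖hankelPhase _ _‖, h]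
  field_simp

lemma two_re_fieldMode_light {r H k : ℝ} (ha : muSq r < 1) (hH : 0 < H) (hk : 0 < k) :
    2 * (fieldMode r H k * (starRingEnd ℂ) (lightMomentumMode r H k)).re =
      -modC (muSq r) (k / H) := by
  rw [fieldMode_eq ha hH hk, lightMomentumMode_eq ha hH hk, modC]
  have h := hankelPhase_mul_conj (muSq r) (k / H)
  generalize upperAmp (muSq r) (k / H) = K
  generalize lowerAmp (muSq r) (k / H) = G
  generalize hankelPhase (muSq r) (k / H) = θ at *
  have hs : Real.sqrt (1 / (2 * k)) * Real.sqrt (1 / (2 * k)) = 1 / (2 * k) :=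
    Real.mul_self_sqrt (by positivity)
  have e : ((Real.sqrt (1 / (2 * k)) : ℝ) : ℂ) * (-Complex.I * (θ * K)) *
      (starRingEnd ℂ) (-(((Real.sqrt (1 / (2 * k)) * k : ℝ) : ℂ) * (θ * G))) =
      ((Real.sqrt (1 / (2 * k)) * Real.sqrt (1 / (2 * k)) * k : ℝ) : ℂ) *
        (Complex.I * (K * (starRingEnd ℂ) G)) * (θ * (starRingEnd ℂ) θ) := by
    simp only [map_neg, map_mul, Complex.conj_ofReal]
    push_cast
    ring
  rw [e, h, mul_one, hs, Complex.re_ofReal_mul, Complex.I_mul_re]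
  field_simp

lemma two_re_fieldMode_momentumMode {r H k : ℝ} (ha0 : 0 ≤ muSq r) (ha : muSq r < 1) (hH : 0 < H)
    (hk : 0 < k) :
    2 * (fieldMode r H k * (starRingEnd ℂ) (momentumMode r H k)).re =
      -modC (muSq r) (k / H) - muSq r * H * (modP (muSq r) (k / H) * k⁻¹) := by
  rw [← two_re_fieldMode_light ha hH hk, ← two_re_fieldMode_fieldMode ha hH hk,
    momentumMode_eq ha0 ha hH hk, map_sub, map_mul, Complex.conj_ofReal, mul_sub,
    mul_left_comm, Complex.sub_re, Complex.re_ofReal_mul]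
  ring

lemma two_re_momentumMode_momentumMode {r H k : ℝ} (ha0 : 0 ≤ muSq r) (ha : muSq r < 1)
    (hH : 0 < H) (hk : 0 < k) :
    2 * (momentumMode r H k * (starRingEnd ℂ) (momentumMode r H k)).re =
      modQ (muSq r) (k / H) * k + 2 * (muSq r * H) * modC (muSq r) (k / H) +
        (muSq r * H) ^ 2 * (modP (muSq r) (k / H) * k⁻¹) := by
  have h1 := two_re_fieldMode_light ha hH hk
  rw [← two_re_fieldMode_fieldMode ha hH hk, ← two_re_light_light ha hH hk,
    momentumMode_eq ha0 ha hH hk]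
  have h2 : modC (muSq r) (k / H) =
    -(2 * (fieldMode r H k * (starRingEnd ℂ) (lightMomentumMode r H k)).re) := by linarith
  rw [h2]
  simp
  ring

end

noncomputable section
open MeasureTheory Filter Topology Set

/-! ### Smearing functions in momentum space -/

lemma continuous_smearFourier {f : Space3 → ℝ} (hf : Integrable f) :
    Continuous (smearFourier f) := by
  refine continuous_of_dominated (bound := fun x => ‖f x‖) (fun k => ?_) (fun k => ?_) hf.norm ?_
  · refine AEStronglyMeasurable.mul ?_
      (Complex.continuous_ofReal.comp_aestronglyMeasurable hf.aestronglyMeasurable)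
    exact Continuous.aestronglyMeasurable (by fun_prop)
  · refine Eventually.of_forall fun x => ?_
    rw [norm_mul, Complex.norm_real, mul_comm Complex.I, ← neg_mul, ← Complex.ofReal_neg,
      Complex.norm_exp_ofReal_mul_I, one_mul]
  · exact Eventually.of_forall fun x => by fun_prop

lemma norm_smearFourier_le (f : Space3 → ℝ) (k : Space3) :
    ‖smearFourier f k‖ ≤ ∫ x, ‖f x‖ := by
  refine (norm_integral_le_integral_norm _).trans (le_of_eq (integral_congr_ae ?_))
  refine Eventually.of_forall fun x => ?_
  simp only
  rw [norm_mul, Complex.norm_real, mul_comm Complex.I, ← neg_mul, ← Complex.ofReal_neg,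
      Complex.norm_exp_ofReal_mul_I, one_mul]

/-- The weight `|k|^n Re (f̃ g̃*) / (2π)³` of the smeared two-point functions. -/
def smearWeight (n : ℝ) (f g : Space3 → ℝ) (k : Space3) : ℝ :=
  ((2 * Real.pi) ^ 3)⁻¹ * (‖k‖ ^ n * (smearFourier f k * (starRingEnd ℂ) (smearFourier g k)).re)

/-- The weight `|k|^n |f̃| |g̃| / (2π)³`. -/
def absWeight (n : ℝ) (f g : Space3 → ℝ) (k : Space3) : ℝ :=
  ((2 * Real.pi) ^ 3)⁻¹ * (‖k‖ ^ n * (‖smearFourier f k‖ * ‖smearFourier g k‖))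

lemma absWeight_nonneg (n : ℝ) (f g : Space3 → ℝ) (k : Space3) : 0 ≤ absWeight n f g k := by
  have := Real.pi_pos
  unfold absWeight; positivity

lemma abs_smearWeight_le (n : ℝ) (f g : Space3 → ℝ) (k : Space3) :
    |smearWeight n f g k| ≤ absWeight n f g k := by
  have := Real.pi_pos
  rw [smearWeight, absWeight, abs_mul, abs_mul, abs_of_pos (by positivity),
    abs_of_nonneg (by positivity : 0 ≤ ‖k‖ ^ n)]
  gcongr
  refine (Complex.abs_re_le_norm _).trans ?_
  rw [norm_mul, RCLike.norm_conj]

lemma smearWeight_self (n : ℝ) (f : Space3 → ℝ) : smearWeight n f f = absWeight n f f := by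
  funext k
  rw [smearWeight, absWeight, Complex.mul_conj, Complex.ofReal_re, Complex.normSq_eq_norm_sq]
  ring

lemma measurable_norm_rpow (n : ℝ) : Measurable fun k : Space3 => ‖k‖ ^ n := by fun_prop

lemma measurable_absWeight {f g : Space3 → ℝ} (hf : Integrable f) (hg : Integrable g) (n : ℝ) :
    Measurable (absWeight n f g) := by
  unfold absWeight
  exact measurable_const.mul ((measurable_norm_rpow n).mul
    ((continuous_smearFourier hf).norm.measurable.mul
      (continuous_smearFourier hg).norm.measurable))

lemma measurable_smearWeight {f g : Space3 → ℝ} (hf : Integrable f) (hg : Integrable g) (n : ℝ) :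
    Measurable (smearWeight n f g) := by
  unfold smearWeight
  exact measurable_const.mul ((measurable_norm_rpow n).mul
    (Complex.measurable_re.comp ((continuous_smearFourier hf).measurable.mul
      (Complex.continuous_conj.measurable.comp (continuous_smearFourier hg).measurable))))

lemma norm_rpow_mul_absWeight {k : Space3} (hk : k ≠ 0) (s n : ℝ) (f g : Space3 → ℝ) :
    ‖k‖ ^ s * absWeight n f g k = absWeight (n + s) f g k := by
  rw [absWeight, absWeight, Real.rpow_add (norm_pos_iff.2 hk)]; ring

lemma norm_rpow_mul_smearWeight {k : Space3} (hk : k ≠ 0) (s n : ℝ) (f g : Space3 → ℝ) :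
    ‖k‖ ^ s * smearWeight n f g k = smearWeight (n + s) f g k := by
  rw [smearWeight, smearWeight, Real.rpow_add (norm_pos_iff.2 hk)]; ring

lemma sobolevNormSq_eq (s : ℝ) (f : Space3 → ℝ) :
    sobolevNormSq s f = ∫⁻ k, ENNReal.ofReal (absWeight (2 * s) f f k) := by
  unfold sobolevNormSq absWeight
  refine lintegral_congr fun k => ?_
  congr 1
  ring

lemma integrable_absWeight_of_sobolevNormSq {f : Space3 → ℝ} (hf : Integrable f) {s n : ℝ}
    (hn : n = 2 * s) (h : sobolevNormSq s f < ⊤) : Integrable (absWeight n f f) := by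
  rw [sobolevNormSq_eq, ← hn] at h
  refine ⟨(measurable_absWeight hf hf n).aestronglyMeasurable, ?_⟩
  rwa [hasFiniteIntegral_iff_ofReal (Eventually.of_forall fun k => absWeight_nonneg n f f k)]

lemma integrableOn_ball_rpow {s : ℝ} (hs : s < 3) :
    Integrable fun k : Space3 => (Iic (1 : ℝ)).indicator (fun y => y ^ (-s)) ‖k‖ := by
  rw [integrable_fun_norm_addHaar (μ := (volume : Measure Space3))
    (f := (Iic (1 : ℝ)).indicator (fun y => y ^ (-s)))]
  have h1 : IntegrableOn (fun y : ℝ => y ^ (2 - s)) (Ioc 0 1) :=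
    (intervalIntegrable_iff_integrableOn_Ioc_of_le zero_le_one).1
      (intervalIntegral.intervalIntegrable_rpow' (by linarith))
  have h2 : IntegrableOn (fun y : ℝ => (Iic (1 : ℝ)).indicator (fun y => y ^ (2 - s)) y)
      (Ioi 0) := by
    rw [IntegrableOn, integrable_indicator_iff measurableSet_Iic, IntegrableOn,
      Measure.restrict_restrict measurableSet_Iic, Iic_inter_Ioi]
    exact h1
  refine h2.congr_fun (fun y hy => ?_) measurableSet_Ioi
  have hy' : (0 : ℝ) < y := hy
  have e : (2 - s : ℝ) = -s + (2 : ℕ) := by push_cast; ring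
  by_cases h : y ∈ Iic (1 : ℝ)
  · simp only [indicator_of_mem h, smul_eq_mul, finrank_euclideanSpace, Fintype.card_fin]
    rw [e, Real.rpow_add_natCast hy'.ne', mul_comm]
  · simp [indicator_of_notMem h]

/-- At s = 3 - 2a this is proportional to 1/(2a), the infrared divergence that limits the estimate
for the exact momentum. -/
lemma integral_ball_rpow_le {s : ℝ} (hs : s < 3) :
    ∫ k : Space3, (Iic (1 : ℝ)).indicator (fun y => y ^ (-s)) ‖k‖ =
      3 * (volume : Measure Space3).real (Metric.ball 0 1) * (3 - s)⁻¹ := by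
  rw [integral_fun_norm_addHaar (μ := (volume : Measure Space3))
    ((Iic (1 : ℝ)).indicator (fun y => y ^ (-s)))]
  have h1 : ∫ y in Ioi (0 : ℝ), y ^ (Module.finrank ℝ Space3 - 1) •
      (Iic (1 : ℝ)).indicator (fun y => y ^ (-s)) y = ∫ y in Ioc (0 : ℝ) 1, y ^ (2 - s) := by
    rw [← Iic_inter_Ioi, ← Measure.restrict_restrict measurableSet_Iic,
      ← integral_indicator measurableSet_Iic]
    refine setIntegral_congr_fun measurableSet_Ioi fun y hy => ?_
    have hy' : (0 : ℝ) < y := hy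
    have e : (2 - s : ℝ) = -s + (2 : ℕ) := by push_cast; ring
    by_cases h : y ∈ Iic (1 : ℝ)
    · simp only [indicator_of_mem h, smul_eq_mul, finrank_euclideanSpace, Fintype.card_fin]
      rw [e, Real.rpow_add_natCast hy'.ne', mul_comm]
    · simp [indicator_of_notMem h]
  rw [h1, ← intervalIntegral.integral_of_le zero_le_one, integral_rpow (Or.inl (by linarith))]
  have h3 : (2 - s + 1) = 3 - s := by ring
  rw [h3, Real.one_rpow, Real.zero_rpow (by linarith)]
  simp
  ring

/-- A weight which stays integrable against every `|k|^{-s}` with `s < 2`. -/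
def InfraredMild (m : Space3 → ℝ) : Prop :=
  ∀ s : ℝ, 0 ≤ s → s < 2 → Integrable fun k => ‖k‖ ^ (-s) * m k

lemma ae_ne_zero_space3 : ∀ᵐ k : Space3, k ≠ 0 := by
  rw [ae_iff]; simp

lemma InfraredMild.integrable {m : Space3 → ℝ} (hm : InfraredMild m) : Integrable m := by
  simpa using hm 0 le_rfl two_pos

lemma InfraredMild.mono {m m' : Space3 → ℝ} (hm : InfraredMild m) (hm' : Measurable m')
    (h : ∀ k, |m' k| ≤ m k) : InfraredMild m' := by
  intro s hs hs'
  refine (hm s hs hs').mono' ((measurable_norm_rpow _).mul hm').aestronglyMeasurable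
    (Eventually.of_forall fun k => ?_)
  rw [norm_mul, Real.norm_of_nonneg (by positivity)]
  exact mul_le_mul_of_nonneg_left (h k) (by positivity)

/-- Near the origin |k|^{-s-1} is integrable in three dimensions because s + 1 < 3; outside the unit
ball |k|^{-s} ≤ 1. -/
lemma infraredMild_of_bound {m E : Space3 → ℝ} {C : ℝ} (hm : Measurable m) (hE : Integrable E)
    (h1 : ∀ k : Space3, k ≠ 0 → ‖k‖ ≤ 1 → |m k| ≤ C * ‖k‖ ^ (-1 : ℝ))
    (h2 : ∀ k : Space3, 1 ≤ ‖k‖ → |m k| ≤ E k) : InfraredMild m := by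
  intro s hs hs'
  refine Integrable.mono' (((integrableOn_ball_rpow (s := s + 1) (by linarith)).const_mul C).add
    hE.norm) ((measurable_norm_rpow _).mul hm).aestronglyMeasurable ?_
  filter_upwards [ae_ne_zero_space3] with k hk
  have hk' := norm_pos_iff.2 hk
  rw [norm_mul, Real.norm_of_nonneg (by positivity), Pi.add_apply]
  by_cases h : ‖k‖ ≤ 1
  · rw [indicator_of_mem (show ‖k‖ ∈ Iic (1 : ℝ) from h)]
    have e : ‖k‖ ^ (-(s + 1)) = ‖k‖ ^ (-s) * ‖k‖ ^ (-1 : ℝ) := by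
      rw [← Real.rpow_add hk']; congr 1; ring
    have := mul_le_mul_of_nonneg_left (h1 k hk h) (by positivity : 0 ≤ ‖k‖ ^ (-s))
    rw [e]
    have h0 := norm_nonneg (E k)
    rw [Real.norm_eq_abs]
    linarith
  · rw [indicator_of_notMem (show ‖k‖ ∉ Iic (1 : ℝ) from h), mul_zero, zero_add]
    push Not at h
    have h3 : ‖k‖ ^ (-s) ≤ 1 := Real.rpow_le_one_of_one_le_of_nonpos h.le (by linarith)
    calc ‖k‖ ^ (-s) * ‖m k‖ ≤ 1 * E k := by
          gcongr
          exact h2 k h.le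
      _ ≤ _ := by rw [one_mul]; exact le_abs_self _

/-- Integrable smearing functions with `‖f‖_{-1/2} < ∞` and `‖g‖_{1/2} < ∞`. -/
structure FinitePair (f g : Space3 → ℝ) : Prop where
  left : Integrable f
  right : Integrable g
  sobolev_left : Integrable (absWeight (-1) f f)
  sobolev_right : Integrable (absWeight 1 g g)

/-- The absolute weights which occur below are mild. -/
lemma infraredMild_absWeight {f g u v : Space3 → ℝ} (hfg : FinitePair f g)
    (hu : Integrable u) (hv : Integrable v) {n : ℝ} (hn : -1 ≤ n)
    (h : ∀ k : Space3, 1 ≤ ‖k‖ →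
      absWeight n u v k ≤ absWeight (-1) f f k + absWeight 1 g g k) :
    InfraredMild (absWeight n u v) := by
  refine infraredMild_of_bound (C := ((2 * Real.pi) ^ 3)⁻¹ * ((∫ x, ‖u x‖) * ∫ x, ‖v x‖))
    (measurable_absWeight hu hv n) (hfg.sobolev_left.add hfg.sobolev_right) (fun k hk hk1 => ?_) (fun k hk => ?_)
  · rw [abs_of_nonneg (absWeight_nonneg _ _ _ _), absWeight, mul_assoc]
    have := Real.pi_pos
    have h1 := norm_smearFourier_le u k
    have h2 := norm_smearFourier_le v k
    have h3 : ‖k‖ ^ n ≤ ‖k‖ ^ (-1 : ℝ) :=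
      Real.rpow_le_rpow_of_exponent_ge (norm_pos_iff.2 hk) hk1 hn
    rw [mul_comm ((∫ x, ‖u x‖) * ∫ x, ‖v x‖)]
    gcongr
  · rw [abs_of_nonneg (absWeight_nonneg _ _ _ _)]
    exact h k hk

lemma infraredMild_ff {f g : Space3 → ℝ} (hfg : FinitePair f g) :
    InfraredMild (absWeight (-1) f f) :=
  infraredMild_absWeight hfg hfg.left hfg.left le_rfl
    fun _ _ => le_add_of_nonneg_right (absWeight_nonneg _ _ _ _)

lemma infraredMild_gg {f g : Space3 → ℝ} (hfg : FinitePair f g) {n : ℝ} (hn : -1 ≤ n) (hn' : n ≤ 1) :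
    InfraredMild (absWeight n g g) :=
  infraredMild_absWeight hfg hfg.right hfg.right hn fun k hk => by
    refine le_trans ?_ (le_add_of_nonneg_left (absWeight_nonneg _ _ _ _))
    have := Real.pi_pos
    unfold absWeight
    gcongr

/-- Outside the unit ball the mixed weight is controlled by the arithmetic–geometric inequality
|f̃||g̃| ≤ |k|⁻¹|f̃|² + |k||g̃|². -/
lemma infraredMild_fg {f g : Space3 → ℝ} (hfg : FinitePair f g) {n : ℝ} (hn : -1 ≤ n) (hn' : n ≤ 0) :
    InfraredMild (absWeight n f g) :=
  infraredMild_absWeight hfg hfg.left hfg.right hn fun k hk => by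
    have := Real.pi_pos
    have h0 : 0 < ‖k‖ := by linarith
    have h1 : ‖k‖ ^ n ≤ 1 := Real.rpow_le_one_of_one_le_of_nonpos hk hn'
    unfold absWeight
    rw [← mul_add]
    have e : ‖k‖ ^ (-1 : ℝ) = ‖k‖⁻¹ := Real.rpow_neg_one _
    rw [e, Real.rpow_one]
    have h2 : ‖smearFourier f k‖ * ‖smearFourier g k‖ ≤
        ‖k‖⁻¹ * (‖smearFourier f k‖ * ‖smearFourier f k‖) +
          ‖k‖ * (‖smearFourier g k‖ * ‖smearFourier g k‖) := by
      generalize ‖smearFourier f k‖ = x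
      generalize ‖smearFourier g k‖ = y
      generalize ‖k‖ = z at *
      have : z⁻¹ * (x * x) + z * (y * y) - x * y =
          z⁻¹ * ((x - z * y / 2) ^ 2 + 3 / 4 * (z * y) ^ 2) := by field_simp; ring
      have h3 : 0 ≤ z⁻¹ * ((x - z * y / 2) ^ 2 + 3 / 4 * (z * y) ^ 2) := by positivity
      linarith
    gcongr
    exact (mul_le_of_le_one_left (by positivity) h1).trans h2

lemma infraredMild_smear_fg {f g : Space3 → ℝ} (hfg : FinitePair f g) {n : ℝ} (hn : -1 ≤ n)
    (hn' : n ≤ 0) :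
    InfraredMild (smearWeight n f g) :=
  (infraredMild_fg hfg hn hn').mono (measurable_smearWeight hfg.left hfg.right n)
    (abs_smearWeight_le n f g)

/-! ### Integrals of modulus functions -/

/-- The momentum integral of a function of `k / H` against a weight. -/
def modeInt (φ : ℝ → ℝ) (m : Space3 → ℝ) (H : ℝ) : ℝ := ∫ k : Space3, φ (‖k‖ / H) * m k

lemma aestronglyMeasurable_comp_norm_div {φ : ℝ → ℝ} (hφ : ContinuousOn φ (Ioi 0)) {H : ℝ}
    (hH : 0 < H) : AEStronglyMeasurable (fun k : Space3 => φ (‖k‖ / H)) volume := by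
  have h : ContinuousOn (fun k : Space3 => φ (‖k‖ / H)) {0}ᶜ :=
    hφ.comp (by fun_prop) fun k hk => div_pos (norm_pos_iff.2 hk) hH
  have h2 := h.aestronglyMeasurable (μ := volume) (measurableSet_singleton 0).compl
  rwa [Measure.restrict_eq_self_of_ae_mem] at h2
  exact ae_ne_zero_space3

lemma integrable_mode {φ : ℝ → ℝ} {m : Space3 → ℝ} {H K s : ℝ} (hφ : ContinuousOn φ (Ioi 0))
    (hm : InfraredMild m) (hH : 0 < H) (hs : 0 ≤ s) (hs' : s < 2)
    (hb : ∀ x, 0 < x → |φ x| ≤ K * (1 + x ^ (-s))) :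
    Integrable fun k : Space3 => φ (‖k‖ / H) * m k := by
  refine Integrable.mono' ((hm.integrable.norm.const_mul K).add
    ((hm s hs hs').norm.const_mul (K * H ^ s)))
    ((aestronglyMeasurable_comp_norm_div hφ hH).mul hm.integrable.aestronglyMeasurable) ?_
  filter_upwards [ae_ne_zero_space3] with k hk
  have hk' := norm_pos_iff.2 hk
  rw [norm_mul, Pi.add_apply, norm_mul, Real.norm_of_nonneg (by positivity : 0 ≤ ‖k‖ ^ (-s))]
  have h := mul_le_mul_of_nonneg_right (hb _ (div_pos hk' hH)) (norm_nonneg (m k))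
  refine h.trans (le_of_eq ?_)
  rw [Real.div_rpow hk'.le hH.le, Real.rpow_neg hH.le s, div_inv_eq_mul]
  ring

/-- Differentiation under the integral, with ∂_H φ(k/H) = H⁻¹(-xφ'(x)) at x = k/H, dominated on H/2
< y < 2H. This is why the negatives of the Euler derivatives occur throughout. -/
lemma hasDerivAt_modeInt {φ φ' : ℝ → ℝ} {m : Space3 → ℝ} {H K s : ℝ}
    (hφ : ∀ x, 0 < x → HasDerivAt φ (φ' x) x) (hφ' : ContinuousOn φ' (Ioi 0))
    (hm : InfraredMild m) (hH : 0 < H) (hs : 0 ≤ s) (hs' : s < 2)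
    (hb : ∀ x, 0 < x → |φ x| ≤ K * (1 + x ^ (-s)))
    (hb' : ∀ x, 0 < x → |x * φ' x| ≤ K * (1 + x ^ (-s))) :
    HasDerivAt (modeInt φ m) (H⁻¹ * modeInt (fun x => -(x * φ' x)) m H) H := by
  have hK : 0 ≤ K := by
    have := (abs_nonneg _).trans (hb 1 one_pos)
    rw [Real.one_rpow] at this
    linarith
  have hφc : ContinuousOn φ (Ioi 0) := fun x hx => (hφ x hx).continuousAt.continuousWithinAt
  have hc2 : ContinuousOn (fun x => -(x * φ' x)) (Ioi 0) := (continuousOn_id.mul hφ').neg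
  have h := hasDerivAt_integral_of_dominated_loc_of_deriv_le (𝕜 := ℝ)
    (μ := (volume : Measure Space3))
    (F := fun H k => φ (‖k‖ / H) * m k)
    (F' := fun H k => H⁻¹ * (-(‖k‖ / H * φ' (‖k‖ / H)) * m k))
    (bound := fun k => (H / 2)⁻¹ * (K * ‖m k‖ + K * (2 * H) ^ s * ‖‖k‖ ^ (-s) * m k‖))
    (x₀ := H) (s := Ioo (H / 2) (2 * H)) (Ioo_mem_nhds (by linarith) (by linarith))
    ?_ (integrable_mode hφc hm hH hs hs' hb) ?_ ?_ ?_ ?_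
  · have h2 := h.2
    rw [integral_const_mul] at h2
    exact h2
  · filter_upwards [lt_mem_nhds hH] with y hy
    exact (aestronglyMeasurable_comp_norm_div hφc hy).mul hm.integrable.aestronglyMeasurable
  · exact ((aestronglyMeasurable_comp_norm_div hc2 hH).mul
      hm.integrable.aestronglyMeasurable).const_mul _
  · filter_upwards [ae_ne_zero_space3] with k hk y hy
    have hk' := norm_pos_iff.2 hk
    have hy0 : 0 < y := by linarith [hy.1]
    have e1 : ‖‖k‖ ^ (-s) * m k‖ = ‖k‖ ^ (-s) * ‖m k‖ := by
      rw [norm_mul, Real.norm_of_nonneg (by positivity)]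
    rw [e1, norm_mul, norm_mul, norm_neg, norm_inv, Real.norm_of_nonneg hy0.le]
    have h1 := hb' _ (div_pos hk' hy0)
    have h2 : (‖k‖ / y) ^ (-s) ≤ (2 * H) ^ s * ‖k‖ ^ (-s) := by
      rw [Real.div_rpow hk'.le hy0.le, Real.rpow_neg hy0.le s, div_inv_eq_mul, mul_comm]
      gcongr
      exact hy.2.le
    have h3 : y⁻¹ ≤ (H / 2)⁻¹ := by
      apply inv_anti₀ (by positivity) hy.1.le
    calc y⁻¹ * (‖‖k‖ / y * φ' (‖k‖ / y)‖ * ‖m k‖)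
        ≤ (H / 2)⁻¹ * (K * (1 + (2 * H) ^ s * ‖k‖ ^ (-s)) * ‖m k‖) := by
          gcongr
          exact h1.trans (by gcongr)
      _ = _ := by ring
  · exact ((hm.integrable.norm.const_mul K).add
      ((hm s hs hs').norm.const_mul (K * (2 * H) ^ s))).const_mul _
  · filter_upwards [ae_ne_zero_space3] with k hk y hy
    have hk' := norm_pos_iff.2 hk
    have hy0 : 0 < y := by linarith [hy.1]
    have h1 : HasDerivAt (fun y : ℝ => ‖k‖ / y) (-‖k‖ / y ^ 2) y := by
      refine (((hasDerivAt_inv hy0.ne').const_mul ‖k‖).congr_deriv ?_)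
      field_simp
    have h2 := ((hφ _ (div_pos hk' hy0)).comp y h1).mul_const (m k)
    refine h2.congr_deriv ?_
    field_simp

/-- As H → 0 the argument k/H tends to infinity. For H ≤ 1 one has (k/H)^{-s} ≤ k^{-s}, an
integrable majorant. -/
lemma tendsto_modeInt_zero {φ : ℝ → ℝ} {m : Space3 → ℝ} {K s l : ℝ}
    (hφ : ContinuousOn φ (Ioi 0)) (hm : InfraredMild m) (hs : 0 ≤ s) (hs' : s < 2)
    (hb : ∀ x, 0 < x → |φ x| ≤ K * (1 + x ^ (-s))) (hl : Tendsto φ atTop (𝓝 l)) :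
    Tendsto (modeInt φ m) (𝓝[>] 0) (𝓝 (l * ∫ k, m k)) := by
  have hK : 0 ≤ K := by
    have := (abs_nonneg _).trans (hb 1 one_pos)
    rw [Real.one_rpow] at this
    linarith
  rw [← integral_const_mul]
  refine tendsto_integral_filter_of_dominated_convergence
    (fun k => K * ‖m k‖ + K * ‖‖k‖ ^ (-s) * m k‖) ?_ ?_
    ((hm.integrable.norm.const_mul K).add ((hm s hs hs').norm.const_mul K)) ?_
  · filter_upwards [self_mem_nhdsWithin] with y hy
    exact (aestronglyMeasurable_comp_norm_div hφ hy).mul hm.integrable.aestronglyMeasurable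
  · filter_upwards [Ioo_mem_nhdsGT one_pos] with y hy
    filter_upwards [ae_ne_zero_space3] with k hk
    have hk' := norm_pos_iff.2 hk
    have hy0 : 0 < y := hy.1
    rw [norm_mul, norm_mul, Real.norm_of_nonneg (by positivity : 0 ≤ ‖k‖ ^ (-s))]
    have h2 : (‖k‖ / y) ^ (-s) ≤ ‖k‖ ^ (-s) := by
      rw [Real.div_rpow hk'.le hy0.le, Real.rpow_neg hy0.le s, div_inv_eq_mul]
      exact mul_le_of_le_one_right (by positivity) (Real.rpow_le_one hy0.le hy.2.le hs)
    calc ‖φ (‖k‖ / y)‖ * ‖m k‖ ≤ K * (1 + ‖k‖ ^ (-s)) * ‖m k‖ := by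
          gcongr
          exact (hb _ (div_pos hk' hy0)).trans (by gcongr)
      _ = _ := by ring
  · filter_upwards [ae_ne_zero_space3] with k hk
    have hk' := norm_pos_iff.2 hk
    refine Tendsto.mul_const _ (hl.comp ?_)
    exact (tendsto_inv_nhdsGT_zero.const_mul_atTop hk').congr fun y => (div_eq_mul_inv _ _).symm

end

noncomputable section
open MeasureTheory Filter Topology Set

/-! ### Uniform bounds for small orders -/

/-- Orders for which the uniform estimates of the modulus functions hold. -/
structure SmallOrder (a : ℝ) : Prop where
  pos : 0 < a
  le : a ≤ 1 / 1000
  modQ_le : ∀ x, 0 < x → modQ a x ≤ 8 * x ^ (2 * a)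

lemma exists_smallOrder : ∃ ε : ℝ, 0 < ε ∧ ∀ a, 0 < a → a < ε → SmallOrder a := by
  obtain ⟨ε, hε, h⟩ := exists_modQ_le_rpow
  exact ⟨min ε (1 / 1000), by positivity, fun a ha ha' =>
    ⟨ha, (ha'.trans_le (min_le_right _ _)).le, h a ha.le (ha'.trans_le (min_le_left _ _))⟩⟩

namespace SmallOrder
variable {a x : ℝ}

lemma lt_one (h : SmallOrder a) : a < 1 := by linarith [h.le]

lemma modQ_pos (h : SmallOrder a) (hx : 0 < x) : 0 < modQ a x := _root_.modQ_pos h.pos.le h.lt_one hx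

lemma modQ_le_one (h : SmallOrder a) : modQ a x ≤ 1 := _root_.modQ_le_one h.pos.le h.lt_one

lemma continuousOn_modQ (h : SmallOrder a) : ContinuousOn (modQ a) (Ioi 0) := fun _ hx =>
  (hasDerivAt_modQ h.pos.le h.lt_one hx).continuousAt.continuousWithinAt

lemma continuousOn_modP (h : SmallOrder a) : ContinuousOn (modP a) (Ioi 0) := fun _ hx =>
  (hasDerivAt_modP h.pos.le h.lt_one hx).continuousAt.continuousWithinAt

lemma continuousOn_modC (h : SmallOrder a) : ContinuousOn (modC a) (Ioi 0) := fun _ hx =>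
  (hasDerivAt_modC h.pos.le h.lt_one hx).continuousAt.continuousWithinAt

lemma modQ_div_sq_le (h : SmallOrder a) (hx : 0 < x) :
    modQ a x / x ^ 2 ≤ 8 * x ^ (-(2 - 2 * a)) := by
  rw [div_le_iff₀ (by positivity), mul_assoc, ← Real.rpow_natCast, ← Real.rpow_add hx]
  refine (h.modQ_le x hx).trans (le_of_eq ?_)
  congr 2
  push_cast
  ring

lemma modQ_div_le (h : SmallOrder a) (hx : 0 < x) :
    modQ a x / x ≤ modQ a x + modQ a x / x ^ 2 := by
  have hq := h.modQ_pos hx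
  have e : modQ a x + modQ a x / x ^ 2 - modQ a x / x =
      modQ a x / x ^ 2 * ((x - 1 / 2) ^ 2 + 3 / 4) := by field_simp; ring
  have : 0 ≤ modQ a x / x ^ 2 * ((x - 1 / 2) ^ 2 + 3 / 4) := by positivity
  linarith

/-- A single majorant for P, C, Q and their Euler derivatives. The exponent 2 - 2a is below 2, as
mild weights require, only because a > 0. -/
lemma bound_of_le (h : SmallOrder a) (hx : 0 < x) {y : ℝ}
    (hy : |y| ≤ 3 * (modQ a x + modQ a x / x ^ 2)) :
    |y| ≤ 24 * (1 + x ^ (-(2 - 2 * a))) := by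
  have h1 := h.modQ_div_sq_le hx
  have h2 := h.modQ_le_one (x := x)
  linarith

lemma abs_modP_le (h : SmallOrder a) (hx : 0 < x) :
    |modP a x| ≤ 3 * (modQ a x + modQ a x / x ^ 2) := by
  have hq := h.modQ_pos hx
  have h2 : 0 ≤ modQ a x / x ^ 2 := by positivity
  rw [abs_of_nonneg (show 0 ≤ modP a x from sq_nonneg _)]
  linarith [modP_le h.pos.le h.le hx]

/-- Relative errors of at most 1/2 fix the signs of C and of the negative Euler derivatives of P and
C. -/
lemma small (h : SmallOrder a) : 500 * a ≤ 1 / 2 := by linarith [h.le]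

lemma modC_bounds (h : SmallOrder a) (hx : 0 < x) :
    0 ≤ modC a x ∧ modC a x ≤ 2 * (modQ a x / x) := by
  have hq := div_pos (h.modQ_pos hx) hx
  have h1 := abs_le.1 (abs_modC_sub_le h.pos.le h.le hx)
  have := mul_le_mul_of_nonneg_right h.small hq.le
  constructor <;> linarith

lemma euler_modC_bounds (h : SmallOrder a) (hx : 0 < x) :
    0 ≤ x * (modP a x - modQ a x) ∧ x * (modP a x - modQ a x) ≤ 2 * (modQ a x / x) := by
  have hq := div_pos (h.modQ_pos hx) hx
  have h1 := abs_le.1 (abs_euler_modC_sub_le h.pos.le h.le hx)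
  have := mul_le_mul_of_nonneg_right h.small hq.le
  constructor <;> linarith

lemma euler_modP_bounds (h : SmallOrder a) (hx : 0 < x) :
    0 ≤ 2 * ((1 - a) * modP a x - x * modC a x) ∧
      2 * ((1 - a) * modP a x - x * modC a x) ≤ 3 * (modQ a x / x ^ 2) := by
  have hq : 0 < modQ a x / x ^ 2 := div_pos (h.modQ_pos hx) (by positivity)
  have h1 := abs_le.1 (abs_euler_modP_sub_le h.pos.le h.le hx)
  have := mul_le_mul_of_nonneg_right h.small hq.le
  constructor <;> linarith

lemma abs_le_of_le_div (h : SmallOrder a) (hx : 0 < x) {y : ℝ} (hy : 0 ≤ y)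
    (hy' : y ≤ 2 * (modQ a x / x)) : |y| ≤ 3 * (modQ a x + modQ a x / x ^ 2) := by
  have h1 := h.modQ_div_le hx
  have h2 : 0 < modQ a x / x ^ 2 := div_pos (h.modQ_pos hx) (by positivity)
  have h3 := h.modQ_pos hx
  rw [abs_of_nonneg hy]
  linarith

/-- Functions bounded by `modQ` and `modQ / x ^ 2` are integrable against mild weights. -/
lemma integrable (h : SmallOrder a) {φ : ℝ → ℝ} {m : Space3 → ℝ} {H : ℝ}
    (hφ : ContinuousOn φ (Ioi 0)) (hm : InfraredMild m) (hH : 0 < H)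
    (hb : ∀ x, 0 < x → |φ x| ≤ 3 * (modQ a x + modQ a x / x ^ 2)) :
    Integrable fun k : Space3 => φ (‖k‖ / H) * m k :=
  integrable_mode hφ hm hH (s := 2 - 2 * a) (by linarith [h.le]) (by linarith [h.pos])
    fun x hx => h.bound_of_le hx (hb x hx)

lemma continuousOn_modQ_div (h : SmallOrder a) :
    ContinuousOn (fun x => modQ a x / x) (Ioi 0) :=
  h.continuousOn_modQ.div continuousOn_id fun _ hx => ne_of_gt hx

lemma continuousOn_modQ_div_sq (h : SmallOrder a) :
    ContinuousOn (fun x => modQ a x / x ^ 2) (Ioi 0) :=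
  h.continuousOn_modQ.div (by fun_prop) fun _ hx => pow_ne_zero 2 (ne_of_gt hx)

lemma integrable_modQ (h : SmallOrder a) {m : Space3 → ℝ} {H : ℝ} (hm : InfraredMild m)
    (hH : 0 < H) : Integrable fun k : Space3 => modQ a (‖k‖ / H) * m k :=
  h.integrable h.continuousOn_modQ hm hH fun x hx => by
    have h2 : 0 < modQ a x / x ^ 2 := div_pos (h.modQ_pos hx) (by positivity)
    have h3 := h.modQ_pos hx
    rw [abs_of_pos h3]; linarith

lemma integrable_modQ_div (h : SmallOrder a) {m : Space3 → ℝ} {H : ℝ} (hm : InfraredMild m)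
    (hH : 0 < H) : Integrable fun k : Space3 => modQ a (‖k‖ / H) / (‖k‖ / H) * m k :=
  h.integrable (φ := fun x => modQ a x / x) h.continuousOn_modQ_div hm hH fun x hx =>
    h.abs_le_of_le_div hx (div_pos (h.modQ_pos hx) hx).le
      (by linarith [div_pos (h.modQ_pos hx) hx])

lemma integrable_modQ_div_sq (h : SmallOrder a) {m : Space3 → ℝ} {H : ℝ} (hm : InfraredMild m)
    (hH : 0 < H) : Integrable fun k : Space3 => modQ a (‖k‖ / H) / (‖k‖ / H) ^ 2 * m k :=
  h.integrable (φ := fun x => modQ a x / x ^ 2) h.continuousOn_modQ_div_sq hm hH fun x hx => by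
    have h2 : 0 < modQ a x / x ^ 2 := div_pos (h.modQ_pos hx) (by positivity)
    have h3 := h.modQ_pos hx
    rw [abs_of_pos h2]; linarith

end SmallOrder

/-- The Cauchy–Schwarz inequality in the form used for Gram determinants. -/
lemma sq_integral_le_mul {u v w : Space3 → ℝ} (hu : Integrable u) (hv : Integrable v)
    (hw : Integrable w) (h : ∀ᵐ k, 0 ≤ u k ∧ 0 ≤ v k ∧ 0 ≤ w k ∧ w k ^ 2 ≤ u k * v k) :
    (∫ k, w k) ^ 2 ≤ (∫ k, u k) * ∫ k, v k := by
  have hU : 0 ≤ ∫ k, u k := integral_nonneg_of_ae (h.mono fun k hk => hk.1)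
  have hV : 0 ≤ ∫ k, v k := integral_nonneg_of_ae (h.mono fun k hk => hk.2.1)
  have key : ∀ t : ℝ, 0 < t → 2 * t * ∫ k, w k ≤ t ^ 2 * (∫ k, u k) + ∫ k, v k := by
    intro t ht
    rw [← integral_const_mul, ← integral_const_mul, ← integral_add (hu.const_mul _) hv]
    refine integral_mono_ae (hw.const_mul _) ((hu.const_mul _).add hv) ?_
    filter_upwards [h] with k hk
    obtain ⟨h1, h2, h3, h4⟩ := hk
    have h5 : (t * w k) ^ 2 ≤ (t ^ 2 * u k) * v k := by nlinarith [sq_nonneg t]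
    have h6 : 0 ≤ t ^ 2 * u k := by positivity
    have h7 : 0 ≤ t * w k := by positivity
    nlinarith [sq_nonneg (t ^ 2 * u k - v k)]
  have hW : 0 ≤ ∫ k, w k := integral_nonneg_of_ae (h.mono fun k hk => hk.2.2.1)
  generalize (∫ k, u k) = U at *
  generalize (∫ k, v k) = V at *
  generalize (∫ k, w k) = W at *
  rcases hU.eq_or_lt with hU0 | hU0
  · rcases hW.eq_or_lt with hW0 | hW0
    · rw [← hW0]; nlinarith
    -- With U = 0 this t gives 2(V + 1) ≤ V, which is absurd.
    · have := key ((V + 1) / W) (by positivity)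
      rw [← hU0, mul_assoc, div_mul_cancel₀ _ hW0.ne'] at this
      linarith
  · rcases hW.eq_or_lt with hW0 | hW0
    · rw [← hW0]; nlinarith
    -- The minimizer of the quadratic in t.
    · have := key (W / U) (by positivity)
      have e : 2 * (W / U) * W = 2 * (W ^ 2 / U) := by ring
      have e' : (W / U) ^ 2 * U = W ^ 2 / U := by field_simp
      rw [e, e'] at this
      have h8 : W ^ 2 / U ≤ V := by linarith
      rw [div_le_iff₀ hU0] at h8
      linarith

lemma absWeight_mul_absWeight (n l j : ℝ) (hj : 2 * j = n + l) (f g : Space3 → ℝ) {k : Space3}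
    (hk : k ≠ 0) : absWeight j f g k ^ 2 = absWeight n f f k * absWeight l g g k := by
  have hk' := norm_pos_iff.2 hk
  have e : (‖k‖ ^ j) ^ 2 = ‖k‖ ^ n * ‖k‖ ^ l := by
    rw [← Real.rpow_natCast, ← Real.rpow_mul hk'.le, ← Real.rpow_add hk']
    congr 1; push_cast; linarith
  unfold absWeight
  generalize ((2 * Real.pi) ^ 3)⁻¹ = c
  rw [mul_pow, mul_pow, e]
  ring

/-- Cauchy–Schwarz with the factor Q as part of the measure: Q/x splits as the geometric mean of
Q/x² and Q. -/
lemma sq_modeInt_div_le {a H : ℝ} {f g : Space3 → ℝ} (h : SmallOrder a) (hfg : FinitePair f g)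
    (hH : 0 < H) :
    modeInt (fun x => modQ a x / x) (absWeight 0 f g) H ^ 2 ≤
      modeInt (fun x => modQ a x / x ^ 2) (absWeight (-1) f f) H *
        modeInt (modQ a) (absWeight 1 g g) H := by
  refine sq_integral_le_mul (h.integrable_modQ_div_sq (infraredMild_ff hfg) hH)
    (h.integrable_modQ (infraredMild_gg hfg (by norm_num) le_rfl) hH)
    (h.integrable_modQ_div (infraredMild_fg hfg (by norm_num) le_rfl) hH) ?_
  filter_upwards [ae_ne_zero_space3] with k hk
  have hx : 0 < ‖k‖ / H := div_pos (norm_pos_iff.2 hk) hH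
  have hq := h.modQ_pos hx
  have h1 := absWeight_nonneg (-1) f f k
  have h2 := absWeight_nonneg 1 g g k
  have h3 := absWeight_nonneg 0 f g k
  refine ⟨by positivity, by positivity, by positivity, le_of_eq ?_⟩
  rw [mul_pow, absWeight_mul_absWeight (-1) 1 0 (by norm_num) f g hk]
  field_simp

lemma sq_modeInt_div_sq_le {a H : ℝ} {f g : Space3 → ℝ} (h : SmallOrder a)
    (hfg : FinitePair f g) (hH : 0 < H) :
    modeInt (fun x => modQ a x / x ^ 2) (absWeight (-1) f g) H ^ 2 ≤
      modeInt (fun x => modQ a x / x ^ 2) (absWeight (-1) f f) H *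
        modeInt (fun x => modQ a x / x ^ 2) (absWeight (-1) g g) H := by
  refine sq_integral_le_mul (h.integrable_modQ_div_sq (infraredMild_ff hfg) hH)
    (h.integrable_modQ_div_sq (infraredMild_gg hfg (by norm_num) (by norm_num)) hH)
    (h.integrable_modQ_div_sq (infraredMild_fg hfg (by norm_num) (by norm_num)) hH) ?_
  filter_upwards [ae_ne_zero_space3] with k hk
  have hx : 0 < ‖k‖ / H := div_pos (norm_pos_iff.2 hk) hH
  have hq := h.modQ_pos hx
  have h1 := absWeight_nonneg (-1) f f k
  have h2 := absWeight_nonneg (-1) g g k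
  have h3 := absWeight_nonneg (-1) f g k
  refine ⟨by positivity, by positivity, by positivity, le_of_eq ?_⟩
  rw [mul_pow, absWeight_mul_absWeight (-1) (-1) (-1) (by norm_num) f g hk]
  ring

/-! ### The gap in Hölder's inequality -/

lemma sobolevProd_re {f g : Space3 → ℝ} {s n : ℝ} (hf : Integrable f) (hg : Integrable g)
    (hn : n = 2 * s) (h : Integrable (absWeight n f g)) :
    (sobolevProd s f g).re = ∫ k, smearWeight n f g k := by
  have hi : Integrable fun k : Space3 => ((((2 * Real.pi) ^ 3)⁻¹ * ‖k‖ ^ (2 * s) : ℝ) : ℂ) *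
      (smearFourier f k * (starRingEnd ℂ) (smearFourier g k)) := by
    refine h.mono' ?_ (Eventually.of_forall fun k => ?_)
    · exact ((Complex.measurable_ofReal.comp (measurable_const.mul (measurable_norm_rpow _))).mul
        ((continuous_smearFourier hf).measurable.mul (Complex.continuous_conj.measurable.comp
          (continuous_smearFourier hg).measurable))).aestronglyMeasurable
    · have := Real.pi_pos
      rw [norm_mul, norm_mul, RCLike.norm_conj, Complex.norm_real, Real.norm_of_nonneg
        (by positivity), absWeight, hn, mul_assoc]
  rw [sobolevProd]
  refine (integral_re hi).symm.trans (integral_congr_ae (Eventually.of_forall fun k => ?_))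
  rw [smearWeight, hn, ← mul_assoc]
  exact Complex.re_ofReal_mul _ _

/-- Hölder's inequality stated in [0, ∞], so that non-saturation becomes a strict inequality also
when ‖f‖_{-3/2} is infinite. -/
lemma ofReal_sq_le_mul_of_absWeight {f g : Space3 → ℝ} (hf : Integrable f) (hg : Integrable g)
    (h : Integrable (absWeight (-1) f g)) :
    ENNReal.ofReal ((∫ k, smearWeight (-1) f g k) ^ 2) ≤
      (∫⁻ k, ENNReal.ofReal (absWeight (-3) f f k)) *
        ∫⁻ k, ENNReal.ofReal (absWeight 1 g g k) := by
  have h1 : |∫ k, smearWeight (-1) f g k| ≤ ∫ k, absWeight (-1) f g k := by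
    rw [← Real.norm_eq_abs]
    exact norm_integral_le_of_norm_le h (Eventually.of_forall fun k => abs_smearWeight_le _ _ _ _)
  have h2 : ENNReal.ofReal (∫ k, absWeight (-1) f g k) =
      ∫⁻ k, ENNReal.ofReal (absWeight (-1) f g k) :=
    ofReal_integral_eq_lintegral_ofReal h (Eventually.of_forall fun k => absWeight_nonneg _ _ _ _)
  have hmf : AEMeasurable (fun k => ENNReal.ofReal (Real.sqrt (absWeight (-3) f f k)))
      (volume : Measure Space3) :=
    ((measurable_absWeight hf hf (-3)).sqrt.ennreal_ofReal).aemeasurable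
  have hmg : AEMeasurable (fun k => ENNReal.ofReal (Real.sqrt (absWeight 1 g g k)))
      (volume : Measure Space3) :=
    ((measurable_absWeight hg hg 1).sqrt.ennreal_ofReal).aemeasurable
  have h3 := ENNReal.lintegral_mul_le_Lp_mul_Lq volume Real.HolderConjugate.two_two hmf hmg
  have e1 : ∀ y : ℝ, 0 ≤ y → ENNReal.ofReal (Real.sqrt y) ^ (2 : ℝ) = ENNReal.ofReal y := by
    intro y hy
    rw [ENNReal.rpow_two, ← ENNReal.ofReal_pow (Real.sqrt_nonneg _), Real.sq_sqrt hy]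
  have e2 : ∫⁻ k, ENNReal.ofReal (absWeight (-1) f g k) =
      ∫⁻ k, ((fun k => ENNReal.ofReal (Real.sqrt (absWeight (-3) f f k))) *
        fun k => ENNReal.ofReal (Real.sqrt (absWeight 1 g g k))) k := by
    refine lintegral_congr_ae ?_
    filter_upwards [ae_ne_zero_space3] with k hk
    rw [Pi.mul_apply, ← ENNReal.ofReal_mul (Real.sqrt_nonneg _),
      ← Real.sqrt_mul (absWeight_nonneg _ _ _ _),
      ← absWeight_mul_absWeight (-3) 1 (-1) (by norm_num) f g hk,
      Real.sqrt_sq (absWeight_nonneg _ _ _ _)]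
  have e3 : ∀ (n : ℝ) (u : Space3 → ℝ), ∫⁻ k, ENNReal.ofReal (Real.sqrt (absWeight n u u k)) ^
      (2 : ℝ) = ∫⁻ k, ENNReal.ofReal (absWeight n u u k) := fun n u =>
    lintegral_congr fun k => e1 _ (absWeight_nonneg _ _ _ _)
  rw [e3, e3, ← e2, ← h2] at h3
  calc ENNReal.ofReal ((∫ k, smearWeight (-1) f g k) ^ 2)
      = ENNReal.ofReal |∫ k, smearWeight (-1) f g k| ^ (2 : ℝ) := by
        rw [ENNReal.rpow_two, ← ENNReal.ofReal_pow (abs_nonneg _), sq_abs]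
    _ ≤ ENNReal.ofReal (∫ k, absWeight (-1) f g k) ^ (2 : ℝ) := by gcongr
    _ ≤ _ := ENNReal.rpow_le_rpow h3 (by norm_num)
    _ = _ := by
      rw [ENNReal.mul_rpow_of_nonneg _ _ (by norm_num), ← ENNReal.rpow_mul, ← ENNReal.rpow_mul]
      norm_num

/-- Non-saturation in terms of real numbers below the two norms. -/
lemma exists_norm_lower_bounds {f g : Space3 → ℝ} (hfg : FinitePair f g)
    (hns : ¬ SaturatesHolder 0 f g) : ∃ n b : ℝ, 0 < n ∧ 0 < b ∧
      ENNReal.ofReal n < ∫⁻ k, ENNReal.ofReal (absWeight (-3) f f k) ∧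
      ENNReal.ofReal b < ∫⁻ k, ENNReal.ofReal (absWeight 1 g g k) ∧
      (∫ k, smearWeight (-1) f g k) ^ 2 < n * b := by
  have hi := (infraredMild_fg hfg (n := -1) le_rfl (by norm_num)).integrable
  have hle := ofReal_sq_le_mul_of_absWeight hfg.left hfg.right hi
  have hlt : ENNReal.ofReal ((∫ k, smearWeight (-1) f g k) ^ 2) <
      (∫⁻ k, ENNReal.ofReal (absWeight (-3) f f k)) *
        ∫⁻ k, ENNReal.ofReal (absWeight 1 g g k) := by
    refine lt_of_le_of_ne hle fun he => hns ?_
    rw [SaturatesHolder, sobolevProd_re hfg.left hfg.right (n := -1) (by norm_num) hi,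
      sobolevNormSq_eq, sobolevNormSq_eq, he]
    norm_num
  have hB : ∫⁻ k, ENNReal.ofReal (absWeight 1 g g k) =
      ENNReal.ofReal (∫ k, absWeight 1 g g k) :=
    (ofReal_integral_eq_lintegral_ofReal hfg.sobolev_right
      (Eventually.of_forall fun k => absWeight_nonneg _ _ _ _)).symm
  rw [hB] at hlt ⊢
  generalize (∫ k, absWeight 1 g g k) = B at *
  generalize (∫⁻ k, ENNReal.ofReal (absWeight (-3) f f k)) = N at *
  generalize (∫ k, smearWeight (-1) f g k) = X at *
  have hB0 : 0 < B := by
    by_contra hB0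
    rw [ENNReal.ofReal_of_nonpos (not_lt.1 hB0), mul_zero] at hlt
    exact not_lt_zero hlt
  -- A real n strictly between X²/B and N exists even if N = ∞. Replacing the norms by such n and b
  -- treats both cases alike.
  have h1 : ENNReal.ofReal (X ^ 2 / B) < N := by
    by_contra h
    push Not at h
    have : N * ENNReal.ofReal B ≤ ENNReal.ofReal (X ^ 2 / B) * ENNReal.ofReal B := by gcongr
    rw [← ENNReal.ofReal_mul (by positivity), div_mul_cancel₀ _ hB0.ne'] at this
    exact absurd hlt (not_lt.2 this)
  obtain ⟨n, hn1, hn2⟩ := ENNReal.lt_iff_exists_nnreal_btwn.1 h1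
  have hn3 : X ^ 2 / B < (n : ℝ) := by
    rw [← ENNReal.ofReal_coe_nnreal, ENNReal.ofReal_lt_ofReal_iff_of_nonneg (by positivity)] at hn1
    exact hn1
  have hn0 : (0 : ℝ) < n := lt_of_le_of_lt (by positivity) hn3
  have h2 : X ^ 2 / n < B := by
    rw [div_lt_iff₀ hB0] at hn3
    rw [div_lt_iff₀ hn0]; linarith
  obtain ⟨b, hb1, hb2⟩ := exists_between h2
  refine ⟨n, b, hn0, lt_of_le_of_lt (by positivity) hb1, ?_, ?_, ?_⟩
  · rwa [ENNReal.ofReal_coe_nnreal]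
  · exact (ENNReal.ofReal_lt_ofReal_iff hB0).2 hb2
  · rw [div_lt_iff₀ hn0] at hb1; linarith

end

/-! ### Uniformity of the Hölder gap in the Hubble rate -/

noncomputable section
open MeasureTheory Filter Topology Set

namespace SmallOrder

/-- The weight `modQ (k / H)` varies slowly in `k`, uniformly in `H`. -/
lemma modQ_div_bounds {a σ k H : ℝ} (h : SmallOrder a) (hσ : 96 * a ≤ σ) (hk : 0 < k)
    (hH : 0 < H) :
    modQ a (1 / H) * Real.exp (-(σ * |Real.log k|)) ≤ modQ a (k / H) ∧
      modQ a (k / H) ≤ modQ a (1 / H) * Real.exp (σ * |Real.log k|) := by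
  have h1 : 0 < 1 / H := by positivity
  have h2 : 0 < k / H := by positivity
  have ha : a ≤ 1 / 4 := by linarith [h.le]
  have e : Real.log (k / H) - Real.log (1 / H) = Real.log k := by
    rw [Real.log_div hk.ne' hH.ne', Real.log_div one_ne_zero hH.ne', Real.log_one]; ring
  have hm : Real.exp (96 * a * |Real.log k|) ≤ Real.exp (σ * |Real.log k|) :=
    Real.exp_le_exp.2 (mul_le_mul_of_nonneg_right hσ (abs_nonneg _))
  have h3 := modQ_le_exp_mul h.pos.le ha h2 h1
  have h4 := modQ_le_exp_mul h.pos.le ha h1 h2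
  rw [e] at h3
  rw [abs_sub_comm, e] at h4
  constructor
  · rw [Real.exp_neg, ← div_eq_mul_inv, div_le_iff₀ (Real.exp_pos _)]
    refine h4.trans ?_
    have := h.modQ_pos h2
    gcongr
  · refine h3.trans ?_
    have := h.modQ_pos h1
    gcongr

/-- A crude bound: 48a ≤ 1/2, and √(1 + H²) ≤ 1 + H. -/
lemma inv_le_modQ_inv {a H : ℝ} (h : SmallOrder a) (hH : 0 < H) :
    (1 + H)⁻¹ ≤ modQ a (1 / H) := by
  have h1 := rpow_neg_le_modQ h.pos.le (by linarith [h.le]) (show 0 < 1 / H by positivity)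
  refine le_trans ?_ h1
  rw [one_div, inv_pow, inv_inv, Real.rpow_neg (by positivity)]
  apply inv_anti₀ (by positivity)
  have h2 : (1 + H ^ 2) ^ (48 * a) ≤ (1 + H ^ 2) ^ (1 / 2 : ℝ) :=
    Real.rpow_le_rpow_of_exponent_le (by nlinarith) (by linarith [h.le])
  refine h2.trans ?_
  rw [← Real.sqrt_eq_rpow]
  apply Real.sqrt_le_iff.2
  constructor <;> nlinarith

end SmallOrder

/-- Monotone convergence along σ = 1/(n + 1); the limit may be infinite. -/
lemma exists_lintegral_exp_gt {m : Space3 → ℝ} (hm : Measurable m) (hm0 : ∀ k, 0 ≤ m k) {c : ℝ}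
    (h : ENNReal.ofReal c < ∫⁻ k, ENNReal.ofReal (m k)) :
    ∃ σ₀ : ℝ, 0 < σ₀ ∧ ∀ σ, 0 ≤ σ → σ ≤ σ₀ →
      ENNReal.ofReal c ≤ ∫⁻ k : Space3, ENNReal.ofReal (Real.exp (-(σ * |Real.log ‖k‖|)) * m k) := by
  have hmeas : ∀ σ : ℝ, Measurable fun k : Space3 =>
      ENNReal.ofReal (Real.exp (-(σ * |Real.log ‖k‖|)) * m k) := by
    intro σ
    have h1 : Measurable fun k : Space3 => Real.log ‖k‖ := measurable_norm.log
    have h2 : Measurable fun k : Space3 => |Real.log ‖k‖| := continuous_abs.measurable.comp h1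
    exact (((h2.const_mul σ).neg.exp).mul hm).ennreal_ofReal
  have hlim : Tendsto (fun n : ℕ => ∫⁻ k : Space3,
      ENNReal.ofReal (Real.exp (-(1 / ((n : ℝ) + 1) * |Real.log ‖k‖|)) * m k)) atTop
      (𝓝 (∫⁻ k, ENNReal.ofReal (m k))) := by
    refine lintegral_tendsto_of_tendsto_of_monotone (fun n => (hmeas _).aemeasurable) ?_ ?_
    · refine Eventually.of_forall fun k n n' hn => ?_
      have := hm0 k
      apply ENNReal.ofReal_le_ofReal
      gcongr
    · refine Eventually.of_forall fun k => ENNReal.tendsto_ofReal ?_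
      have h1 : Tendsto (fun n : ℕ => Real.exp (-(1 / ((n : ℝ) + 1) * |Real.log ‖k‖|))) atTop
          (𝓝 (Real.exp (-(0 * |Real.log ‖k‖|)))) :=
        (Real.continuous_exp.tendsto _).comp
          ((tendsto_one_div_add_atTop_nhds_zero_nat.mul_const _).neg)
      simpa using h1.mul_const (m k)
  obtain ⟨n, hn⟩ := (hlim.eventually (lt_mem_nhds h)).exists
  refine ⟨1 / ((n : ℝ) + 1), by positivity, fun σ hσ hσ' => hn.le.trans ?_⟩
  refine lintegral_mono fun k => ENNReal.ofReal_le_ofReal ?_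
  have := hm0 k
  gcongr

/-- Since exp|log k| ≤ k + 1/k, the weight is dominated by those of degrees 0 and -2, and degree -2
is the case s = 1 of mildness. -/
lemma integrable_exp_log {f g : Space3 → ℝ} (hfg : FinitePair f g) :
    Integrable fun k : Space3 => Real.exp |Real.log ‖k‖| * absWeight (-1) f g k := by
  have h1 := (infraredMild_fg hfg (n := 0) (by norm_num) le_rfl).integrable
  have h2 := infraredMild_fg hfg (n := -1) (by norm_num) (by norm_num) 1 zero_le_one one_lt_two
  refine (h1.add h2).mono' ?_ ?_
  · have h3 : Measurable fun k : Space3 => Real.exp |Real.log ‖k‖| :=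
      (continuous_abs.measurable.comp measurable_norm.log).exp
    exact (h3.mul (measurable_absWeight hfg.left hfg.right _)).aestronglyMeasurable
  · filter_upwards [ae_ne_zero_space3] with k hk
    have hk' := norm_pos_iff.2 hk
    have hw := absWeight_nonneg (-1) f g k
    rw [Real.norm_of_nonneg (by positivity), Pi.add_apply]
    have e : absWeight 0 f g k = ‖k‖ * absWeight (-1) f g k := by
      have := norm_rpow_mul_absWeight hk 1 (-1) f g
      rw [Real.rpow_one] at this
      rw [this]; norm_num
    rw [e, ← add_mul, Real.rpow_neg_one]
    gcongr
    rcases le_total 0 (Real.log ‖k‖) with h | h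
    · rw [abs_of_nonneg h, Real.exp_log hk']
      linarith [inv_pos.2 hk']
    · rw [abs_of_nonpos h, Real.exp_neg, Real.exp_log hk']
      linarith

/-- Dominated convergence as σ → 0. It controls the error made in replacing Q(k/H) by Q(1/H) in the
mixed integral. -/
lemma exists_integral_exp_sub_one_lt {f g : Space3 → ℝ} (hfg : FinitePair f g) {η : ℝ}
    (hη : 0 < η) : ∃ σ₀ : ℝ, 0 < σ₀ ∧ ∀ σ, 0 ≤ σ → σ ≤ σ₀ →
      Integrable (fun k : Space3 => (Real.exp (σ * |Real.log ‖k‖|) - 1) * absWeight (-1) f g k) ∧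
      ∫ k : Space3, (Real.exp (σ * |Real.log ‖k‖|) - 1) * absWeight (-1) f g k < η := by
  have hmeas : ∀ σ : ℝ, AEStronglyMeasurable (fun k : Space3 =>
      (Real.exp (σ * |Real.log ‖k‖|) - 1) * absWeight (-1) f g k) volume := by
    intro σ
    have h2 : Measurable fun k : Space3 => |Real.log ‖k‖| :=
      continuous_abs.measurable.comp measurable_norm.log
    exact (((h2.const_mul σ).exp.sub_const 1).mul
      (measurable_absWeight hfg.left hfg.right _)).aestronglyMeasurable
  have hbound : ∀ σ : ℝ, 0 ≤ σ → σ ≤ 1 → ∀ k : Space3,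
      ‖(Real.exp (σ * |Real.log ‖k‖|) - 1) * absWeight (-1) f g k‖ ≤
        Real.exp |Real.log ‖k‖| * absWeight (-1) f g k := by
    intro σ hσ hσ' k
    have hw := absWeight_nonneg (-1) f g k
    have h1 : 1 ≤ Real.exp (σ * |Real.log ‖k‖|) := Real.one_le_exp (by positivity)
    have h2 : Real.exp (σ * |Real.log ‖k‖|) ≤ Real.exp |Real.log ‖k‖| :=
      Real.exp_le_exp.2 (mul_le_of_le_one_left (abs_nonneg _) hσ')
    rw [Real.norm_of_nonneg (mul_nonneg (by linarith) hw)]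
    gcongr
    linarith
  have hint : ∀ σ : ℝ, 0 ≤ σ → σ ≤ 1 → Integrable (fun k : Space3 =>
      (Real.exp (σ * |Real.log ‖k‖|) - 1) * absWeight (-1) f g k) := fun σ hσ hσ' =>
    (integrable_exp_log hfg).mono' (hmeas σ) (Eventually.of_forall (hbound σ hσ hσ'))
  have hlim : Tendsto (fun n : ℕ => ∫ k : Space3,
      (Real.exp (1 / ((n : ℝ) + 1) * |Real.log ‖k‖|) - 1) * absWeight (-1) f g k) atTop
      (𝓝 (∫ _ : Space3, (0 : ℝ))) := by
    refine tendsto_integral_of_dominated_convergence _ (fun n => hmeas _)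
      (integrable_exp_log hfg) (fun n => Eventually.of_forall (hbound _ (by positivity) ?_))
      (Eventually.of_forall fun k => ?_)
    · rw [div_le_one (by positivity)]; linarith [n.cast_nonneg (α := ℝ)]
    · have h1 : Tendsto (fun n : ℕ => Real.exp (1 / ((n : ℝ) + 1) * |Real.log ‖k‖|)) atTop
          (𝓝 (Real.exp (0 * |Real.log ‖k‖|))) :=
        (Real.continuous_exp.tendsto _).comp
          (tendsto_one_div_add_atTop_nhds_zero_nat.mul_const _)
      have h2 := (h1.sub_const 1).mul_const (absWeight (-1) f g k)
      simpa using h2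
  rw [integral_zero] at hlim
  obtain ⟨n, hn⟩ := (hlim.eventually (gt_mem_nhds hη)).exists
  have hn1 : 1 / ((n : ℝ) + 1) ≤ 1 := by
    rw [div_le_one (by positivity)]; linarith [n.cast_nonneg (α := ℝ)]
  refine ⟨1 / ((n : ℝ) + 1), by positivity, fun σ hσ hσ' => ⟨hint σ hσ (hσ'.trans hn1), ?_⟩⟩
  refine lt_of_le_of_lt (integral_mono (hint σ hσ (hσ'.trans hn1))
    (hint _ (by positivity) hn1) fun k => ?_) hn
  have hw := absWeight_nonneg (-1) f g k
  simp only
  gcongr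

/-- The comparison passes through `lintegral` because the lower weight m' need not be integrable. -/
lemma le_modeInt_of_lintegral {φ : ℝ → ℝ} {m m' : Space3 → ℝ} {H c C : ℝ} (hc : 0 ≤ c)
    (hint : Integrable fun k : Space3 => φ (‖k‖ / H) * m k)
    (hle : ∀ k : Space3, k ≠ 0 → 0 ≤ m' k ∧ c * m' k ≤ φ (‖k‖ / H) * m k)
    (hC : ENNReal.ofReal C ≤ ∫⁻ k, ENNReal.ofReal (m' k)) : c * C ≤ modeInt φ m H := by
  have h0 : ∀ᵐ k : Space3, 0 ≤ φ (‖k‖ / H) * m k := by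
    filter_upwards [ae_ne_zero_space3] with k hk
    exact (mul_nonneg hc (hle k hk).1).trans (hle k hk).2
  rw [modeInt, ← ENNReal.ofReal_le_ofReal_iff (integral_nonneg_of_ae h0),
    ofReal_integral_eq_lintegral_ofReal hint h0, ENNReal.ofReal_mul hc]
  calc ENNReal.ofReal c * ENNReal.ofReal C
      ≤ ENNReal.ofReal c * ∫⁻ k, ENNReal.ofReal (m' k) := by gcongr
    _ ≤ ∫⁻ k, ENNReal.ofReal c * ENNReal.ofReal (m' k) := lintegral_const_mul_le _ _
    _ ≤ _ := by
      refine lintegral_mono_ae ?_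
      filter_upwards [ae_ne_zero_space3] with k hk
      rw [← ENNReal.ofReal_mul hc]
      exact ENNReal.ofReal_le_ofReal (hle k hk).2

/-- The gap in Hölder's inequality is uniform in the Hubble rate for small orders. -/
lemma exists_uniform_gap {f g : Space3 → ℝ} (hfg : FinitePair f g)
    (hns : ¬ SaturatesHolder 0 f g) :
    ∃ δ n b ε : ℝ, 0 < δ ∧ 0 < n ∧ 0 < b ∧ 0 < ε ∧ ∀ a, SmallOrder a → a < ε → ∀ H, 0 < H →
      modeInt (fun x => modQ a x / x) (smearWeight 0 f g) H ^ 2 ≤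
        (1 - δ) * (modeInt (fun x => modQ a x / x ^ 2) (absWeight (-1) f f) H *
          modeInt (modQ a) (absWeight 1 g g) H) ∧
      H ^ 2 * modQ a (1 / H) * n ≤ modeInt (fun x => modQ a x / x ^ 2) (absWeight (-1) f f) H ∧
      modQ a (1 / H) * b ≤ modeInt (modQ a) (absWeight 1 g g) H := by
  obtain ⟨n, b, hn, hb, hnN, hbB, hX⟩ := exists_norm_lower_bounds hfg hns
  obtain ⟨σ₁, hσ₁, h1⟩ := exists_lintegral_exp_gt (measurable_absWeight hfg.left hfg.left (-3))
    (absWeight_nonneg _ _ _) hnN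
  obtain ⟨σ₂, hσ₂, h2⟩ := exists_lintegral_exp_gt (measurable_absWeight hfg.right hfg.right 1)
    (absWeight_nonneg _ _ _) hbB
  -- The room between X₁² and nb is shared: X₁² < y absorbs the variation of Q in the mixed
  -- integral, and y < nb leaves the gap δ = 1 - y/(nb).
  obtain ⟨y, hy1, hy2⟩ := exists_between hX
  have hy0 : 0 < y := lt_of_le_of_lt (sq_nonneg _) hy1
  set X₁ := ∫ k, smearWeight (-1) f g k with hX₁
  have hη : 0 < Real.sqrt y - |X₁| := by
    rw [sub_pos]
    apply Real.lt_sqrt_of_sq_lt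
    rwa [sq_abs]
  obtain ⟨σ₃, hσ₃, h3⟩ := exists_integral_exp_sub_one_lt hfg hη
  set σ := min (min σ₁ σ₂) σ₃ with hσ
  have hσ0 : 0 < σ := by positivity
  obtain ⟨hint3, hlt3⟩ := h3 σ hσ0.le (min_le_right _ _)
  have hσ1 : σ ≤ σ₁ := (min_le_left _ _).trans (min_le_left _ _)
  have hσ2 : σ ≤ σ₂ := (min_le_left _ _).trans (min_le_right _ _)
  refine ⟨1 - y / (n * b), n, b, σ / 96, ?_, hn, hb, by positivity, fun a ha haε H hH => ?_⟩
  · rw [sub_pos, div_lt_one (by positivity)]; exact hy2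
  have haσ : 96 * a ≤ σ := by linarith
  have hw := ha.modQ_pos (show 0 < 1 / H by positivity)
  have hN : H ^ 2 * modQ a (1 / H) * n ≤
      modeInt (fun x => modQ a x / x ^ 2) (absWeight (-1) f f) H := by
    refine le_modeInt_of_lintegral (by positivity)
      (ha.integrable_modQ_div_sq (infraredMild_ff hfg) hH) (fun k hk => ?_) (h1 σ hσ0.le hσ1)
    have hk' := norm_pos_iff.2 hk
    have hm := absWeight_nonneg (-1) f f k
    have hm3 := absWeight_nonneg (-3) f f k
    have h4 := (ha.modQ_div_bounds haσ hk' hH).1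
    refine ⟨by positivity, ?_⟩
    have e : absWeight (-1) f f k = ‖k‖ ^ 2 * absWeight (-3) f f k := by
      have := norm_rpow_mul_absWeight hk 2 (-3) f f
      rw [Real.rpow_two] at this
      rw [this]; norm_num
    rw [e]
    have e2 : modQ a (‖k‖ / H) / (‖k‖ / H) ^ 2 * (‖k‖ ^ 2 * absWeight (-3) f f k) =
        modQ a (‖k‖ / H) * (H ^ 2 * absWeight (-3) f f k) := by field_simp
    rw [e2]
    calc _ = modQ a (1 / H) * Real.exp (-(σ * |Real.log ‖k‖|)) *
          (H ^ 2 * absWeight (-3) f f k) := by ring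
      _ ≤ _ := by gcongr
  have hB : modQ a (1 / H) * b ≤ modeInt (modQ a) (absWeight 1 g g) H := by
    refine le_modeInt_of_lintegral hw.le
      (ha.integrable_modQ (infraredMild_gg hfg (by norm_num) le_rfl) hH) (fun k hk => ?_)
      (h2 σ hσ0.le hσ2)
    have hm := absWeight_nonneg 1 g g k
    refine ⟨by positivity, ?_⟩
    have h4 := (ha.modQ_div_bounds haσ (norm_pos_iff.2 hk) hH).1
    rw [← mul_assoc]
    gcongr
  refine ⟨?_, hN, hB⟩
  -- To leading order N, X and B scale as H²Q(1/H), H Q(1/H) and Q(1/H). These factors cancel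
  -- between X² and NB, which makes the gap independent of H.
  have hXd : |modeInt (fun x => modQ a x / x) (smearWeight 0 f g) H -
      H * modQ a (1 / H) * X₁| ≤ H * modQ a (1 / H) * (Real.sqrt y - |X₁|) := by
    rw [modeInt, hX₁, ← integral_const_mul, ← integral_sub
      (ha.integrable_modQ_div (infraredMild_smear_fg hfg (by norm_num) le_rfl) hH)
      ((infraredMild_smear_fg hfg le_rfl (by norm_num)).integrable.const_mul _)]
    have hle : ‖∫ k : Space3, (modQ a (‖k‖ / H) / (‖k‖ / H) * smearWeight 0 f g k -
        H * modQ a (1 / H) * smearWeight (-1) f g k)‖ ≤ ∫ k : Space3, H * modQ a (1 / H) *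
          ((Real.exp (σ * |Real.log ‖k‖|) - 1) * absWeight (-1) f g k) := by
      refine norm_integral_le_of_norm_le (hint3.const_mul _) ?_
      filter_upwards [ae_ne_zero_space3] with k hk
      have hk' := norm_pos_iff.2 hk
      have e : smearWeight 0 f g k = ‖k‖ * smearWeight (-1) f g k := by
        have := norm_rpow_mul_smearWeight hk 1 (-1) f g
        rw [Real.rpow_one] at this
        rw [this]; norm_num
      have e2 : modQ a (‖k‖ / H) / (‖k‖ / H) * smearWeight 0 f g k -
          H * modQ a (1 / H) * smearWeight (-1) f g k =
          H * (modQ a (‖k‖ / H) - modQ a (1 / H)) * smearWeight (-1) f g k := by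
        rw [e]; field_simp
      obtain ⟨h4, h5⟩ := ha.modQ_div_bounds haσ hk' hH
      have h6 : |modQ a (‖k‖ / H) - modQ a (1 / H)| ≤
          modQ a (1 / H) * (Real.exp (σ * |Real.log ‖k‖|) - 1) := by
        -- This gives 1 - e^{-t} ≤ e^t - 1, so the lower bound on Q(k/H) has the same error as the
        -- upper one.
        have h7 : 2 ≤ Real.exp (σ * |Real.log ‖k‖|) + Real.exp (-(σ * |Real.log ‖k‖|)) := by
          have := Real.add_one_le_exp (σ * |Real.log ‖k‖|)
          have := Real.add_one_le_exp (-(σ * |Real.log ‖k‖|))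
          linarith
        rw [abs_le]
        constructor <;> nlinarith
      rw [e2, norm_mul, norm_mul, Real.norm_of_nonneg hH.le]
      calc _ ≤ H * (modQ a (1 / H) * (Real.exp (σ * |Real.log ‖k‖|) - 1)) *
            absWeight (-1) f g k := by
            gcongr
            · exact mul_nonneg hH.le ((abs_nonneg _).trans h6)
            · exact h6
            · exact abs_smearWeight_le _ _ _ _
        _ = _ := by ring
    rw [integral_const_mul] at hle
    exact hle.trans (mul_le_mul_of_nonneg_left hlt3.le (by positivity))
  have hXb : |modeInt (fun x => modQ a x / x) (smearWeight 0 f g) H| ≤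
      H * modQ a (1 / H) * Real.sqrt y := by
    have h4 := abs_sub_abs_le_abs_sub (modeInt (fun x => modQ a x / x) (smearWeight 0 f g) H)
      (H * modQ a (1 / H) * X₁)
    rw [abs_mul (H * modQ a (1 / H)), abs_of_pos (mul_pos hH hw)] at h4
    linarith
  rw [← sq_abs]
  calc |modeInt (fun x => modQ a x / x) (smearWeight 0 f g) H| ^ 2
      ≤ (H * modQ a (1 / H) * Real.sqrt y) ^ 2 := by gcongr
    _ = (y / (n * b)) * ((H ^ 2 * modQ a (1 / H) * n) * (modQ a (1 / H) * b)) := by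
      rw [mul_pow, Real.sq_sqrt hy0.le]; field_simp
    _ ≤ (1 - (1 - y / (n * b))) * _ := by
      have h0 := le_trans (by positivity) hN
      rw [sub_sub_cancel]
      gcongr

end

noncomputable section
open MeasureTheory Filter Topology Set

/-! ### Euler derivatives of the smeared correlators -/

/-- `-x ∂ₓ modP`. -/
def eulerP (a x : ℝ) : ℝ := 2 * ((1 - a) * modP a x - x * modC a x)

/-- `-x ∂ₓ modC`. -/
def eulerC (a x : ℝ) : ℝ := x * (modP a x - modQ a x)

/-- `-x ∂ₓ modQ`. -/
def eulerQ (a x : ℝ) : ℝ := -(2 * ((1 - a) * modQ a x - x * modC a x))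

lemma modeInt_congr {φ ψ : ℝ → ℝ} (m : Space3 → ℝ) {H : ℝ} (hH : 0 < H)
    (h : ∀ x, 0 < x → φ x = ψ x) : modeInt φ m H = modeInt ψ m H := by
  refine integral_congr_ae ?_
  filter_upwards [ae_ne_zero_space3] with k hk
  rw [h _ (div_pos (norm_pos_iff.2 hk) hH)]

lemma abs_modeInt_le {φ χ : ℝ → ℝ} {m m' : Space3 → ℝ} {H : ℝ} (hH : 0 < H)
    (h : ∀ x, 0 < x → |φ x| ≤ χ x) (hm : ∀ k, |m k| ≤ m' k)
    (hi : Integrable fun k : Space3 => χ (‖k‖ / H) * m' k) :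
    |modeInt φ m H| ≤ modeInt χ m' H := by
  rw [← Real.norm_eq_abs]
  refine norm_integral_le_of_norm_le hi ?_
  filter_upwards [ae_ne_zero_space3] with k hk
  rw [norm_mul]
  have h1 := h _ (div_pos (norm_pos_iff.2 hk) hH)
  exact mul_le_mul h1 (hm k) (norm_nonneg _) ((abs_nonneg _).trans h1)

lemma modeInt_nonneg {φ : ℝ → ℝ} {m : Space3 → ℝ} {H : ℝ} (hH : 0 < H)
    (h : ∀ x, 0 < x → 0 ≤ φ x) (hm : ∀ k, 0 ≤ m k) : 0 ≤ modeInt φ m H := by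
  refine integral_nonneg_of_ae ?_
  filter_upwards [ae_ne_zero_space3] with k hk
  exact mul_nonneg (h _ (div_pos (norm_pos_iff.2 hk) hH)) (hm k)

lemma modeInt_mono {φ χ : ℝ → ℝ} {m : Space3 → ℝ} {H : ℝ} (hH : 0 < H)
    (h : ∀ x, 0 < x → φ x ≤ χ x) (hm : ∀ k, 0 ≤ m k)
    (hi : Integrable fun k : Space3 => φ (‖k‖ / H) * m k)
    (hi' : Integrable fun k : Space3 => χ (‖k‖ / H) * m k) :
    modeInt φ m H ≤ modeInt χ m H := by
  refine integral_mono_ae hi hi' ?_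
  filter_upwards [ae_ne_zero_space3] with k hk
  exact mul_le_mul_of_nonneg_right (h _ (div_pos (norm_pos_iff.2 hk) hH)) (hm k)

lemma modeInt_sub_const_mul {φ χ : ℝ → ℝ} {m : Space3 → ℝ} {H : ℝ} (c : ℝ)
    (hi : Integrable fun k : Space3 => φ (‖k‖ / H) * m k)
    (hi' : Integrable fun k : Space3 => χ (‖k‖ / H) * m k) :
    modeInt (fun x => φ x - c * χ x) m H = modeInt φ m H - c * modeInt χ m H := by
  unfold modeInt
  rw [← integral_const_mul, ← integral_sub hi (hi'.const_mul c)]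
  congr 1; funext k; ring

lemma modeInt_const_mul (φ : ℝ → ℝ) (m : Space3 → ℝ) (H c : ℝ) :
    modeInt (fun x => c * φ x) m H = c * modeInt φ m H := by
  unfold modeInt
  rw [← integral_const_mul]
  congr 1; funext k; ring

namespace SmallOrder
variable {a H : ℝ} {m : Space3 → ℝ}

lemma abs_eulerP_le (h : SmallOrder a) {x : ℝ} (hx : 0 < x) :
    |eulerP a x| ≤ 3 * (modQ a x + modQ a x / x ^ 2) := by
  obtain ⟨h1, h2⟩ := h.euler_modP_bounds hx
  have h3 := h.modQ_pos hx
  rw [eulerP, abs_of_nonneg h1]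
  linarith

lemma abs_modC_le (h : SmallOrder a) {x : ℝ} (hx : 0 < x) :
    |modC a x| ≤ 3 * (modQ a x + modQ a x / x ^ 2) :=
  h.abs_le_of_le_div hx (h.modC_bounds hx).1 (h.modC_bounds hx).2

lemma abs_eulerC_le (h : SmallOrder a) {x : ℝ} (hx : 0 < x) :
    |eulerC a x| ≤ 3 * (modQ a x + modQ a x / x ^ 2) :=
  h.abs_le_of_le_div hx (h.euler_modC_bounds hx).1 (h.euler_modC_bounds hx).2

lemma abs_eulerQ_le (h : SmallOrder a) {x : ℝ} (hx : 0 < x) :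
    |eulerQ a x| ≤ 500 * a * (modQ a x / (1 + x ^ 2)) := by
  have h3 := h.modQ_pos hx
  rw [eulerQ, abs_neg]
  refine (abs_euler_modQ_le h.pos.le (by linarith [h.le]) hx).trans ?_
  rw [mul_div_assoc]
  have := h.pos
  gcongr
  norm_num

lemma modQ_div_one_add_le (h : SmallOrder a) {x : ℝ} (hx : 0 < x) :
    0 ≤ modQ a x / (1 + x ^ 2) ∧ modQ a x / (1 + x ^ 2) ≤ modQ a x := by
  have h3 := h.modQ_pos hx
  exact ⟨by positivity, div_le_self h3.le (by nlinarith)⟩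

lemma abs_eulerQ_le' (h : SmallOrder a) {x : ℝ} (hx : 0 < x) :
    |eulerQ a x| ≤ 3 * (modQ a x + modQ a x / x ^ 2) := by
  have h3 := h.modQ_pos hx
  have h4 : 0 < modQ a x / x ^ 2 := by positivity
  obtain ⟨h5, h6⟩ := h.modQ_div_one_add_le hx
  have := mul_le_mul h.small h6 h5 (by norm_num)
  linarith [h.abs_eulerQ_le hx]

lemma abs_modQ_le (h : SmallOrder a) {x : ℝ} (hx : 0 < x) :
    |modQ a x| ≤ 3 * (modQ a x + modQ a x / x ^ 2) := by
  have h3 := h.modQ_pos hx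
  have h4 : 0 < modQ a x / x ^ 2 := by positivity
  rw [abs_of_pos h3]; linarith

lemma continuousOn_eulerP (h : SmallOrder a) : ContinuousOn (eulerP a) (Ioi 0) :=
  ((h.continuousOn_modP.const_mul _).sub (continuousOn_id.mul h.continuousOn_modC)).const_mul 2

lemma continuousOn_eulerC (h : SmallOrder a) : ContinuousOn (eulerC a) (Ioi 0) :=
  continuousOn_id.mul (h.continuousOn_modP.sub h.continuousOn_modQ)

lemma continuousOn_eulerQ (h : SmallOrder a) : ContinuousOn (eulerQ a) (Ioi 0) :=
  (((h.continuousOn_modQ.const_mul _).sub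
    (continuousOn_id.mul h.continuousOn_modC)).const_mul 2).neg

lemma integrable_modP (h : SmallOrder a) (hm : InfraredMild m) (hH : 0 < H) :
    Integrable fun k : Space3 => modP a (‖k‖ / H) * m k :=
  h.integrable h.continuousOn_modP hm hH fun _ hx => h.abs_modP_le hx

lemma integrable_modC (h : SmallOrder a) (hm : InfraredMild m) (hH : 0 < H) :
    Integrable fun k : Space3 => modC a (‖k‖ / H) * m k :=
  h.integrable h.continuousOn_modC hm hH fun _ hx => h.abs_modC_le hx

lemma integrable_eulerP (h : SmallOrder a) (hm : InfraredMild m) (hH : 0 < H) :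
    Integrable fun k : Space3 => eulerP a (‖k‖ / H) * m k :=
  h.integrable h.continuousOn_eulerP hm hH fun _ hx => h.abs_eulerP_le hx

lemma integrable_eulerC (h : SmallOrder a) (hm : InfraredMild m) (hH : 0 < H) :
    Integrable fun k : Space3 => eulerC a (‖k‖ / H) * m k :=
  h.integrable h.continuousOn_eulerC hm hH fun _ hx => h.abs_eulerC_le hx

lemma integrable_modQ_div_one_add (h : SmallOrder a) (hm : InfraredMild m) (hH : 0 < H) :
    Integrable fun k : Space3 => modQ a (‖k‖ / H) / (1 + (‖k‖ / H) ^ 2) * m k :=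
  h.integrable (φ := fun x => modQ a x / (1 + x ^ 2))
    (h.continuousOn_modQ.div (by fun_prop) fun x _ => by positivity) hm hH fun x hx => by
    obtain ⟨h5, h6⟩ := h.modQ_div_one_add_le hx
    rw [abs_of_nonneg h5]
    exact h6.trans ((le_abs_self _).trans (h.abs_modQ_le hx))

lemma hasDerivAt_modeInt (h : SmallOrder a) {φ φ' e : ℝ → ℝ} (hm : InfraredMild m) (hH : 0 < H)
    (hφ : ∀ x, 0 < x → HasDerivAt φ (φ' x) x) (he : ∀ x, 0 < x → e x = -(x * φ' x))
    (hec : ContinuousOn e (Ioi 0))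
    (hb : ∀ x, 0 < x → |φ x| ≤ 3 * (modQ a x + modQ a x / x ^ 2))
    (hb' : ∀ x, 0 < x → |e x| ≤ 3 * (modQ a x + modQ a x / x ^ 2)) :
    HasDerivAt (modeInt φ m) (H⁻¹ * modeInt e m H) H := by
  have h1 : ∀ x, 0 < x → φ' x = -(e x / x) := by
    intro x hx; rw [he x hx]; field_simp
  rw [modeInt_congr m hH he]
  refine _root_.hasDerivAt_modeInt (s := 2 - 2 * a) hφ ?_ hm hH (by linarith [h.le])
    (by linarith [h.pos]) (fun x hx => h.bound_of_le hx (hb x hx)) (fun x hx => ?_)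
  · exact ((hec.div continuousOn_id fun x hx => ne_of_gt hx).neg).congr fun x hx => h1 x hx
  · have := h.bound_of_le hx (hb' x hx)
    rwa [he x hx, abs_neg] at this

lemma hasDerivAt_modeInt_modP (h : SmallOrder a) (hm : InfraredMild m) (hH : 0 < H) :
    HasDerivAt (modeInt (modP a) m) (H⁻¹ * modeInt (eulerP a) m H) H :=
  h.hasDerivAt_modeInt hm hH (fun _ hx => hasDerivAt_modP h.pos.le h.lt_one hx)
    (fun x hx => by rw [eulerP]; field_simp; ring) h.continuousOn_eulerP
    (fun _ hx => h.abs_modP_le hx) (fun _ hx => h.abs_eulerP_le hx)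

lemma hasDerivAt_modeInt_modC (h : SmallOrder a) (hm : InfraredMild m) (hH : 0 < H) :
    HasDerivAt (modeInt (modC a) m) (H⁻¹ * modeInt (eulerC a) m H) H :=
  h.hasDerivAt_modeInt hm hH (fun _ hx => hasDerivAt_modC h.pos.le h.lt_one hx)
    (fun x hx => by rw [eulerC]; ring) h.continuousOn_eulerC
    (fun _ hx => h.abs_modC_le hx) (fun _ hx => h.abs_eulerC_le hx)

lemma hasDerivAt_modeInt_modQ (h : SmallOrder a) (hm : InfraredMild m) (hH : 0 < H) :
    HasDerivAt (modeInt (modQ a) m) (H⁻¹ * modeInt (eulerQ a) m H) H :=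
  h.hasDerivAt_modeInt hm hH (fun _ hx => hasDerivAt_modQ h.pos.le h.lt_one hx)
    (fun x hx => by rw [eulerQ]; field_simp) h.continuousOn_eulerQ
    (fun _ hx => h.abs_modQ_le hx) (fun _ hx => h.abs_eulerQ_le' hx)

end SmallOrder

/-! ### Growth of the determinant with the truncated momentum -/

lemma abs_absWeight_le (n : ℝ) (f g : Space3 → ℝ) (k : Space3) :
    |absWeight n f g k| ≤ absWeight n f g k := (abs_of_nonneg (absWeight_nonneg n f g k)).le

section
variable {a H : ℝ} {f g : Space3 → ℝ}

lemma abs_eulerP_sub_le (h : SmallOrder a) (hfg : FinitePair f g) (hH : 0 < H) :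
    |modeInt (eulerP a) (absWeight (-1) f f) H -
      2 * modeInt (fun x => modQ a x / x ^ 2) (absWeight (-1) f f) H| ≤
      500 * a * modeInt (fun x => modQ a x / x ^ 2) (absWeight (-1) f f) H := by
  have hm := infraredMild_ff hfg
  rw [← modeInt_sub_const_mul 2 (h.integrable_eulerP hm hH) (h.integrable_modQ_div_sq hm hH),
    ← modeInt_const_mul]
  refine abs_modeInt_le hH (fun x hx => abs_euler_modP_sub_le h.pos.le h.le hx)
    (abs_absWeight_le _ _ _) ?_
  simp only [mul_assoc]
  exact ((h.integrable_modQ_div_sq hm hH).const_mul a).const_mul 500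

lemma abs_modC_modeInt_sub_le (h : SmallOrder a) (hfg : FinitePair f g) (hH : 0 < H) :
    |modeInt (modC a) (smearWeight 0 f g) H -
      modeInt (fun x => modQ a x / x) (smearWeight 0 f g) H| ≤
      500 * a * modeInt (fun x => modQ a x / x) (absWeight 0 f g) H := by
  have hm := infraredMild_smear_fg hfg (n := 0) (by norm_num) le_rfl
  have hm' := infraredMild_fg hfg (n := 0) (by norm_num) le_rfl
  have e := modeInt_sub_const_mul 1 (h.integrable_modC hm hH) (h.integrable_modQ_div hm hH)
    (χ := fun x => modQ a x / x)
  rw [one_mul] at e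
  rw [← e, ← modeInt_const_mul]
  refine abs_modeInt_le hH (fun x hx => ?_) (abs_smearWeight_le _ _ _) ?_
  · rw [one_mul]; exact abs_modC_sub_le h.pos.le h.le hx
  · simp only [mul_assoc]
    exact ((h.integrable_modQ_div hm' hH).const_mul a).const_mul 500

lemma abs_eulerC_modeInt_sub_le (h : SmallOrder a) (hfg : FinitePair f g) (hH : 0 < H) :
    |modeInt (eulerC a) (smearWeight 0 f g) H -
      modeInt (fun x => modQ a x / x) (smearWeight 0 f g) H| ≤
      500 * a * modeInt (fun x => modQ a x / x) (absWeight 0 f g) H := by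
  have hm := infraredMild_smear_fg hfg (n := 0) (by norm_num) le_rfl
  have hm' := infraredMild_fg hfg (n := 0) (by norm_num) le_rfl
  have e := modeInt_sub_const_mul 1 (h.integrable_eulerC hm hH) (h.integrable_modQ_div hm hH)
    (χ := fun x => modQ a x / x)
  rw [one_mul] at e
  rw [← e, ← modeInt_const_mul]
  refine abs_modeInt_le hH (fun x hx => ?_) (abs_smearWeight_le _ _ _) ?_
  · rw [one_mul]; exact abs_euler_modC_sub_le h.pos.le h.le hx
  · simp only [mul_assoc]
    exact ((h.integrable_modQ_div hm' hH).const_mul a).const_mul 500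

lemma abs_modeInt_modQ_div_le (h : SmallOrder a) (hfg : FinitePair f g) (hH : 0 < H) :
    |modeInt (fun x => modQ a x / x) (smearWeight 0 f g) H| ≤
      modeInt (fun x => modQ a x / x) (absWeight 0 f g) H :=
  abs_modeInt_le hH (fun x hx => (abs_of_pos (div_pos (h.modQ_pos hx) hx)).le)
    (abs_smearWeight_le _ _ _)
    (h.integrable_modQ_div (infraredMild_fg hfg (n := 0) (by norm_num) le_rfl) hH)

lemma abs_eulerQ_modeInt_le (h : SmallOrder a) (hfg : FinitePair f g) (hH : 0 < H) :
    |modeInt (eulerQ a) (absWeight 1 g g) H| ≤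
      500 * a * modeInt (fun x => modQ a x / (1 + x ^ 2)) (absWeight 1 g g) H := by
  have hm := infraredMild_gg hfg (n := 1) (by norm_num) le_rfl
  rw [← modeInt_const_mul]
  refine abs_modeInt_le hH (fun x hx => h.abs_eulerQ_le hx) (abs_absWeight_le _ _ _) ?_
  simp only [mul_assoc]
  exact ((h.integrable_modQ_div_one_add hm hH).const_mul a).const_mul 500

lemma modeInt_modP_le (h : SmallOrder a) (hfg : FinitePair f g) (hH : 0 < H) :
    modeInt (modP a) (absWeight (-1) f f) H ≤ modeInt (modQ a) (absWeight (-1) f f) H +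
      2 * modeInt (fun x => modQ a x / x ^ 2) (absWeight (-1) f f) H := by
  have hm := infraredMild_ff hfg
  have e := modeInt_sub_const_mul (-2) (h.integrable_modQ hm hH) (h.integrable_modQ_div_sq hm hH)
    (χ := fun x => modQ a x / x ^ 2)
  rw [neg_mul, sub_neg_eq_add] at e
  rw [← e]
  refine modeInt_mono hH (fun x hx => ?_) (absWeight_nonneg _ _ _) (h.integrable_modP hm hH) ?_
  · linarith [modP_le h.pos.le h.le hx]
  · have := (h.integrable_modQ hm hH).add ((h.integrable_modQ_div_sq hm hH).const_mul 2)
    refine this.congr (Eventually.of_forall fun k => ?_)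
    simp only [Pi.add_apply]; ring

lemma modeInt_modQ_le_integral (h : SmallOrder a) {m : Space3 → ℝ} (hm : InfraredMild m)
    (hm0 : ∀ k, 0 ≤ m k) (hH : 0 < H) : modeInt (modQ a) m H ≤ ∫ k, m k := by
  refine integral_mono_ae (h.integrable_modQ hm hH) hm.integrable ?_
  exact Eventually.of_forall fun k => mul_le_of_le_one_left (hm0 k) h.modQ_le_one

/-- Q ≤ 1 and 1/(1 + x²) ≤ H²/k². The derivative of the momentum correlator is thus O(H²) for small
H, like N. -/
lemma modeInt_modQ_div_one_add_le (h : SmallOrder a) (hfg : FinitePair f g) (hH : 0 < H) :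
    modeInt (fun x => modQ a x / (1 + x ^ 2)) (absWeight 1 g g) H ≤
      H ^ 2 * ∫ k, absWeight (-1) g g k := by
  rw [← integral_const_mul]
  refine integral_mono_ae (h.integrable_modQ_div_one_add
    (infraredMild_gg hfg (n := 1) (by norm_num) le_rfl) hH)
    ((infraredMild_gg hfg (n := -1) le_rfl (by norm_num)).integrable.const_mul _) ?_
  filter_upwards [ae_ne_zero_space3] with k hk
  have hk' := norm_pos_iff.2 hk
  have hm := absWeight_nonneg (-1) g g k
  have e : absWeight 1 g g k = ‖k‖ ^ 2 * absWeight (-1) g g k := by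
    have := norm_rpow_mul_absWeight hk 2 (-1) g g
    rw [Real.rpow_two] at this
    rw [this]; norm_num
  have hx : 0 < ‖k‖ / H := by positivity
  have h1 : modQ a (‖k‖ / H) / (1 + (‖k‖ / H) ^ 2) ≤ 1 / (‖k‖ / H) ^ 2 :=
    div_le_div₀ zero_le_one h.modQ_le_one (by positivity) (by linarith)
  rw [e]
  calc _ ≤ 1 / (‖k‖ / H) ^ 2 * (‖k‖ ^ 2 * absWeight (-1) g g k) := by gcongr
    _ = _ := by field_simp

end

/-- A, B, C are the correlators, A', B', S the corresponding Euler derivatives, N and X the leading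
terms, Z the majorant of X. The main part is 2NB - 2X² ≥ 2δNB. The errors are κNB from A'B, (2 +
c)κNB from AB' and 6κNB from 2CS. -/
lemma gram_growth_bound {A A' B B' C S N X Z A0 B1 κ δ c : ℝ} (hκ : 0 ≤ κ) (hκ1 : κ ≤ 1)
    (hN : 0 ≤ N) (hB : 0 ≤ B) (hA : 0 ≤ A) (hA'N : |A' - 2 * N| ≤ κ * N)
    (hCX : |C - X| ≤ κ * Z) (hSX : |S - X| ≤ κ * Z) (hXZ : |X| ≤ Z) (hZ : Z ^ 2 ≤ N * B)
    (hAle : A ≤ A0 + 2 * N) (hB' : |B'| ≤ κ * B1) (hB1B : B1 ≤ B)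
    (hAB : A0 * B1 ≤ c * (N * B)) (hX : X ^ 2 ≤ (1 - δ) * (N * B)) :
    (2 * δ - (9 + c) * κ) * (N * B) ≤ A' * B + A * B' - 2 * (C * S) := by
  have hZ0 : 0 ≤ Z := (abs_nonneg _).trans hXZ
  have h1 : (2 - κ) * N * B ≤ A' * B := by
    have := (abs_le.1 hA'N).1
    gcongr
    linarith
  have h2 : -(κ * (c * (N * B)) + 2 * κ * (N * B)) ≤ A * B' := by
    have h3 : |A * B'| ≤ (A0 + 2 * N) * (κ * B1) := by
      have := hA.trans hAle
      rw [abs_mul, abs_of_nonneg hA]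
      gcongr
    have h4 : N * B1 ≤ N * B := by gcongr
    have := (abs_le.1 h3).1
    nlinarith
  have h5 : C * S ≤ X ^ 2 + 3 * κ * (N * B) := by
    have hC : |C| ≤ |X| + κ * Z := by
      have := abs_sub_abs_le_abs_sub C X
      linarith
    have hS : |S| ≤ |X| + κ * Z := by
      have := abs_sub_abs_le_abs_sub S X
      linarith
    have h6 : C * S ≤ (|X| + κ * Z) * (|X| + κ * Z) := by
      refine (le_abs_self _).trans ?_
      rw [abs_mul]
      exact mul_le_mul hC hS (abs_nonneg _) (by positivity)
    have h7 : (|X| + κ * Z) * (|X| + κ * Z) ≤ X ^ 2 + 3 * κ * Z ^ 2 := by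
      have e : (|X| + κ * Z) * (|X| + κ * Z) = |X| ^ 2 + 2 * κ * (|X| * Z) + κ * κ * Z ^ 2 := by
        ring
      rw [e, sq_abs]
      have h8 : |X| * Z ≤ Z ^ 2 := by nlinarith
      have h9 : κ * κ * Z ^ 2 ≤ κ * Z ^ 2 := by nlinarith [sq_nonneg Z, mul_nonneg hκ (sq_nonneg Z)]
      nlinarith
    have : 3 * κ * Z ^ 2 ≤ 3 * κ * (N * B) := by gcongr
    linarith
  nlinarith

/-- The logarithmic derivative of the determinant of the light correlators is bounded below. -/
lemma exists_light_growth {f g : Space3 → ℝ} (hfg : FinitePair f g)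
    (hns : ¬ SaturatesHolder 0 f g) :
    ∃ δ b n ε : ℝ, 0 < δ ∧ 0 < b ∧ 0 < n ∧ 0 < ε ∧ ∀ a, SmallOrder a → a < ε → ∀ H, 0 < H →
      H ^ 2 * (1 + H)⁻¹ * n ≤ modeInt (fun x => modQ a x / x ^ 2) (absWeight (-1) f f) H ∧
      (1 + H)⁻¹ * b ≤ modeInt (modQ a) (absWeight 1 g g) H ∧
      δ * (modeInt (fun x => modQ a x / x ^ 2) (absWeight (-1) f f) H *
          modeInt (modQ a) (absWeight 1 g g) H) ≤
        modeInt (eulerP a) (absWeight (-1) f f) H * modeInt (modQ a) (absWeight 1 g g) H +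
        modeInt (modP a) (absWeight (-1) f f) H * modeInt (eulerQ a) (absWeight 1 g g) H -
        2 * (modeInt (modC a) (smearWeight 0 f g) H * modeInt (eulerC a) (smearWeight 0 f g) H) := by
  obtain ⟨δ, n, b, ε, hδ, hn, hb, hε, hgap⟩ := exists_uniform_gap hfg hns
  set F := ∫ k, absWeight (-1) f f k with hF
  set G := ∫ k, absWeight (-1) g g k with hG
  have hF0 : 0 ≤ F := integral_nonneg fun k => absWeight_nonneg _ _ _ _
  have hG0 : 0 ≤ G := integral_nonneg fun k => absWeight_nonneg _ _ _ _
  -- The first summand serves H ≤ 1, the second H ≥ 1, in the bound on A₀B₁ below.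
  set c := 4 * F * G / (n * b) + 2 * F / n with hc
  have hc0 : 0 ≤ c := by positivity
  refine ⟨δ, b, n, min ε (δ / (500 * (9 + c))), hδ, hb, hn, by positivity,
    fun a ha haε H hH => ?_⟩
  obtain ⟨hX, hN, hB⟩ := hgap a ha (haε.trans_le (min_le_left _ _)) H hH
  have hκ : (9 + c) * (500 * a) ≤ δ := by
    have := (haε.trans_le (min_le_right _ _)).le
    rw [le_div_iff₀ (by positivity)] at this
    linarith
  have hw := ha.inv_le_modQ_inv hH
  have hN' : H ^ 2 * (1 + H)⁻¹ * n ≤ modeInt (fun x => modQ a x / x ^ 2) (absWeight (-1) f f) H :=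
    le_trans (by gcongr) hN
  have hB' : (1 + H)⁻¹ * b ≤ modeInt (modQ a) (absWeight 1 g g) H :=
    le_trans (by gcongr) hB
  refine ⟨hN', hB', ?_⟩
  have hmg := infraredMild_gg hfg (n := 1) (by norm_num) le_rfl
  have hN0 := (show 0 ≤ H ^ 2 * (1 + H)⁻¹ * n by positivity).trans hN'
  have hB0 := (show 0 ≤ (1 + H)⁻¹ * b by positivity).trans hB'
  have hB1 : 0 ≤ modeInt (fun x => modQ a x / (1 + x ^ 2)) (absWeight 1 g g) H :=
    modeInt_nonneg hH (fun x hx => (ha.modQ_div_one_add_le hx).1) (absWeight_nonneg _ _ _)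
  have hB1B : modeInt (fun x => modQ a x / (1 + x ^ 2)) (absWeight 1 g g) H ≤
      modeInt (modQ a) (absWeight 1 g g) H :=
    modeInt_mono hH (fun x hx => (ha.modQ_div_one_add_le hx).2) (absWeight_nonneg _ _ _)
      (ha.integrable_modQ_div_one_add hmg hH) (ha.integrable_modQ hmg hH)
  have hB1H := modeInt_modQ_div_one_add_le ha hfg hH
  have hA0F : modeInt (modQ a) (absWeight (-1) f f) H ≤ F :=
    modeInt_modQ_le_integral ha (infraredMild_ff hfg) (absWeight_nonneg _ _ _) hH
  have hA00 : 0 ≤ modeInt (modQ a) (absWeight (-1) f f) H :=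
    modeInt_nonneg hH (fun x hx => (ha.modQ_pos hx).le) (absWeight_nonneg _ _ _)
  have hAB : modeInt (modQ a) (absWeight (-1) f f) H *
      modeInt (fun x => modQ a x / (1 + x ^ 2)) (absWeight 1 g g) H ≤
      c * (modeInt (fun x => modQ a x / x ^ 2) (absWeight (-1) f f) H *
        modeInt (modQ a) (absWeight 1 g g) H) := by
    -- For H ≤ 1 both B₁ and the lower bound on N are of order H². For H ≥ 1 the lower bound on N
    -- stays away from zero and B₁ ≤ B suffices.
    rcases le_total H 1 with h1 | h1
    · have h2 : (1 / 2 : ℝ) ≤ (1 + H)⁻¹ := by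
        rw [← one_div]; apply one_div_le_one_div_of_le <;> linarith
      calc _ ≤ F * (H ^ 2 * G) := by gcongr
        _ = 4 * F * G / (n * b) * ((H ^ 2 * (1 / 2) * n) * (1 / 2 * b)) := by field_simp; norm_num
        _ ≤ 4 * F * G / (n * b) * ((H ^ 2 * (1 + H)⁻¹ * n) * ((1 + H)⁻¹ * b)) := by gcongr
        _ ≤ c * _ := by
          gcongr
          rw [hc]; exact le_add_of_nonneg_right (by positivity)
    · have h2 : 1 / 2 ≤ H ^ 2 * (1 + H)⁻¹ := by
        rw [← div_eq_mul_inv, le_div_iff₀ (by positivity)]; nlinarith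
      calc _ ≤ F * modeInt (modQ a) (absWeight 1 g g) H := by gcongr
        _ = 2 * F / n * ((1 / 2 * n) * modeInt (modQ a) (absWeight 1 g g) H) := by field_simp
        _ ≤ 2 * F / n * ((H ^ 2 * (1 + H)⁻¹ * n) * modeInt (modQ a) (absWeight 1 g g) H) := by
          gcongr
        _ ≤ c * _ := by
          gcongr
          rw [hc]; exact le_add_of_nonneg_left (by positivity)
  have key := gram_growth_bound (κ := 500 * a) (by linarith [ha.pos]) (by linarith [ha.small])
    hN0 hB0 (modeInt_nonneg hH (fun x _ => sq_nonneg _) (absWeight_nonneg _ _ _))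
    (abs_eulerP_sub_le ha hfg hH) (abs_modC_modeInt_sub_le ha hfg hH)
    (abs_eulerC_modeInt_sub_le ha hfg hH) (abs_modeInt_modQ_div_le ha hfg hH)
    (sq_modeInt_div_le ha hfg hH) (modeInt_modP_le ha hfg hH) (abs_eulerQ_modeInt_le ha hfg hH)
    hB1B hAB hX
  refine le_trans ?_ key
  gcongr
  linarith

end

noncomputable section
open MeasureTheory Filter Topology Set

/-! ### Determinants of the covariance matrices -/

/-- The determinant of the covariance matrix with the truncated momentum modes. -/
def lightDet (a : ℝ) (f g : Space3 → ℝ) (H : ℝ) : ℝ :=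
  modeInt (modP a) (absWeight (-1) f f) H * modeInt (modQ a) (absWeight 1 g g) H -
    modeInt (modC a) (smearWeight 0 f g) H ^ 2

/-- The determinant of the covariance matrix with the exact momentum modes. -/
def exactDet (a : ℝ) (f g : Space3 → ℝ) (H : ℝ) : ℝ :=
  modeInt (modP a) (absWeight (-1) f f) H *
    (modeInt (modQ a) (absWeight 1 g g) H +
      (2 * (a * H) * modeInt (modC a) (absWeight 0 g g) H +
        (a * H) ^ 2 * modeInt (modP a) (absWeight (-1) g g) H)) -
    (modeInt (modC a) (smearWeight 0 f g) H +
      a * H * modeInt (modP a) (smearWeight (-1) f g) H) ^ 2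

lemma modeCorr_congr {u v : ℝ → ℂ} {f g : Space3 → ℝ} {F : Space3 → ℝ}
    (h : ∀ k : Space3, k ≠ 0 → ((2 * Real.pi) ^ 3)⁻¹ *
      (2 * (u ‖k‖ * (starRingEnd ℂ) (v ‖k‖)).re) *
      (smearFourier f k * (starRingEnd ℂ) (smearFourier g k)).re = F k) :
    modeCorr u v f g = ∫ k, F k := by
  refine integral_congr_ae ?_
  filter_upwards [ae_ne_zero_space3] with k hk
  exact h k hk

section
variable {r H : ℝ} {f g : Space3 → ℝ}

lemma modeCorr_fieldMode_fieldMode (ha : muSq r < 1) (hH : 0 < H) :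
    modeCorr (fieldMode r H) (fieldMode r H) f g =
      modeInt (modP (muSq r)) (smearWeight (-1) f g) H := by
  refine modeCorr_congr fun k hk => ?_
  rw [two_re_fieldMode_fieldMode ha hH (norm_pos_iff.2 hk), smearWeight, Real.rpow_neg_one]
  ring

lemma modeCorr_fieldMode_light (ha : muSq r < 1) (hH : 0 < H) :
    modeCorr (fieldMode r H) (lightMomentumMode r H) f g =
      -modeInt (modC (muSq r)) (smearWeight 0 f g) H := by
  rw [modeInt, ← integral_neg]
  refine modeCorr_congr fun k hk => ?_
  rw [two_re_fieldMode_light ha hH (norm_pos_iff.2 hk), smearWeight, Real.rpow_zero]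
  ring

lemma modeCorr_light_light (ha : muSq r < 1) (hH : 0 < H) :
    modeCorr (lightMomentumMode r H) (lightMomentumMode r H) f g =
      modeInt (modQ (muSq r)) (smearWeight 1 f g) H := by
  refine modeCorr_congr fun k hk => ?_
  rw [two_re_light_light ha hH (norm_pos_iff.2 hk), smearWeight, Real.rpow_one]
  ring

lemma modeCorr_fieldMode_momentumMode (h : SmallOrder (muSq r)) (hfg : FinitePair f g)
    (hH : 0 < H) :
    modeCorr (fieldMode r H) (momentumMode r H) f g =
      -(modeInt (modC (muSq r)) (smearWeight 0 f g) H +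
        muSq r * H * modeInt (modP (muSq r)) (smearWeight (-1) f g) H) := by
  unfold modeInt
  rw [← integral_const_mul, ← integral_add
    (h.integrable_modC (infraredMild_smear_fg hfg (by norm_num) le_rfl) hH)
    ((h.integrable_modP (infraredMild_smear_fg hfg le_rfl (by norm_num)) hH).const_mul _),
    ← integral_neg]
  refine modeCorr_congr fun k hk => ?_
  rw [two_re_fieldMode_momentumMode h.pos.le h.lt_one hH (norm_pos_iff.2 hk), smearWeight,
    smearWeight, Real.rpow_zero, Real.rpow_neg_one]
  ring

lemma modeCorr_momentumMode_momentumMode (h : SmallOrder (muSq r)) (hfg : FinitePair f g)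
    (hH : 0 < H) :
    modeCorr (momentumMode r H) (momentumMode r H) g g =
      modeInt (modQ (muSq r)) (absWeight 1 g g) H +
      (2 * (muSq r * H) * modeInt (modC (muSq r)) (absWeight 0 g g) H +
        (muSq r * H) ^ 2 * modeInt (modP (muSq r)) (absWeight (-1) g g) H) := by
  have i1 := h.integrable_modQ (infraredMild_gg hfg (n := 1) (by norm_num) le_rfl) hH
  have i2 := (h.integrable_modC (infraredMild_gg hfg (n := 0) (by norm_num) (by norm_num)) hH).const_mul
    (2 * (muSq r * H))
  have i3 := (h.integrable_modP (infraredMild_gg hfg (n := -1) le_rfl (by norm_num)) hH).const_mul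
    ((muSq r * H) ^ 2)
  unfold modeInt
  rw [← integral_const_mul, ← integral_const_mul, ← integral_add i2 i3,
    ← integral_add i1 (g := fun k => 2 * (muSq r * H) * (modC (muSq r) (‖k‖ / H) *
      absWeight 0 g g k) + (muSq r * H) ^ 2 * (modP (muSq r) (‖k‖ / H) *
      absWeight (-1) g g k)) (i2.add i3)]
  refine modeCorr_congr fun k hk => ?_
  rw [two_re_momentumMode_momentumMode h.pos.le h.lt_one hH (norm_pos_iff.2 hk),
    ← smearWeight_self, ← smearWeight_self, ← smearWeight_self, smearWeight,
    smearWeight, smearWeight, Real.rpow_zero, Real.rpow_neg_one, Real.rpow_one]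
  ring

lemma det_light (ha : muSq r < 1) (hH : 0 < H) :
    (pairCovariance (fieldMode r H) (lightMomentumMode r H) f g).det =
      lightDet (muSq r) f g H := by
  rw [pairCovariance, Matrix.det_fin_two_of, modeCorr_fieldMode_fieldMode ha hH,
    modeCorr_fieldMode_light ha hH, modeCorr_light_light ha hH, smearWeight_self,
    smearWeight_self, lightDet]
  ring

lemma det_exact (h : SmallOrder (muSq r)) (hfg : FinitePair f g) (hH : 0 < H) :
    (pairCovariance (fieldMode r H) (momentumMode r H) f g).det =
      exactDet (muSq r) f g H := by
  rw [pairCovariance, Matrix.det_fin_two_of, modeCorr_fieldMode_fieldMode h.lt_one hH,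
    modeCorr_fieldMode_momentumMode h hfg hH, modeCorr_momentumMode_momentumMode h hfg hH,
    smearWeight_self, exactDet]
  ring

lemma det_minkowski (hfg : FinitePair f g) :
    (minkowskiCovariance f g).det =
      (∫ k, absWeight (-1) f f k) * ∫ k, absWeight 1 g g k := by
  rw [minkowskiCovariance, Matrix.det_fin_two_of,
    sobolevProd_re hfg.left hfg.left (n := -1) (by norm_num) hfg.sobolev_left,
    sobolevProd_re hfg.right hfg.right (n := 1) (by norm_num) hfg.sobolev_right,
    smearWeight_self, smearWeight_self]
  ring

end

section
variable {a H : ℝ} {f g : Space3 → ℝ}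

lemma hasDerivAt_lightDet (h : SmallOrder a) (hfg : FinitePair f g) (hH : 0 < H) :
    HasDerivAt (lightDet a f g)
      (H⁻¹ * (modeInt (eulerP a) (absWeight (-1) f f) H * modeInt (modQ a) (absWeight 1 g g) H +
        modeInt (modP a) (absWeight (-1) f f) H * modeInt (eulerQ a) (absWeight 1 g g) H -
        2 * (modeInt (modC a) (smearWeight 0 f g) H *
          modeInt (eulerC a) (smearWeight 0 f g) H))) H := by
  have hA := h.hasDerivAt_modeInt_modP (infraredMild_ff hfg) hH
  have hB := h.hasDerivAt_modeInt_modQ (infraredMild_gg hfg (n := 1) (by norm_num) le_rfl) hH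
  have hC := h.hasDerivAt_modeInt_modC
    (infraredMild_smear_fg hfg (n := 0) (by norm_num) le_rfl) hH
  refine ((hA.mul hB).sub (hC.pow 2)).congr_deriv ?_
  simp only [Nat.cast_ofNat]
  ring

lemma hasDerivAt_exactDet (h : SmallOrder a) (hfg : FinitePair f g) (hH : 0 < H) :
    HasDerivAt (exactDet a f g)
      (H⁻¹ * (modeInt (eulerP a) (absWeight (-1) f f) H *
          (modeInt (modQ a) (absWeight 1 g g) H +
            (2 * (a * H) * modeInt (modC a) (absWeight 0 g g) H +
              (a * H) ^ 2 * modeInt (modP a) (absWeight (-1) g g) H)) +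
        modeInt (modP a) (absWeight (-1) f f) H *
          (modeInt (eulerQ a) (absWeight 1 g g) H +
            (2 * (a * H) * (modeInt (modC a) (absWeight 0 g g) H +
                modeInt (eulerC a) (absWeight 0 g g) H) +
              (a * H) ^ 2 * (2 * modeInt (modP a) (absWeight (-1) g g) H +
                modeInt (eulerP a) (absWeight (-1) g g) H))) -
        2 * ((modeInt (modC a) (smearWeight 0 f g) H +
            a * H * modeInt (modP a) (smearWeight (-1) f g) H) *
          (modeInt (eulerC a) (smearWeight 0 f g) H +
            a * H * (modeInt (modP a) (smearWeight (-1) f g) H +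
              modeInt (eulerP a) (smearWeight (-1) f g) H))))) H := by
  have hA := h.hasDerivAt_modeInt_modP (infraredMild_ff hfg) hH
  have hB := h.hasDerivAt_modeInt_modQ (infraredMild_gg hfg (n := 1) (by norm_num) le_rfl) hH
  have hC := h.hasDerivAt_modeInt_modC
    (infraredMild_smear_fg hfg (n := 0) (by norm_num) le_rfl) hH
  have hU := h.hasDerivAt_modeInt_modC
    (infraredMild_gg hfg (n := 0) (by norm_num) (by norm_num)) hH
  have hAg := h.hasDerivAt_modeInt_modP
    (infraredMild_gg hfg (n := -1) le_rfl (by norm_num)) hH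
  have hAfg := h.hasDerivAt_modeInt_modP
    (infraredMild_smear_fg hfg (n := -1) le_rfl (by norm_num)) hH
  have hl : HasDerivAt (fun H : ℝ => a * H) a H := by
    simpa using (hasDerivAt_id H).const_mul a
  refine ((hA.mul (hB.add (((hl.const_mul 2).mul hU).add ((hl.pow 2).mul hAg)))).sub
    ((hC.add (hl.mul hAfg)).pow 2)).congr_deriv ?_
  simp only [Nat.cast_ofNat, Pi.add_apply, Pi.mul_apply, Pi.pow_apply]
  field_simp
  ring

lemma tendsto_modeInt_of_small (h : SmallOrder a) {φ : ℝ → ℝ} {m : Space3 → ℝ} {l : ℝ}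
    (hφ : ContinuousOn φ (Ioi 0)) (hm : InfraredMild m)
    (hb : ∀ x, 0 < x → |φ x| ≤ 3 * (modQ a x + modQ a x / x ^ 2)) (hl : Tendsto φ atTop (𝓝 l)) :
    Tendsto (modeInt φ m) (𝓝[>] 0) (𝓝 (l * ∫ k, m k)) :=
  tendsto_modeInt_zero (s := 2 - 2 * a) hφ hm (by linarith [h.le]) (by linarith [h.pos])
    (fun x hx => h.bound_of_le hx (hb x hx)) hl

lemma tendsto_modeInt_modP (h : SmallOrder a) {m : Space3 → ℝ} (hm : InfraredMild m) :
    Tendsto (modeInt (modP a) m) (𝓝[>] 0) (𝓝 (∫ k, m k)) := by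
  simpa using tendsto_modeInt_of_small h h.continuousOn_modP hm (fun _ hx => h.abs_modP_le hx)
    (tendsto_modP h.pos.le h.lt_one)

lemma tendsto_modeInt_modQ (h : SmallOrder a) {m : Space3 → ℝ} (hm : InfraredMild m) :
    Tendsto (modeInt (modQ a) m) (𝓝[>] 0) (𝓝 (∫ k, m k)) := by
  simpa using tendsto_modeInt_of_small h h.continuousOn_modQ hm (fun _ hx => h.abs_modQ_le hx)
    (tendsto_modQ h.pos.le h.lt_one)

lemma tendsto_modeInt_modC (h : SmallOrder a) {m : Space3 → ℝ} (hm : InfraredMild m) :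
    Tendsto (modeInt (modC a) m) (𝓝[>] 0) (𝓝 0) := by
  simpa using tendsto_modeInt_of_small h h.continuousOn_modC hm (fun _ hx => h.abs_modC_le hx)
    (tendsto_modC h.pos.le h.lt_one)

lemma tendsto_lightDet (h : SmallOrder a) (hfg : FinitePair f g) :
    Tendsto (lightDet a f g) (𝓝[>] 0)
      (𝓝 ((∫ k, absWeight (-1) f f k) * ∫ k, absWeight 1 g g k)) := by
  have hA := tendsto_modeInt_modP h (infraredMild_ff hfg)
  have hB := tendsto_modeInt_modQ h (infraredMild_gg hfg (n := 1) (by norm_num) le_rfl)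
  have hC := tendsto_modeInt_modC h (infraredMild_smear_fg hfg (n := 0) (by norm_num) le_rfl)
  have := (hA.mul hB).sub (hC.pow 2)
  unfold lightDet
  simpa using this

/-- The additional terms carry a factor aH, while their integrals converge as H → 0. -/
lemma tendsto_exactDet (h : SmallOrder a) (hfg : FinitePair f g) :
    Tendsto (exactDet a f g) (𝓝[>] 0)
      (𝓝 ((∫ k, absWeight (-1) f f k) * ∫ k, absWeight 1 g g k)) := by
  have hA := tendsto_modeInt_modP h (infraredMild_ff hfg)
  have hB := tendsto_modeInt_modQ h (infraredMild_gg hfg (n := 1) (by norm_num) le_rfl)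
  have hC := tendsto_modeInt_modC h (infraredMild_smear_fg hfg (n := 0) (by norm_num) le_rfl)
  have hU := tendsto_modeInt_modC h (infraredMild_gg hfg (n := 0) (by norm_num) (by norm_num))
  have hAg := tendsto_modeInt_modP h (infraredMild_gg hfg (n := -1) le_rfl (by norm_num))
  have hAfg := tendsto_modeInt_modP h
    (infraredMild_smear_fg hfg (n := -1) le_rfl (by norm_num))
  have hl : Tendsto (fun H : ℝ => a * H) (𝓝[>] 0) (𝓝 0) := by
    have : Continuous fun H : ℝ => a * H := by fun_prop
    simpa using (this.tendsto 0).mono_left nhdsWithin_le_nhds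
  have := (hA.mul (hB.add (((hl.const_mul 2).mul hU).add ((hl.pow 2).mul hAg)))).sub
    ((hC.add (hl.mul hAfg)).pow 2)
  unfold exactDet
  simpa using this

end

/-! ### Growth of the determinant with the exact momentum -/

/-- The infrared integral of `|g̃|²` diverges at most like `1 / a`. -/
lemma exists_infrared_bound {f g : Space3 → ℝ} (hfg : FinitePair f g) :
    ∃ K : ℝ, 0 ≤ K ∧ ∀ a, SmallOrder a → ∀ H, 0 < H →
      a * modeInt (fun x => modQ a x / x ^ 2) (absWeight (-1) g g) H ≤ K * (1 + H) ^ 2 := by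
  set c := ((2 * Real.pi) ^ 3)⁻¹ * ((∫ x, ‖g x‖) * ∫ x, ‖g x‖) with hc
  have hπ := Real.pi_pos
  have hI : 0 ≤ ∫ x, ‖g x‖ := integral_nonneg fun x => norm_nonneg _
  have hc0 : 0 ≤ c := by positivity
  set V := 3 * (volume : Measure Space3).real (Metric.ball 0 1) with hV
  have hV0 : 0 ≤ V := by positivity
  have hG0 : 0 ≤ ∫ k, absWeight 1 g g k := integral_nonneg fun k => absWeight_nonneg _ _ _ _
  refine ⟨8 * (c * V + ∫ k, absWeight 1 g g k), by positivity, fun a ha H hH => ?_⟩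
  have ha0 := ha.pos
  have hs : (3 - 2 * a) < 3 := by linarith
  have hint := ((integrableOn_ball_rpow hs).const_mul c).add hfg.sobolev_right
  -- Inside the unit ball |g̃| is bounded and the integrand is of order |k|^{-(3 - 2a)}, with
  -- integral proportional to 1/(2a). Outside, the weight of ‖g‖_{1/2} dominates.
  have hle : modeInt (fun x => modQ a x / x ^ 2) (absWeight (-1) g g) H ≤
      ∫ k : Space3, 8 * H ^ (2 - 2 * a) * (c * (Iic (1 : ℝ)).indicator
        (fun y => y ^ (-(3 - 2 * a))) ‖k‖ + absWeight 1 g g k) := by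
    refine integral_mono_ae (ha.integrable_modQ_div_sq
      (infraredMild_gg hfg (n := -1) le_rfl (by norm_num)) hH) (hint.const_mul _) ?_
    filter_upwards [ae_ne_zero_space3] with k hk
    have hk' := norm_pos_iff.2 hk
    have hw := absWeight_nonneg (-1) g g k
    have h1 := ha.modQ_div_sq_le (div_pos hk' hH)
    have e1 : (‖k‖ / H) ^ (-(2 - 2 * a)) = H ^ (2 - 2 * a) * ‖k‖ ^ (-(2 - 2 * a)) := by
      rw [Real.div_rpow hk'.le hH.le, Real.rpow_neg hH.le (2 - 2 * a), div_inv_eq_mul, mul_comm]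
    have e2 : ‖k‖ ^ (-(2 - 2 * a)) * absWeight (-1) g g k =
        absWeight (-(3 - 2 * a)) g g k := by
      rw [norm_rpow_mul_absWeight hk]; congr 1; ring
    have h2 : absWeight (-(3 - 2 * a)) g g k ≤ c * (Iic (1 : ℝ)).indicator
        (fun y => y ^ (-(3 - 2 * a))) ‖k‖ + absWeight 1 g g k := by
      have hw1 := absWeight_nonneg 1 g g k
      by_cases h : ‖k‖ ≤ 1
      · rw [indicator_of_mem (show ‖k‖ ∈ Iic (1 : ℝ) from h)]
        refine le_trans ?_ (le_add_of_nonneg_right hw1)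
        have h3 := norm_smearFourier_le g k
        rw [absWeight, hc, mul_assoc, mul_comm ((∫ x, ‖g x‖) * ∫ x, ‖g x‖)]
        gcongr
      · rw [indicator_of_notMem (show ‖k‖ ∉ Iic (1 : ℝ) from h), mul_zero, zero_add]
        push Not at h
        unfold absWeight
        gcongr
        · exact h.le
        · linarith [ha.le]
    calc _ ≤ 8 * (‖k‖ / H) ^ (-(2 - 2 * a)) * absWeight (-1) g g k := by gcongr
      _ = 8 * H ^ (2 - 2 * a) * absWeight (-(3 - 2 * a)) g g k := by rw [e1, ← e2]; ring
      _ ≤ _ := by gcongr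
  rw [integral_const_mul, integral_add ((integrableOn_ball_rpow hs).const_mul c)
    hfg.sobolev_right, integral_const_mul, integral_ball_rpow_le hs, ← hV] at hle
  have h4 : H ^ (2 - 2 * a) ≤ (1 + H) ^ 2 := by
    calc H ^ (2 - 2 * a) ≤ (1 + H) ^ (2 - 2 * a) :=
          Real.rpow_le_rpow hH.le (by linarith) (by linarith [ha.le])
      _ ≤ (1 + H) ^ (2 : ℝ) := Real.rpow_le_rpow_of_exponent_le (by linarith) (by linarith)
      _ = _ := Real.rpow_two _
  calc a * modeInt (fun x => modQ a x / x ^ 2) (absWeight (-1) g g) H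
      ≤ a * (8 * H ^ (2 - 2 * a) * (c * (V * (3 - (3 - 2 * a))⁻¹) + ∫ k, absWeight 1 g g k)) := by
        gcongr
    _ = 8 * H ^ (2 - 2 * a) * (c * V / 2 + a * ∫ k, absWeight 1 g g k) := by
      have : 3 - (3 - 2 * a) = 2 * a := by ring
      rw [this]; field_simp
    _ ≤ 8 * (1 + H) ^ 2 * (c * V + 1 * ∫ k, absWeight 1 g g k) := by
      have h5 : c * V / 2 ≤ c * V := half_le_self (by positivity)
      have h6 : a ≤ 1 := ha.lt_one.le
      gcongr
    _ = _ := by ring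

section
variable {a H : ℝ} {f g : Space3 → ℝ}

/-- The prefactor H of the extra term is absorbed into Q/x, so the part of P of order Q is
controlled by Z without loss at large H. -/
lemma hubble_mul_modeInt_modQ (f g : Space3 → ℝ) (hH : 0 < H) :
    H * modeInt (modQ a) (absWeight (-1) f g) H =
      modeInt (fun x => modQ a x / x) (absWeight 0 f g) H := by
  rw [modeInt, ← integral_const_mul]
  refine integral_congr_ae ?_
  filter_upwards [ae_ne_zero_space3] with k hk
  have hk' := norm_pos_iff.2 hk
  have e : absWeight 0 f g k = ‖k‖ * absWeight (-1) f g k := by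
    have := norm_rpow_mul_absWeight hk 1 (-1) f g
    rw [Real.rpow_one] at this
    rw [this]; norm_num
  rw [e]
  field_simp

/-- The factor 5 collects P ≤ Q + 2Q/x² and the bound 3Q/x² for the Euler derivative. -/
lemma abs_modeInt_modP_add_eulerP_le (h : SmallOrder a) (hfg : FinitePair f g) (hH : 0 < H) :
    |modeInt (modP a) (smearWeight (-1) f g) H| + |modeInt (eulerP a) (smearWeight (-1) f g) H| ≤
      modeInt (modQ a) (absWeight (-1) f g) H +
        5 * modeInt (fun x => modQ a x / x ^ 2) (absWeight (-1) f g) H := by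
  have hm := infraredMild_fg hfg (n := -1) le_rfl (by norm_num)
  have i1 := h.integrable_modQ hm hH
  have i2 := h.integrable_modQ_div_sq hm hH
  have e := modeInt_sub_const_mul (-2) i1 i2 (χ := fun x => modQ a x / x ^ 2)
  have h1 : |modeInt (modP a) (smearWeight (-1) f g) H| ≤
      modeInt (fun x => modQ a x - -2 * (modQ a x / x ^ 2)) (absWeight (-1) f g) H := by
    refine abs_modeInt_le hH (fun x hx => ?_) (abs_smearWeight_le _ _ _) ?_
    · rw [abs_of_nonneg (show 0 ≤ modP a x from sq_nonneg _)]
      linarith [modP_le h.pos.le h.le hx]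
    · refine (i1.add (i2.const_mul 2)).congr (Eventually.of_forall fun k => ?_)
      simp only [Pi.add_apply]; ring
  have h2 : |modeInt (eulerP a) (smearWeight (-1) f g) H| ≤
      modeInt (fun x => 3 * (modQ a x / x ^ 2)) (absWeight (-1) f g) H := by
    refine abs_modeInt_le hH (fun x hx => ?_) (abs_smearWeight_le _ _ _) ?_
    · obtain ⟨h3, h4⟩ := h.euler_modP_bounds hx
      rw [eulerP, abs_of_nonneg h3]; exact h4
    · simp only [mul_assoc]; exact i2.const_mul 3
  rw [e] at h1
  rw [modeInt_const_mul] at h2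
  linarith

lemma abs_modeInt_modC_le (h : SmallOrder a) (hfg : FinitePair f g) (hH : 0 < H) :
    |modeInt (modC a) (smearWeight 0 f g) H| ≤
        2 * modeInt (fun x => modQ a x / x) (absWeight 0 f g) H ∧
      |modeInt (eulerC a) (smearWeight 0 f g) H| ≤
        2 * modeInt (fun x => modQ a x / x) (absWeight 0 f g) H := by
  have i := h.integrable_modQ_div (infraredMild_fg hfg (n := 0) (by norm_num) le_rfl) hH
  rw [← modeInt_const_mul]
  constructor
  · refine abs_modeInt_le hH (fun x hx => ?_) (abs_smearWeight_le _ _ _) ?_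
    · rw [abs_of_nonneg (h.modC_bounds hx).1]; exact (h.modC_bounds hx).2
    · simp only [mul_assoc]; exact i.const_mul 2
  · refine abs_modeInt_le hH (fun x hx => ?_) (abs_smearWeight_le _ _ _) ?_
    · rw [eulerC, abs_of_nonneg (h.euler_modC_bounds hx).1]; exact (h.euler_modC_bounds hx).2
    · simp only [mul_assoc]; exact i.const_mul 2

end

/-- E and E' enter with a favourable sign and are dropped. The change tV of the mixed correlator is
bounded by Y, and 8ZY ≤ (δ/4)Z² + (64/δ)Y² trades it against half of the growth δNB. -/
lemma exact_growth_bound {A A' B B' C S Z E E' V W Y t NB δ : ℝ} (hδ : 0 < δ)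
    (hlight : δ * NB ≤ A' * B + A * B' - 2 * (C * S)) (hA : 0 ≤ A) (hA' : 0 ≤ A')
    (hE : 0 ≤ E) (hE' : 0 ≤ E') (hC : |C| ≤ 2 * Z) (hS : |S| ≤ 2 * Z) (hZ : Z ^ 2 ≤ NB)
    (ht : 0 ≤ t) (hY : t * (|V| + |W|) ≤ Y) (hY2 : (64 / δ + 2) * Y ^ 2 ≤ δ / 4 * NB) :
    δ / 2 * NB ≤ A' * (B + E) + A * (B' + E') - 2 * ((C + t * V) * (S + t * (V + W))) := by
  have h1 : 0 ≤ A' * E := mul_nonneg hA' hE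
  have h2 : 0 ≤ A * E' := mul_nonneg hA hE'
  have hZ0 : 0 ≤ Z := by linarith [abs_nonneg C]
  have hV : |t * V| ≤ Y := by
    rw [abs_mul, abs_of_nonneg ht]
    nlinarith [mul_nonneg ht (abs_nonneg W)]
  have hVW : |t * (V + W)| ≤ Y := by
    rw [abs_mul, abs_of_nonneg ht]
    refine le_trans ?_ hY
    gcongr
    exact abs_add_le _ _
  have hY0 : 0 ≤ Y := (abs_nonneg _).trans hV
  have h3 : C * (t * (V + W)) + t * V * S + t * V * (t * (V + W)) ≤ 4 * (Z * Y) + Y ^ 2 := by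
    have a1 : C * (t * (V + W)) ≤ 2 * Z * Y := (le_abs_self _).trans (by
      rw [abs_mul]; exact mul_le_mul hC hVW (abs_nonneg _) (by positivity))
    have a2 : t * V * S ≤ Y * (2 * Z) := (le_abs_self _).trans (by
      rw [abs_mul]; exact mul_le_mul hV hS (abs_nonneg _) (by positivity))
    have a3 : t * V * (t * (V + W)) ≤ Y * Y := (le_abs_self _).trans (by
      rw [abs_mul]; exact mul_le_mul hV hVW (abs_nonneg _) (by positivity))
    linarith
  have h4 : 8 * (Z * Y) ≤ δ / 4 * Z ^ 2 + 64 / δ * Y ^ 2 := by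
    have : 0 ≤ δ / 4 * (Z - 16 / δ * Y) ^ 2 := by positivity
    have e : δ / 4 * (Z - 16 / δ * Y) ^ 2 = δ / 4 * Z ^ 2 + 64 / δ * Y ^ 2 - 8 * (Z * Y) := by
      field_simp; ring
    linarith
  have h5 : δ / 4 * Z ^ 2 ≤ δ / 4 * NB := by gcongr
  nlinarith

end

noncomputable section
open MeasureTheory Filter Topology Set

lemma sq_add_five_mul_le (x y : ℝ) : (x + 5 * y) ^ 2 ≤ 2 * x ^ 2 + 50 * y ^ 2 := by
  nlinarith [sq_nonneg (x - 5 * y)]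

/-- On bounded ranges of the Hubble rate the exact determinant grows for small orders. -/
lemma exists_exact_growth {f g : Space3 → ℝ} (hfg : FinitePair f g)
    (hns : ¬ SaturatesHolder 0 f g) (M : ℝ) :
    ∃ ε : ℝ, 0 < ε ∧ ∀ a, SmallOrder a → a < ε → ∀ H, 0 < H → H ≤ M →
      ∃ d, 0 < d ∧ HasDerivAt (exactDet a f g) d H := by
  obtain ⟨δ, b, n, ε, hδ, hb, hn, hε, hgrow⟩ := exists_light_growth hfg hns
  obtain ⟨K, hK, hbound⟩ := exists_infrared_bound hfg
  -- The absolute value makes c nonnegative before M > 0 is known; it becomes 1 + M once some 0 < H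
  -- ≤ M is given.
  set c := K * (1 + M) ^ 4 * |1 + M| / b with hc
  have hc0 : 0 ≤ c := by positivity
  set c' := (64 / δ + 2) * (2 + 50 * c) with hc'
  have hc'0 : 0 < c' := by positivity
  refine ⟨min ε (δ / (4 * c')), by positivity, fun a ha haε H hH hHM => ?_⟩
  obtain ⟨hN, hB, hl⟩ := hgrow a ha (haε.trans_le (min_le_left _ _)) H hH
  have haδ : c' * a ≤ δ / 4 := by
    have := (haε.trans_le (min_le_right _ _)).le
    rw [le_div_iff₀ (by positivity)] at this
    linarith
  have ha0 := ha.pos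
  have haa : a ^ 2 ≤ a := by rw [sq]; exact mul_le_of_le_one_left ha0.le ha.lt_one.le
  have hM : 0 < M := hH.trans_le hHM
  have hNg := hbound a ha H hH
  have hZ := sq_modeInt_div_le ha hfg hH
  have hW := sq_modeInt_div_sq_le ha hfg hH
  obtain ⟨hC, hS⟩ := abs_modeInt_modC_le ha hfg hH
  have hV := abs_modeInt_modP_add_eulerP_le ha hfg hH
  have hHZ := hubble_mul_modeInt_modQ (a := a) f g hH
  have hN0 : 0 < modeInt (fun x => modQ a x / x ^ 2) (absWeight (-1) f f) H :=
    lt_of_lt_of_le (by positivity) hN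
  have hB0 : 0 < modeInt (modQ a) (absWeight 1 g g) H := lt_of_lt_of_le (by positivity) hB
  have hpos0 := absWeight_nonneg 0 g g
  have hposm := absWeight_nonneg (-1) g g
  have hU : 0 ≤ modeInt (modC a) (absWeight 0 g g) H :=
    modeInt_nonneg hH (fun x hx => (ha.modC_bounds hx).1) hpos0
  have hU' : 0 ≤ modeInt (eulerC a) (absWeight 0 g g) H :=
    modeInt_nonneg hH (fun x hx => (ha.euler_modC_bounds hx).1) hpos0
  have hAg : 0 ≤ modeInt (modP a) (absWeight (-1) g g) H :=
    modeInt_nonneg hH (fun x _ => sq_nonneg _) hposm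
  have hAg' : 0 ≤ modeInt (eulerP a) (absWeight (-1) g g) H :=
    modeInt_nonneg hH (fun x hx => (ha.euler_modP_bounds hx).1) hposm
  have hA : 0 ≤ modeInt (modP a) (absWeight (-1) f f) H :=
    modeInt_nonneg hH (fun x _ => sq_nonneg _) (absWeight_nonneg _ _ _)
  have hA' : 0 ≤ modeInt (eulerP a) (absWeight (-1) f f) H :=
    modeInt_nonneg hH (fun x hx => (ha.euler_modP_bounds hx).1) (absWeight_nonneg _ _ _)
  set N := modeInt (fun x => modQ a x / x ^ 2) (absWeight (-1) f f) H
  set B := modeInt (modQ a) (absWeight 1 g g) H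
  set Z := modeInt (fun x => modQ a x / x) (absWeight 0 f g) H
  set W := modeInt (fun x => modQ a x / x ^ 2) (absWeight (-1) f g) H
  set Ng := modeInt (fun x => modQ a x / x ^ 2) (absWeight (-1) g g) H
  have hNB : N ≤ |1 + M| / b * (N * B) := by
    have h1 : 1 ≤ |1 + M| / b * B := by
      rw [abs_of_pos (by linarith)]
      calc (1 : ℝ) = (1 + H) / b * ((1 + H)⁻¹ * b) := by field_simp
        _ ≤ (1 + M) / b * B := by gcongr
    calc N = N * 1 := (mul_one N).symm
      _ ≤ N * (|1 + M| / b * B) := by gcongr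
      _ = _ := by ring
  -- Cauchy–Schwarz gives W² ≤ N Ng. One of the two powers of a is spent on the infrared divergence
  -- of Ng, the other remains as the small factor.
  have hWs : (a * H * W) ^ 2 ≤ a * (c * (N * B)) := by
    calc (a * H * W) ^ 2 = a ^ 2 * H ^ 2 * W ^ 2 := by ring
      _ ≤ a ^ 2 * H ^ 2 * (N * Ng) := by gcongr
      _ = a * H ^ 2 * N * (a * Ng) := by ring
      _ ≤ a * H ^ 2 * N * (K * (1 + H) ^ 2) := by gcongr
      _ ≤ a * (1 + M) ^ 2 * (|1 + M| / b * (N * B)) * (K * (1 + M) ^ 2) := by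
        have : H ≤ 1 + M := by linarith
        gcongr
      _ = a * (c * (N * B)) := by rw [hc]; ring
  refine ⟨_, mul_pos (inv_pos.2 hH) ?_, hasDerivAt_exactDet ha hfg hH⟩
  refine lt_of_lt_of_le (show 0 < δ / 2 * (N * B) by positivity)
    (exact_growth_bound hδ hl hA hA' (by positivity) (by positivity) hC hS hZ (by positivity)
      (Y := a * Z + 5 * (a * H * W)) ?_ ?_)
  · calc _ ≤ a * H * (modeInt (modQ a) (absWeight (-1) f g) H + 5 * W) := by gcongr
      _ = a * (H * modeInt (modQ a) (absWeight (-1) f g) H) + 5 * (a * H * W) := by ring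
      _ = _ := by rw [hHZ]
  · have h1 : (a * Z + 5 * (a * H * W)) ^ 2 ≤ (2 + 50 * c) * a * (N * B) := by
      have h2 := sq_add_five_mul_le (a * Z) (a * H * W)
      have h3 : (a * Z) ^ 2 ≤ a * (N * B) := by
        rw [mul_pow]
        gcongr
      linarith
    calc (64 / δ + 2) * (a * Z + 5 * (a * H * W)) ^ 2
        ≤ (64 / δ + 2) * ((2 + 50 * c) * a * (N * B)) := by gcongr
      _ = c' * a * (N * B) := by rw [hc']; ring
      _ ≤ δ / 4 * (N * B) := by gcongr

/-! ### Entropy -/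

lemma vnEntropy_eq (ν : ℝ) : vnEntropy ν = (Real.log 2)⁻¹ *
    ((ν + 1) / 2 * Real.log ((ν + 1) / 2) - (ν - 1) / 2 * Real.log ((ν - 1) / 2)) := by
  rw [vnEntropy, Real.logb, Real.logb]; ring

/-- For ν > 1 the derivative is half of log₂((ν + 1)/(ν - 1)). Continuity at ν = 1 holds because y
log y extends continuously by 0. -/
lemma strictMonoOn_vnEntropy : StrictMonoOn vnEntropy (Ici 1) := by
  have hF := Real.continuous_mul_log
  have hcont : Continuous vnEntropy := by
    have h : vnEntropy = fun ν => (Real.log 2)⁻¹ *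
        ((ν + 1) / 2 * Real.log ((ν + 1) / 2) - (ν - 1) / 2 * Real.log ((ν - 1) / 2)) :=
      funext vnEntropy_eq
    rw [h]
    exact continuous_const.mul ((hF.comp (f := fun ν : ℝ => (ν + 1) / 2) (by fun_prop)).sub
      (hF.comp (f := fun ν : ℝ => (ν - 1) / 2) (by fun_prop)))
  refine strictMonoOn_of_deriv_pos (convex_Ici 1) hcont.continuousOn fun ν hν => ?_
  rw [interior_Ici] at hν
  have hν' : (1 : ℝ) < ν := hν
  have h1 : HasDerivAt (fun ν : ℝ => (ν + 1) / 2) (1 / 2) ν :=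
    ((hasDerivAt_id ν).add_const 1).div_const 2
  have h2 : HasDerivAt (fun ν : ℝ => (ν - 1) / 2) (1 / 2) ν :=
    ((hasDerivAt_id ν).sub_const 1).div_const 2
  have d1 := (Real.hasDerivAt_mul_log (x := (ν + 1) / 2) (by linarith)).comp ν h1
  have d2 := (Real.hasDerivAt_mul_log (x := (ν - 1) / 2) (by linarith)).comp ν h2
  have d := ((d1.sub d2).const_mul (Real.log 2)⁻¹).congr_of_eventuallyEq
    (Eventually.of_forall vnEntropy_eq)
  rw [d.deriv]
  have h3 : Real.log ((ν - 1) / 2) < Real.log ((ν + 1) / 2) :=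
    Real.log_lt_log (by linarith) (by linarith)
  have h4 : 0 < Real.log 2 := Real.log_pos one_lt_two
  have : 0 < (Real.log ((ν + 1) / 2) + 1) * (1 / 2) - (Real.log ((ν - 1) / 2) + 1) * (1 / 2) := by
    linarith
  positivity

/-- Entropy grows with the Hubble rate when the determinant of the covariance matrix does. -/
lemma strictMonoOn_entropy {S D : ℝ → ℝ} {d₀ : ℝ} {s : Set ℝ} (hs : Convex ℝ s)
    (hs0 : s ⊆ Ici 0) (h0 : (0 : ℝ) ∈ s) (hd₀ : 1 ≤ d₀) (hS0 : S 0 = vnEntropy (Real.sqrt d₀))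
    (hS : ∀ H, 0 < H → S H = vnEntropy (Real.sqrt (D H)))
    (hlim : Tendsto D (𝓝[>] 0) (𝓝 d₀))
    (hD : ∀ H ∈ s, 0 < H → ∃ d, 0 < d ∧ HasDerivAt D d H) : StrictMonoOn S s := by
  -- The formula for D need not have the right value at H = 0; E carries the limit d₀ there and is
  -- continuous from the right.
  set E : ℝ → ℝ := fun H => if H = 0 then d₀ else D H with hE
  have hE0 : E 0 = d₀ := by simp [hE]
  have hEev : ∀ H, 0 < H → E =ᶠ[𝓝 H] D := fun H hH => by
    filter_upwards [lt_mem_nhds hH] with y hy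
    simp [hE, hy.ne']
  have hmono : StrictMonoOn E s := by
    refine strictMonoOn_of_deriv_pos hs (fun H hH => ?_) (fun H hH => ?_)
    · rcases (mem_Ici.1 (hs0 hH)).eq_or_lt with h | h
      · rw [← h]
        refine ContinuousWithinAt.mono ?_ hs0
        rw [← Ioi_union_left, continuousWithinAt_union]
        refine ⟨?_, continuousWithinAt_singleton⟩
        rw [ContinuousWithinAt, hE0]
        refine hlim.congr' ?_
        filter_upwards [self_mem_nhdsWithin] with y hy
        simp [hE, (ne_of_gt hy : y ≠ 0)]
      · obtain ⟨d, -, hd⟩ := hD H hH h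
        exact (hd.congr_of_eventuallyEq (hEev H h)).continuousAt.continuousWithinAt
    · have hH0 : 0 < H := by
        have := interior_mono hs0 hH
        rwa [interior_Ici] at this
      obtain ⟨d, hd0, hd⟩ := hD H (interior_subset hH) hH0
      rwa [(hd.congr_of_eventuallyEq (hEev H hH0)).deriv]
  have hSE : ∀ H ∈ s, S H = vnEntropy (Real.sqrt (E H)) := fun H hH => by
    rcases (mem_Ici.1 (hs0 hH)).eq_or_lt with h | h
    · rw [← h, hS0, hE0]
    · rw [hS H h, (hEev H h).eq_of_nhds]
  -- The uncertainty bound at H = 0 propagates by monotonicity, so no separate uncertainty relation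
  -- is needed for H > 0.
  have hge : ∀ H ∈ s, 1 ≤ E H := fun H hH =>
    hd₀.trans (hE0 ▸ hmono.monotoneOn h0 hH (hs0 hH))
  intro x hx y hy hxy
  rw [hSE x hx, hSE y hy]
  have h1 := hge x hx
  have h2 := hmono hx hy hxy
  refine strictMonoOn_vnEntropy ?_ ?_ (Real.sqrt_lt_sqrt (by linarith) h2)
  · exact Real.one_le_sqrt.2 h1
  · exact Real.one_le_sqrt.2 (by linarith)

/-- (3/2 - r)² ≤ 9/4 - r² amounts to 2r² ≤ 3r. Smallness of m/H thus passes to μ². -/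
lemma muSq_pos_and_le {r : ℝ} (hr : 0 < r) (hr' : r < 1) : 0 < muSq r ∧ muSq r ≤ r := by
  have h1 : Real.sqrt (9 / 4 - r ^ 2) < 3 / 2 := by
    rw [Real.sqrt_lt' (by norm_num)]; nlinarith
  have h2 : 3 / 2 - r ≤ Real.sqrt (9 / 4 - r ^ 2) := by
    apply Real.le_sqrt_of_sq_le; nlinarith
  unfold muSq bdIndex
  constructor <;> linarith

end

noncomputable section
open MeasureTheory Filter Topology Set

/-! ### Plancherel's formula for integrable functions -/

open FourierTransform SchwartzMap Convolution

/-- Used to identify the L² Fourier transform, known through its action on Schwartz functions, with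
the Fourier integral. -/
lemma ae_eq_of_integral_schwartz_smul_eq {u v : Space3 → ℂ} (hu : LocallyIntegrable u)
    (hv : LocallyIntegrable v) (h : ∀ φ : 𝓢(Space3, ℂ), ∫ x, φ x • u x = ∫ x, φ x • v x) :
    u =ᵐ[volume] v := by
  refine ae_eq_of_integral_contDiff_smul_eq hu hv fun φ hφ hφ' => ?_
  have h1 : HasCompactSupport fun x => (φ x : ℂ) :=
    hφ'.comp_left (g := ((↑) : ℝ → ℂ)) Complex.ofReal_zero
  have h2 := h (h1.toSchwartzMap (Complex.ofRealCLM.contDiff.comp hφ))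
  calc ∫ x, φ x • u x = ∫ x, (φ x : ℂ) • u x := by simp
    _ = ∫ x, (φ x : ℂ) • v x := h2
    _ = _ := by simp

lemma integral_fourier_smul_eq_of_integrable {u v : Space3 → ℂ} (hu : Integrable u)
    (hv : Integrable v) : ∫ ξ, 𝓕 u ξ • v ξ = ∫ x, u x • 𝓕 v x := by
  have h := VectorFourier.integral_fourierIntegral_smul_eq_flip (L := innerₗ Space3)
    Real.continuous_fourierChar continuous_inner hu hv
  simpa [flip_innerₗ] using! h

lemma continuous_fourier_of_integrable {h : Space3 → ℂ} (hh : Integrable h) :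
    Continuous (𝓕 h) :=
  VectorFourier.fourierIntegral_continuous (L := innerₗ Space3) Real.continuous_fourierChar
    continuous_inner hh

/-- Plancherel's formula for an integrable function, as an equality in `[0, ∞]`. -/
lemma eLpNorm_fourier_of_integrable {h : Space3 → ℂ} (hh : Integrable h) :
    eLpNorm (𝓕 h) 2 volume = eLpNorm h 2 volume := by
  have hc := continuous_fourier_of_integrable hh
  have key1 : MemLp h 2 → eLpNorm (𝓕 h) 2 volume = eLpNorm h 2 volume := fun hm => by
    have e : (𝓕 (hm.toLp h) : Lp ℂ 2 (volume : Measure Space3)) =ᵐ[volume] 𝓕 h := by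
      refine ae_eq_of_integral_schwartz_smul_eq
        ((Lp.memLp _).locallyIntegrable one_le_two) hc.locallyIntegrable fun φ => ?_
      have h1 := DFunLike.congr_fun (Lp.fourier_toTemperedDistribution_eq (hm.toLp h)) φ
      rw [Lp.toTemperedDistribution_apply, TemperedDistribution.fourier_apply,
        Lp.toTemperedDistribution_apply] at h1
      rw [← h1]
      calc _ = ∫ x, (𝓕 φ) x • h x := by
            refine integral_congr_ae ?_
            filter_upwards [hm.coeFn_toLp] with x hx
            rw [hx]
        _ = _ := by
          rw [SchwartzMap.fourier_coe]
          exact integral_fourier_smul_eq_of_integrable (φ.integrable (μ := volume)) hh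
    rw [← eLpNorm_congr_ae e, ← eLpNorm_congr_ae hm.coeFn_toLp]
    have := congrArg ENNReal.ofReal (Lp.norm_fourier_eq (hm.toLp h))
    rwa [Lp.norm_def, Lp.norm_def, ENNReal.ofReal_toReal (Lp.eLpNorm_ne_top _),
      ENNReal.ofReal_toReal (Lp.eLpNorm_ne_top _)] at this
  by_cases hm : MemLp h 2
  · exact key1 hm
  -- If h is not square integrable, neither is its transform: otherwise the inverse L² transform
  -- would agree with h almost everywhere. Both norms are then infinite.
  by_cases hm' : MemLp (𝓕 h) 2
  · exfalso
    apply hm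
    have e : (𝓕⁻ (hm'.toLp (𝓕 h)) : Lp ℂ 2 (volume : Measure Space3)) =ᵐ[volume] h := by
      refine ae_eq_of_integral_schwartz_smul_eq
        ((Lp.memLp _).locallyIntegrable one_le_two) hh.locallyIntegrable fun φ => ?_
      have h1 := DFunLike.congr_fun (Lp.fourierInv_toTemperedDistribution_eq (hm'.toLp (𝓕 h))) φ
      rw [Lp.toTemperedDistribution_apply, TemperedDistribution.fourierInv_apply,
        Lp.toTemperedDistribution_apply] at h1
      rw [← h1]
      calc _ = ∫ x, (𝓕⁻ φ) x • 𝓕 h x := by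
            refine integral_congr_ae ?_
            filter_upwards [hm'.coeFn_toLp] with x hx
            rw [hx]
        _ = ∫ x, 𝓕 (𝓕⁻ φ : 𝓢(Space3, ℂ)) x • h x :=
          by
            rw [SchwartzMap.fourier_coe]
            exact (integral_fourier_smul_eq_of_integrable ((𝓕⁻ φ).integrable (μ := volume)) hh).symm
        _ = _ := by simp
    exact (memLp_congr_ae e).1 (Lp.memLp _)
  · have h1 : eLpNorm h 2 volume = ⊤ := by
      by_contra hne
      exact hm ⟨hh.aestronglyMeasurable, lt_top_iff_ne_top.2 hne⟩
    have h2 : eLpNorm (𝓕 h) 2 volume = ⊤ := by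
      by_contra hne
      exact hm' ⟨hc.aestronglyMeasurable, lt_top_iff_ne_top.2 hne⟩
    rw [h1, h2]

lemma lintegral_enorm_sq_fourier {h : Space3 → ℂ} (hh : Integrable h) :
    ∫⁻ ξ, ‖𝓕 h ξ‖ₑ ^ 2 = ∫⁻ x, ‖h x‖ₑ ^ 2 := by
  have h1 := eLpNorm_fourier_of_integrable hh
  rw [eLpNorm_eq_lintegral_rpow_enorm_toReal two_ne_zero ENNReal.ofNat_ne_top,
    eLpNorm_eq_lintegral_rpow_enorm_toReal two_ne_zero ENNReal.ofNat_ne_top] at h1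
  have h2 := congrArg (· ^ (2 : ℝ)) h1
  simp only [← ENNReal.rpow_mul] at h2
  simpa using h2

/-! ### Parseval's inequality for a bounded factor -/

lemma integral_mul_conj_fourierInv {F w : Space3 → ℂ} (hF : Integrable F) (hw : Integrable w) :
    ∫ x, F x * (starRingEnd ℂ) (𝓕⁻ w x) = ∫ ξ, 𝓕 F ξ * (starRingEnd ℂ) (w ξ) := by
  have hw' : Integrable fun ξ => (starRingEnd ℂ) (w ξ) :=
    (Complex.conjCLE.toContinuousLinearMap.integrable_comp hw)
  have h1 := integral_fourier_smul_eq_of_integrable hF hw'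
  simp only [smul_eq_mul] at h1
  rw [h1]
  congr 1
  funext x
  congr 1
  rw [Real.fourierInv_eq', Real.fourier_eq', ← integral_conj]
  congr 1
  funext y
  rw [smul_eq_mul, smul_eq_mul, map_mul, ← Complex.exp_conj]
  congr 2
  simp [Complex.conj_ofNat]

/-- The Fourier transform of h need not be integrable, but that of a mollification is. For
mollifications inversion and the exchange formula apply, and the mollifier's transform has modulus
at most 1. Boundedness of h supplies the majorant C|F| in the limit. -/
lemma enorm_integral_mul_conj_le {F h : Space3 → ℂ} {C : ℝ} (hF : Integrable F)
    (hh : Integrable h) (hC : ∀ x, ‖h x‖ ≤ C) :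
    ‖∫ x, F x * (starRingEnd ℂ) (h x)‖ₑ ≤ ∫⁻ ξ, ‖𝓕 F ξ‖ₑ * ‖𝓕 h ξ‖ₑ := by
  -- The fixed ratio 2 of outer to inner radius is required for almost everywhere convergence of the
  -- mollifications.
  let φ : ℕ → ContDiffBump (0 : Space3) := fun i =>
    ⟨1 / (i + 1), 2 * (1 / (i + 1)), by positivity, by
      have : (0 : ℝ) < 1 / (i + 1) := by positivity
      linarith⟩
  have hφ : Tendsto (fun i => (φ i).rOut) atTop (𝓝 0) := by
    have := (tendsto_one_div_add_atTop_nhds_zero_nat (𝕜 := ℝ)).const_mul 2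
    simpa [φ] using this
  have hconv := ContDiffBump.ae_convolution_tendsto_right_of_locallyIntegrable (μ := volume)
    (K := 2) hφ (Eventually.of_forall fun i => le_rfl) hh.locallyIntegrable
  set u : ℕ → Space3 → ℂ := fun i => (φ i).normed volume ⋆[ContinuousLinearMap.lsmul ℝ ℝ] h
    with hu
  have hη : ∀ i, Integrable ((φ i).normed volume) := fun i =>
    (φ i).integrable_normed
  have huC : ∀ i x, ‖u i x‖ ≤ C := fun i x => by
    rw [hu]
    simp only [convolution_def]
    calc _ ≤ ∫ t, (φ i).normed volume t * C := by
          refine norm_integral_le_of_norm_le ((hη i).mul_const C) (Eventually.of_forall fun t => ?_)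
          rw [ContinuousLinearMap.lsmul_apply, norm_smul,
            Real.norm_of_nonneg ((φ i).nonneg_normed t)]
          exact mul_le_mul_of_nonneg_left (hC _) ((φ i).nonneg_normed t)
      _ = C := by rw [integral_mul_const, (φ i).integral_normed, one_mul]
  have hui : ∀ i, Integrable (u i) := fun i => (hη i).integrable_convolution _ hh
  have huc : ∀ i, Continuous (u i) := fun i =>
    (φ i).hasCompactSupport_normed.continuous_convolution_left _ (φ i).continuous_normed
      hh.locallyIntegrable
  -- the Fourier transform of the mollified function
  have hFu : ∀ i, 𝓕 (u i) = fun ξ => 𝓕 (fun x => ((φ i).normed volume x : ℂ)) ξ * 𝓕 h ξ := by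
    intro i
    funext ξ
    refine Eq.trans ?_ (Real.fourier_mul_convolution_eq (hη i).ofReal hh ξ)
    congr 1
  have hφs : ∀ i, Integrable (𝓕 (fun x => ((φ i).normed volume x : ℂ))) := fun i => by
    have h1 : HasCompactSupport fun x => ((φ i).normed volume x : ℂ) :=
      (φ i).hasCompactSupport_normed.comp_left (g := ((↑) : ℝ → ℂ)) Complex.ofReal_zero
    have := (𝓕 (h1.toSchwartzMap (Complex.ofRealCLM.contDiff.comp (φ i).contDiff_normed)) :
      𝓢(Space3, ℂ)).integrable (μ := volume)
    rw [SchwartzMap.fourier_coe] at this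
    exact this
  have hφ1 : ∀ i ξ, ‖𝓕 (fun x => ((φ i).normed volume x : ℂ)) ξ‖ ≤ 1 := fun i ξ => by
    refine (VectorFourier.norm_fourierIntegral_le_integral_norm _ _ _ _ _).trans (le_of_eq ?_)
    rw [← (φ i).integral_normed (μ := volume)]
    congr 1
    funext x
    rw [Complex.norm_real, Real.norm_of_nonneg ((φ i).nonneg_normed x)]
  have hFui : ∀ i, Integrable (𝓕 (u i)) := fun i => by
    rw [hFu i]
    refine (hφs i).mul_bdd (c := ∫ x, ‖h x‖)
      (continuous_fourier_of_integrable hh).aestronglyMeasurable (Eventually.of_forall fun ξ => ?_)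
    exact VectorFourier.norm_fourierIntegral_le_integral_norm _ _ _ _ _
  have hle : ∀ i, ‖∫ x, F x * (starRingEnd ℂ) (u i x)‖ₑ ≤ ∫⁻ ξ, ‖𝓕 F ξ‖ₑ * ‖𝓕 h ξ‖ₑ := by
    intro i
    have e := (huc i).fourierInv_fourier_eq (hui i) (hFui i)
    have h1 := integral_mul_conj_fourierInv hF (hFui i)
    rw [e] at h1
    rw [h1]
    refine (enorm_integral_le_lintegral_enorm _).trans (lintegral_mono fun ξ => ?_)
    rw [enorm_mul, RCLike.enorm_conj, hFu i, enorm_mul]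
    gcongr
    refine mul_le_of_le_one_left' ?_
    rw [← ofReal_norm]
    exact ENNReal.ofReal_le_one.2 (hφ1 i ξ)
  have hlim : Tendsto (fun i => ∫ x, F x * (starRingEnd ℂ) (u i x)) atTop
      (𝓝 (∫ x, F x * (starRingEnd ℂ) (h x))) := by
    refine tendsto_integral_of_dominated_convergence (fun x => ‖F x‖ * C) (fun i => ?_)
      (hF.norm.mul_const C) (fun i => Eventually.of_forall fun x => ?_) ?_
    · exact hF.aestronglyMeasurable.mul
        (Complex.continuous_conj.comp (huc i)).aestronglyMeasurable
    · rw [norm_mul, RCLike.norm_conj]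
      exact mul_le_mul_of_nonneg_left (huC i x) (norm_nonneg _)
    · filter_upwards [hconv] with x hx
      exact ((Complex.continuous_conj.tendsto _).comp hx).const_mul _
  exact le_of_tendsto hlim.enorm (Eventually.of_forall hle)

end

noncomputable section
open MeasureTheory Filter Topology Set

open FourierTransform

/-! ### The Gagliardo form of the Sobolev norm of order one half -/

/-- The squared modulus of `e^{2πi z·ξ} - 1`. -/
def phaseGap (z ξ : Space3) : ENNReal := ‖((Real.fourierChar (inner ℝ z ξ) : Circle) : ℂ) - 1‖ₑ ^ 2

lemma continuous_phaseGap : Continuous fun p : Space3 × Space3 => phaseGap p.1 p.2 := by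
  unfold phaseGap
  have : Continuous fun p : Space3 × Space3 =>
      ((Real.fourierChar (inner ℝ p.1 p.2) : Circle) : ℂ) - 1 :=
    (continuous_subtype_val.comp (Real.continuous_fourierChar.comp (by fun_prop))).sub
      continuous_const
  fun_prop

lemma continuous_phaseGap_left (ξ : Space3) : Continuous fun z => phaseGap z ξ :=
  continuous_phaseGap.comp (f := fun z : Space3 => (z, ξ)) (by fun_prop)

/-- The kernel `|z|⁻⁴`. -/
def gagliardoKernel (z : Space3) : ENNReal := (‖z‖ₑ ^ 4)⁻¹

lemma measurable_gagliardoKernel : Measurable gagliardoKernel := by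
  unfold gagliardoKernel; fun_prop

lemma lintegral_comp_smul_space3 {F : Space3 → ENNReal} (hF : Measurable F) {r : ℝ} (hr : 0 < r) :
    ∫⁻ z, F (r • z) = ENNReal.ofReal ((r ^ 3)⁻¹) * ∫⁻ z, F z := by
  have h := Measure.map_addHaar_smul (volume : Measure Space3) hr.ne'
  rw [← lintegral_map hF (measurable_const_smul r), h, lintegral_smul_measure,
    abs_of_pos (by positivity)]
  simp

/-- A reflection takes e to ξ/|ξ|. Scaling by |ξ| then gives |ξ|⁴ from the kernel and |ξ|⁻³ from the
volume. -/
lemma lintegral_gagliardoKernel_mul_phaseGap (e : Space3) (he : ‖e‖ = 1) (ξ : Space3) :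
    ∫⁻ z, gagliardoKernel z * phaseGap z ξ =
      ‖ξ‖ₑ * ∫⁻ z, gagliardoKernel z * phaseGap z e := by
  rcases eq_or_ne ξ 0 with rfl | hξ
  · simp [phaseGap]
  have hr : 0 < ‖ξ‖ := norm_pos_iff.2 hξ
  set r := ‖ξ‖ with hrdef
  have hn : ‖e‖ = ‖r⁻¹ • ξ‖ := by
    rw [he, norm_smul, norm_inv, Real.norm_of_nonneg hr.le, ← hrdef, inv_mul_cancel₀ hr.ne']
  set A := (ℝ ∙ (e - r⁻¹ • ξ))ᗮ.reflection
  have hA : A e = r⁻¹ • ξ := Submodule.reflection_sub hn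
  have hmeas : Measurable fun z => gagliardoKernel z * phaseGap z e :=
    measurable_gagliardoKernel.mul
      (continuous_phaseGap_left e).measurable
  have h1 := A.measurePreserving.lintegral_comp_emb A.toHomeomorph.measurableEmbedding
    (fun z => gagliardoKernel z * phaseGap z ξ)
  rw [← h1]
  have h2 : ∀ z, gagliardoKernel (A z) * phaseGap (A z) ξ =
      ‖ξ‖ₑ ^ 4 * (gagliardoKernel (r • z) * phaseGap (r • z) e) := fun z => by
    have e1 : inner ℝ (A z) ξ = inner ℝ (r • z) e := by
      have : ξ = r • A e := by rw [hA, smul_inv_smul₀ hr.ne']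
      rw [this, inner_smul_right, LinearIsometryEquiv.inner_map_map, inner_smul_left]
      simp
    have e2 : gagliardoKernel (A z) = ‖ξ‖ₑ ^ 4 * gagliardoKernel (r • z) := by
      unfold gagliardoKernel
      have e3 : ‖A z‖ₑ = ‖z‖ₑ := by rw [← ofReal_norm, A.norm_map, ofReal_norm]
      have e4 : ‖r‖ₑ = ‖ξ‖ₑ := by rw [hrdef, enorm_norm]
      rw [e3, enorm_smul, e4, mul_pow, ENNReal.mul_inv (by simp [hξ]) (by simp), ← mul_assoc,
        ENNReal.mul_inv_cancel (by simp [hξ]) (by simp), one_mul]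
    rw [e2, mul_assoc, phaseGap, phaseGap, e1]
  simp_rw [h2]
  have h3 := lintegral_comp_smul_space3 hmeas hr
  rw [lintegral_const_mul, h3, ← mul_assoc]
  swap
  · exact hmeas.comp (measurable_const_smul r)
  congr 1
  rw [← ofReal_norm, ← hrdef, ← ENNReal.ofReal_pow hr.le, ← ENNReal.ofReal_mul (by positivity)]
  congr 1
  field_simp

/-- A fixed unit vector. -/
def unitVec : Space3 := EuclideanSpace.single 0 1

lemma norm_unitVec : ‖unitVec‖ = 1 := by simp [unitVec]

/-- The constant which relates the Gagliardo form to the Fourier side. -/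
def gagliardoConst : ENNReal := ∫⁻ z, gagliardoKernel z * phaseGap z unitVec

/-- The phase gap equals 4 at half the unit vector, hence is positive on a neighbourhood. -/
lemma gagliardoConst_ne_zero : gagliardoConst ≠ 0 := by
  have hmeas : Measurable fun z => gagliardoKernel z * phaseGap z unitVec :=
    measurable_gagliardoKernel.mul
      (continuous_phaseGap_left _).measurable
  have hopen : IsOpen {z : Space3 | phaseGap z unitVec ≠ 0} :=
    isOpen_compl_singleton.preimage (continuous_phaseGap_left unitVec)
  have hne : ((1 / 2 : ℝ) • unitVec) ∈ {z : Space3 | phaseGap z unitVec ≠ 0} := by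
    have h1 : inner ℝ ((1 / 2 : ℝ) • unitVec) unitVec = (1 / 2 : ℝ) := by
      rw [inner_smul_left, real_inner_self_eq_norm_sq, norm_unitVec]
      simp
    have h2 : (Real.fourierChar (1 / 2) : ℂ) = -1 := by
      rw [Real.fourierChar_apply]
      have : ((2 * Real.pi * (1 / 2) : ℝ) : ℂ) * Complex.I = Real.pi * Complex.I := by
        push_cast; ring
      rw [this, Complex.exp_pi_mul_I]
    rw [Set.mem_ofPred_eq, phaseGap, h1, h2]
    exact pow_ne_zero 2 (enorm_ne_zero.2 (by norm_num))
  have hpos : 0 < volume (Function.support fun z => gagliardoKernel z * phaseGap z unitVec) :=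
    (hopen.measure_pos volume ⟨_, hne⟩).trans_le (measure_mono fun z hz =>
      mul_ne_zero (ENNReal.inv_ne_zero.2 (ENNReal.pow_ne_top enorm_ne_top)) hz)
  rw [gagliardoConst, ← pos_iff_ne_zero, lintegral_pos_iff_support hmeas]
  exact hpos

/-- The phase gap is at most (2π|z|)², so the integrand is O(|z|⁻²) near 0, and it is O(|z|⁻⁴) at
infinity; both are integrable in dimension three. -/
lemma gagliardoConst_ne_top : gagliardoConst ≠ ⊤ := by
  set G : Space3 → ℝ := fun z => (2 * Real.pi) ^ 2 *
    (Iic (1 : ℝ)).indicator (fun y => y ^ (-2 : ℝ)) ‖z‖ + 64 * (1 + ‖z‖) ^ (-4 : ℝ) with hG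
  have hGi : Integrable G :=
    ((integrableOn_ball_rpow (s := 2) (by norm_num)).const_mul _).add
      ((integrable_one_add_norm (by simp; norm_num)).const_mul _)
  refine ne_top_of_le_ne_top hGi.lintegral_lt_top.ne (lintegral_mono fun z => ?_)
  -- At z = 0 the kernel is infinite, but ∞ · 0 = 0.
  rcases eq_or_ne z 0 with rfl | hz
  · simp [phaseGap]
  have hr : 0 < ‖z‖ := norm_pos_iff.2 hz
  have e1 : gagliardoKernel z * phaseGap z unitVec = ENNReal.ofReal
      ((‖z‖ ^ 4)⁻¹ * ‖((Real.fourierChar (inner ℝ z unitVec) : Circle) : ℂ) - 1‖ ^ 2) := by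
    rw [ENNReal.ofReal_mul (by positivity), ENNReal.ofReal_inv_of_pos (by positivity),
      ENNReal.ofReal_pow hr.le, ENNReal.ofReal_pow (norm_nonneg _), ofReal_norm, ofReal_norm]
    rfl
  rw [e1]
  refine ENNReal.ofReal_le_ofReal ?_
  have hin : |inner ℝ z unitVec| ≤ ‖z‖ := by
    have := abs_real_inner_le_norm z unitVec
    rwa [norm_unitVec, mul_one] at this
  have hpi := Real.pi_pos
  by_cases h : ‖z‖ ≤ 1
  · have h1 : ‖((Real.fourierChar (inner ℝ z unitVec) : Circle) : ℂ) - 1‖ ≤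
        2 * Real.pi * ‖z‖ := by
      rw [Real.fourierChar_apply, mul_comm _ Complex.I]
      refine (Real.norm_exp_I_mul_ofReal_sub_one_le).trans ?_
      rw [Real.norm_eq_abs, abs_mul, abs_of_pos (by positivity : 0 < 2 * Real.pi)]
      gcongr
    rw [hG]
    simp only
    rw [indicator_of_mem (show ‖z‖ ∈ Iic (1 : ℝ) from h)]
    have h2 : (0 : ℝ) ≤ 64 * (1 + ‖z‖) ^ (-4 : ℝ) := by positivity
    calc _ ≤ (‖z‖ ^ 4)⁻¹ * (2 * Real.pi * ‖z‖) ^ 2 := by gcongr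
      _ = (2 * Real.pi) ^ 2 * ‖z‖ ^ (-2 : ℝ) := by
        rw [Real.rpow_neg hr.le, Real.rpow_two]; field_simp
      _ ≤ _ := by linarith
  · push Not at h
    have h1 : ‖((Real.fourierChar (inner ℝ z unitVec) : Circle) : ℂ) - 1‖ ≤ 2 := by
      refine (norm_sub_le _ _).trans ?_
      rw [Circle.norm_coe, norm_one]; norm_num
    rw [hG]
    simp only
    rw [indicator_of_notMem (show ‖z‖ ∉ Iic (1 : ℝ) from not_le.2 h), mul_zero, zero_add,
      Real.rpow_neg (by positivity)]
    have e2 : (1 + ‖z‖) ^ (4 : ℝ) = (1 + ‖z‖) ^ 4 := by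
      rw [← Real.rpow_natCast]; norm_num
    rw [e2]
    have h3 : (1 + ‖z‖) ^ 4 ≤ 16 * ‖z‖ ^ 4 := by
      calc (1 + ‖z‖) ^ 4 ≤ (2 * ‖z‖) ^ 4 := by gcongr; linarith
        _ = _ := by ring
    calc _ ≤ (‖z‖ ^ 4)⁻¹ * 2 ^ 2 := by gcongr
      _ = 64 * (16 * ‖z‖ ^ 4)⁻¹ := by rw [mul_inv]; ring
      _ ≤ _ := by gcongr

lemma fourier_translate_sub {h : Space3 → ℂ} (hh : Integrable h) (z ξ : Space3) :
    𝓕 (fun x => h (x + z) - h x) ξ =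
      (((Real.fourierChar (inner ℝ z ξ) : Circle) : ℂ) - 1) * 𝓕 h ξ := by
  have h1 : 𝓕 (fun x => h (x + z)) ξ = ((Real.fourierChar (inner ℝ z ξ) : Circle) : ℂ) * 𝓕 h ξ :=
    congrFun (VectorFourier.fourierIntegral_comp_add_right Real.fourierChar volume
      (innerₗ Space3) h z) ξ
  rw [sub_mul, one_mul, ← h1, Real.fourier_eq, Real.fourier_eq, Real.fourier_eq, ← integral_sub]
  · simp only [smul_sub]
  · exact (Real.fourierIntegral_convergent_iff ξ).2 (hh.comp_add_right z)
  · exact (Real.fourierIntegral_convergent_iff ξ).2 hh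

/-- The Gagliardo form computes the homogeneous Sobolev norm of order one half. -/
lemma gagliardo_eq {h : Space3 → ℂ} (hh : Integrable h) :
    ∫⁻ z, gagliardoKernel z * ∫⁻ x, ‖h (x + z) - h x‖ₑ ^ 2 =
      gagliardoConst * ∫⁻ ξ, ‖ξ‖ₑ * ‖𝓕 h ξ‖ₑ ^ 2 := by
  have hc := continuous_fourier_of_integrable hh
  have h1 : ∀ z, gagliardoKernel z * ∫⁻ x, ‖h (x + z) - h x‖ₑ ^ 2 =
      ∫⁻ ξ, gagliardoKernel z * (phaseGap z ξ * ‖𝓕 h ξ‖ₑ ^ 2) := fun z => by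
    -- Plancherel for the difference of h and its translate, whose transform is (e^{2πi z·ξ} - 1)
    -- times that of h.
    have h2 := lintegral_enorm_sq_fourier ((hh.comp_add_right z).sub hh)
    simp only [Pi.sub_apply] at h2
    rw [← h2, lintegral_const_mul]
    · congr 2
      funext ξ
      rw [phaseGap, ← mul_pow, ← enorm_mul, ← fourier_translate_sub hh]
      rfl
    · exact (continuous_phaseGap.comp (Continuous.prodMk_right z)).measurable.mul (by fun_prop)
  simp_rw [h1]
  rw [lintegral_lintegral_swap]
  · rw [← lintegral_const_mul _ (by fun_prop)]
    refine lintegral_congr fun ξ => ?_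
    simp_rw [← mul_assoc]
    rw [lintegral_mul_const, lintegral_gagliardoKernel_mul_phaseGap unitVec norm_unitVec,
      gagliardoConst, mul_comm ‖ξ‖ₑ]
    exact measurable_gagliardoKernel.mul
      (continuous_phaseGap_left ξ).measurable
  · exact ((measurable_gagliardoKernel.comp measurable_fst).mul
      (continuous_phaseGap.measurable.mul
        ((hc.comp continuous_snd).enorm.measurable.pow_const 2))).aemeasurable

end

noncomputable section
open MeasureTheory Filter Topology Set

open FourierTransform

/-! ### The uncertainty relation for a canonical pair -/

lemma integrable_complex_ofReal {u : Space3 → ℝ} (hu : Integrable u) :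
    Integrable fun x => (u x : ℂ) := hu.ofReal

lemma smearFourier_two_pi_smul (f : Space3 → ℝ) (ξ : Space3) :
    smearFourier f ((2 * Real.pi) • ξ) = 𝓕 (fun x => (f x : ℂ)) ξ := by
  rw [smearFourier, Real.fourier_eq']
  congr 1
  funext x
  rw [smul_eq_mul, inner_smul_left, real_inner_comm]
  congr 2
  simp
  ring

/-- The substitution k = 2πξ absorbs the factor (2π)⁻³. -/
lemma lintegral_absWeight {f : Space3 → ℝ} (hf : Integrable f) (n : ℝ) :
    ∫⁻ k, ENNReal.ofReal (absWeight n f f k) =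
      ∫⁻ ξ, ENNReal.ofReal ((2 * Real.pi * ‖ξ‖) ^ n) * ‖𝓕 (fun x => (f x : ℂ)) ξ‖ₑ ^ 2 := by
  have hpi := Real.pi_pos
  have h := lintegral_comp_smul_space3 (F := fun k =>
    ENNReal.ofReal (‖k‖ ^ n * (‖smearFourier f k‖ * ‖smearFourier f k‖)))
    (((measurable_norm_rpow n).mul ((continuous_smearFourier hf).norm.measurable.mul
      (continuous_smearFourier hf).norm.measurable)).ennreal_ofReal)
    (r := 2 * Real.pi) (by positivity)
  calc _ = ENNReal.ofReal (((2 * Real.pi) ^ 3)⁻¹) *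
        ∫⁻ k, ENNReal.ofReal (‖k‖ ^ n * (‖smearFourier f k‖ * ‖smearFourier f k‖)) := by
        rw [← lintegral_const_mul']
        · refine lintegral_congr fun k => ?_
          rw [absWeight, ENNReal.ofReal_mul (by positivity)]
        · exact ENNReal.ofReal_ne_top
    _ = _ := by
        rw [← h]
        refine lintegral_congr fun ξ => ?_
        rw [smearFourier_two_pi_smul, norm_smul, Real.norm_of_nonneg (by positivity),
          ENNReal.ofReal_mul (by positivity), ← sq, ENNReal.ofReal_pow (norm_nonneg _),
          ofReal_norm]

/-- Truncation at height `n`. -/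
def clampFun (n : ℕ) (y : ℝ) : ℝ := max (-n) (min y n)

lemma abs_clampFun_le (n : ℕ) (y : ℝ) : |clampFun n y| ≤ n := by
  have : (0 : ℝ) ≤ n := n.cast_nonneg
  rw [abs_le, clampFun]
  exact ⟨le_max_left _ _, max_le (by linarith) (min_le_right _ _)⟩

lemma abs_clampFun_sub_le (n : ℕ) (x y : ℝ) : |clampFun n x - clampFun n y| ≤ |x - y| := by
  unfold clampFun
  rw [max_comm, max_comm (-(n : ℝ))]
  exact (abs_max_sub_max_le_abs _ _ _).trans (abs_inf_sub_inf_le_abs _ _ _)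

lemma abs_clampFun_le_abs (n : ℕ) (y : ℝ) : |clampFun n y| ≤ |y| := by
  have h := abs_clampFun_sub_le n y 0
  have h0 : clampFun n 0 = 0 := by simp [clampFun]
  rwa [h0, sub_zero, sub_zero] at h

lemma clampFun_eq {n : ℕ} {y : ℝ} (h : |y| ≤ n) : clampFun n y = y := by
  rw [clampFun, min_eq_left (abs_le.1 h).2, max_eq_right (abs_le.1 h).1]

lemma continuous_clampFun (n : ℕ) : Continuous (clampFun n) := by
  unfold clampFun; fun_prop

lemma integrable_clampFun {g : Space3 → ℝ} (hg : Integrable g) (n : ℕ) :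
    Integrable fun x => clampFun n (g x) :=
  hg.mono ((continuous_clampFun n).comp_aestronglyMeasurable hg.aestronglyMeasurable)
    (Eventually.of_forall fun x => abs_clampFun_le_abs n (g x))

/-- Truncation does not increase the Sobolev norm of order one half. -/
lemma lintegral_absWeight_clampFun_le {g : Space3 → ℝ} (hg : Integrable g) (n : ℕ) :
    ∫⁻ k, ENNReal.ofReal (absWeight 1 (fun x => clampFun n (g x)) (fun x => clampFun n (g x)) k) ≤
      ∫⁻ k, ENNReal.ofReal (absWeight 1 g g k) := by
  have hpi := Real.pi_pos
  have e : ∀ u : Space3 → ℝ, Integrable u → ∫⁻ k, ENNReal.ofReal (absWeight 1 u u k) =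
      ENNReal.ofReal (2 * Real.pi) * ∫⁻ ξ, ‖ξ‖ₑ * ‖𝓕 (fun x => (u x : ℂ)) ξ‖ₑ ^ 2 := by
    intro u hu
    rw [lintegral_absWeight hu, ← lintegral_const_mul' _ _ ENNReal.ofReal_ne_top]
    refine lintegral_congr fun ξ => ?_
    rw [Real.rpow_one, ENNReal.ofReal_mul (by positivity), ofReal_norm, mul_assoc]
  rw [e g hg, e _ (integrable_clampFun hg n)]
  refine mul_le_mul_right ?_ _
  -- In the Gagliardo form the claim holds pointwise, since truncation is a contraction. The
  -- constant can be cancelled because it is neither 0 nor ∞.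
  rw [← ENNReal.mul_le_mul_iff_right gagliardoConst_ne_zero gagliardoConst_ne_top,
    ← gagliardo_eq (integrable_complex_ofReal hg), ← gagliardo_eq (integrable_complex_ofReal (integrable_clampFun hg n))]
  refine lintegral_mono fun z => mul_le_mul_right (lintegral_mono fun x => ?_) _
  refine pow_le_pow_left' ?_ 2
  rw [← Complex.ofReal_sub, ← Complex.ofReal_sub, ← ofReal_norm, ← ofReal_norm,
    Complex.norm_real, Complex.norm_real]
  exact ENNReal.ofReal_le_ofReal (abs_clampFun_sub_le n _ _)

/-- Cauchy–Schwarz after inserting (2π|ξ|)^{-1/2} (2π|ξ|)^{1/2} = 1 away from ξ = 0. -/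
lemma sq_lintegral_fourier_mul_le {f h : Space3 → ℝ} (hf : Integrable f) (hh : Integrable h) :
    (∫⁻ ξ, ‖𝓕 (fun x => (f x : ℂ)) ξ‖ₑ * ‖𝓕 (fun x => (h x : ℂ)) ξ‖ₑ) ^ 2 ≤
      (∫⁻ k, ENNReal.ofReal (absWeight (-1) f f k)) *
        ∫⁻ k, ENNReal.ofReal (absWeight 1 h h k) := by
  have hpi := Real.pi_pos
  have hcf := continuous_fourier_of_integrable (integrable_complex_ofReal hf)
  have hch := continuous_fourier_of_integrable (integrable_complex_ofReal hh)
  rw [lintegral_absWeight hf, lintegral_absWeight hh]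
  set P : Space3 → ENNReal := fun ξ =>
    ENNReal.ofReal ((2 * Real.pi * ‖ξ‖) ^ (-(1 / 2) : ℝ)) * ‖𝓕 (fun x => (f x : ℂ)) ξ‖ₑ with hP
  set Q : Space3 → ENNReal := fun ξ =>
    ENNReal.ofReal ((2 * Real.pi * ‖ξ‖) ^ (1 / 2 : ℝ)) * ‖𝓕 (fun x => (h x : ℂ)) ξ‖ₑ with hQ
  have hPm : Measurable P := by
    rw [hP]
    exact (by fun_prop : Measurable fun ξ : Space3 =>
      ENNReal.ofReal ((2 * Real.pi * ‖ξ‖) ^ (-(1 / 2) : ℝ))).mul hcf.enorm.measurable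
  have hQm : Measurable Q := by
    rw [hQ]
    exact (by fun_prop : Measurable fun ξ : Space3 =>
      ENNReal.ofReal ((2 * Real.pi * ‖ξ‖) ^ (1 / 2 : ℝ))).mul hch.enorm.measurable
  have h1 := ENNReal.lintegral_mul_le_Lp_mul_Lq volume Real.HolderConjugate.two_two
    hPm.aemeasurable hQm.aemeasurable
  have e0 : ∫⁻ ξ, ‖𝓕 (fun x => (f x : ℂ)) ξ‖ₑ * ‖𝓕 (fun x => (h x : ℂ)) ξ‖ₑ =
      ∫⁻ ξ, (P * Q) ξ := by
    refine lintegral_congr_ae ?_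
    filter_upwards [ae_ne_zero_space3] with ξ hξ
    have hξ' : 0 < 2 * Real.pi * ‖ξ‖ := by have := norm_pos_iff.2 hξ; positivity
    rw [Pi.mul_apply, hP, hQ]
    simp only
    rw [mul_mul_mul_comm, ← ENNReal.ofReal_mul (by positivity), ← Real.rpow_add hξ']
    simp
  have eP : ∫⁻ ξ, P ξ ^ (2 : ℝ) =
      ∫⁻ ξ, ENNReal.ofReal ((2 * Real.pi * ‖ξ‖) ^ (-1 : ℝ)) * ‖𝓕 (fun x => (f x : ℂ)) ξ‖ₑ ^ 2 := by
    refine lintegral_congr fun ξ => ?_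
    rw [ENNReal.rpow_two, hP]
    simp only
    rw [mul_pow, ← ENNReal.ofReal_pow (by positivity), ← Real.rpow_natCast,
      ← Real.rpow_mul (by positivity)]
    norm_num
  have eQ : ∫⁻ ξ, Q ξ ^ (2 : ℝ) =
      ∫⁻ ξ, ENNReal.ofReal ((2 * Real.pi * ‖ξ‖) ^ (1 : ℝ)) * ‖𝓕 (fun x => (h x : ℂ)) ξ‖ₑ ^ 2 := by
    refine lintegral_congr fun ξ => ?_
    rw [ENNReal.rpow_two, hQ]
    simp only
    rw [mul_pow, ← ENNReal.ofReal_pow (by positivity), ← Real.rpow_natCast,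
      ← Real.rpow_mul (by positivity)]
    norm_num
  rw [← e0, eP, eQ] at h1
  refine (pow_le_pow_left' h1 2).trans (le_of_eq ?_)
  rw [mul_pow, ← ENNReal.rpow_natCast, ← ENNReal.rpow_natCast, ← ENNReal.rpow_mul,
    ← ENNReal.rpow_mul]
  norm_num

/-- The uncertainty relation `(∫ f g)² ≤ ‖f‖²_{-1/2} ‖g‖²_{1/2}` for a canonical pair. -/
lemma one_le_sobolev_mul {f g : Space3 → ℝ} (hfg : FinitePair f g) (hω : ∫ x, f x * g x = 1) :
    1 ≤ (∫ k, absWeight (-1) f f k) * ∫ k, absWeight 1 g g k := by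
  -- A non-integrable product would have integral 0, not 1.
  have hi : Integrable fun x => f x * g x := by
    by_contra h
    rw [integral_undef h] at hω
    exact zero_ne_one hω
  -- The Parseval inequality needs one bounded factor, hence the truncation of g at height n.
  have hlim : Tendsto (fun n => ∫ x, f x * clampFun n (g x)) atTop (𝓝 1) := by
    rw [← hω]
    refine tendsto_integral_of_dominated_convergence (fun x => ‖f x * g x‖) (fun n => ?_) hi.norm
      (fun n => Eventually.of_forall fun x => ?_) (Eventually.of_forall fun x => ?_)
    · exact hfg.left.aestronglyMeasurable.mul
        (integrable_clampFun hfg.right n).aestronglyMeasurable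
    · rw [norm_mul, norm_mul]
      exact mul_le_mul_of_nonneg_left (abs_clampFun_le_abs n _) (norm_nonneg _)
    · refine tendsto_const_nhds.congr' ?_
      obtain ⟨N, hN⟩ := exists_nat_ge |g x|
      filter_upwards [eventually_ge_atTop N] with n hn
      rw [clampFun_eq (hN.trans (Nat.cast_le.2 hn))]
  have hle : ∀ n : ℕ, ‖∫ x, f x * clampFun n (g x)‖ₑ ^ 2 ≤
      ENNReal.ofReal ((∫ k, absWeight (-1) f f k) * ∫ k, absWeight 1 g g k) := fun n => by
    have hc := integrable_clampFun hfg.right n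
    have h1 := enorm_integral_mul_conj_le (C := n) (integrable_complex_ofReal hfg.left)
      (integrable_complex_ofReal hc) fun x => by
      rw [Complex.norm_real]
      exact abs_clampFun_le n (g x)
    have e1 : ∫ x, (f x : ℂ) * (starRingEnd ℂ) ((clampFun n (g x) : ℝ) : ℂ) =
        ((∫ x, f x * clampFun n (g x) : ℝ) : ℂ) := by
      rw [← integral_complex_ofReal]
      simp
    rw [e1, ← ofReal_norm, Complex.norm_real, ofReal_norm] at h1
    rw [ENNReal.ofReal_mul (integral_nonneg fun k => absWeight_nonneg _ _ _ _),
      ofReal_integral_eq_lintegral_ofReal hfg.sobolev_left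
        (Eventually.of_forall fun k => absWeight_nonneg _ _ _ _),
      ofReal_integral_eq_lintegral_ofReal hfg.sobolev_right
        (Eventually.of_forall fun k => absWeight_nonneg _ _ _ _)]
    refine (pow_le_pow_left' h1 2).trans ((sq_lintegral_fourier_mul_le hfg.left hc).trans ?_)
    exact mul_le_mul_right (lintegral_absWeight_clampFun_le hfg.right n) _
  have h2 := le_of_tendsto ((ENNReal.continuous_pow 2).tendsto _ |>.comp hlim.enorm)
    (Eventually.of_forall hle)
  simpa using h2

end

noncomputable section
open MeasureTheory Filter Topology Set

/-! ### Entropy as a function of the Hubble rate -/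

section
variable {f g : Space3 → ℝ}

lemma exists_strictMonoOn_lightEntropy (hfg : FinitePair f g) (hω : ∫ x, f x * g x = 1)
    (hns : ¬ SaturatesHolder 0 f g) :
    ∃ ε : ℝ, 0 < ε ∧ ∀ r : ℝ, 0 < r → r < ε →
      StrictMonoOn (fun H => lightEntropy r H f g) (Ici 0) := by
  obtain ⟨ε₁, hε₁, hsmall⟩ := exists_smallOrder
  obtain ⟨δ, b, n, ε₂, hδ, hb, hn, hε₂, hgrow⟩ := exists_light_growth hfg hns
  -- The bound 1 gives μ² ≤ r, so the thresholds for μ² can be imposed on r = m/H.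
  refine ⟨min (min ε₁ ε₂) 1, by positivity, fun r hr hrε => ?_⟩
  simp only [lt_min_iff] at hrε
  obtain ⟨⟨hr1, hr2⟩, hr3⟩ := hrε
  obtain ⟨ha, har⟩ := muSq_pos_and_le hr hr3
  have hS := hsmall _ ha (har.trans_lt hr1)
  refine strictMonoOn_entropy (D := lightDet (muSq r) f g) (convex_Ici 0) subset_rfl
    (mem_Ici.2 le_rfl) (one_le_sobolev_mul hfg hω) ?_ (fun H hH => ?_) (tendsto_lightDet hS hfg)
    fun H _ hH => ⟨_, mul_pos (inv_pos.2 hH) ?_, hasDerivAt_lightDet hS hfg hH⟩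
  · rw [lightEntropy, if_pos rfl, covEntropy, det_minkowski hfg]
  · rw [lightEntropy, if_neg hH.ne', covEntropy, det_light hS.lt_one hH]
  · obtain ⟨hN, hB, hl⟩ := hgrow _ hS (har.trans_lt hr2) H hH
    exact lt_of_lt_of_le (mul_pos hδ (mul_pos (lt_of_lt_of_le (by positivity) hN)
      (lt_of_lt_of_le (by positivity) hB))) hl

lemma exists_strictMonoOn_exactEntropy (hfg : FinitePair f g) (hω : ∫ x, f x * g x = 1)
    (hns : ¬ SaturatesHolder 0 f g) {M : ℝ} (hM : 0 ≤ M) :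
    ∃ ε : ℝ, 0 < ε ∧ ∀ r : ℝ, 0 < r → r < ε →
      StrictMonoOn (fun H => exactEntropy r H f g) (Icc 0 M) := by
  obtain ⟨ε₁, hε₁, hsmall⟩ := exists_smallOrder
  obtain ⟨ε₂, hε₂, hgrow⟩ := exists_exact_growth hfg hns M
  refine ⟨min (min ε₁ ε₂) 1, by positivity, fun r hr hrε => ?_⟩
  simp only [lt_min_iff] at hrε
  obtain ⟨⟨hr1, hr2⟩, hr3⟩ := hrε
  obtain ⟨ha, har⟩ := muSq_pos_and_le hr hr3
  have hS := hsmall _ ha (har.trans_lt hr1)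
  refine strictMonoOn_entropy (D := exactDet (muSq r) f g) (convex_Icc 0 M) Icc_subset_Ici_self
    (left_mem_Icc.2 hM) (one_le_sobolev_mul hfg hω) ?_ (fun H hH => ?_) (tendsto_exactDet hS hfg)
    fun H hHs hH => hgrow _ hS (har.trans_lt hr2) H hH hHs.2
  · rw [exactEntropy, if_pos rfl, covEntropy, det_minkowski hfg]
  · rw [exactEntropy, if_neg hH.ne', covEntropy, det_exact hS hfg hH]

end

end


theorem mainTheorem7 (f g : Space3 → ℝ) (R : ℝ) (hR : 0 < R)
    (hf : MeasureTheory.Integrable f) (hg : MeasureTheory.Integrable g)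
    (hfS : sobolevNormSq (-1 / 2) f < ⊤) (hgS : sobolevNormSq (1 / 2) g < ⊤)
    (hω : ∫ x : Space3, f x * g x = 1)
    (hns : ¬ SaturatesHolder 0 f g) :
    (∃ ε : ℝ, 0 < ε ∧ ∀ r : ℝ, 0 < r → r < ε →
      StrictMonoOn (fun ρ : ℝ => lightEntropy r (ρ / R) f g) (Set.Ici 0)) ∧
    (∀ L : ℝ, ∃ ε : ℝ, 0 < ε ∧ ∀ r : ℝ, 0 < r → r < ε →
      StrictMonoOn (fun ρ : ℝ => exactEntropy r (ρ / R) f g) (Set.Icc 0 L)) := by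
  have hfg : FinitePair f g :=
    ⟨hf, hg, integrable_absWeight_of_sobolevNormSq hf (by norm_num) hfS,
      integrable_absWeight_of_sobolevNormSq hg (by norm_num) hgS⟩
  have hmono : StrictMono fun ρ : ℝ => ρ / R := fun x y h => div_lt_div_of_pos_right h hR
  constructor
  · obtain ⟨ε, hε, h⟩ := exists_strictMonoOn_lightEntropy hfg hω hns
    exact ⟨ε, hε, fun r hr hr' => (h r hr hr').comp (hmono.strictMonoOn _)
      fun ρ hρ => div_nonneg hρ hR.le⟩
  · intro L
    rcases lt_or_ge L 0 with hL | hL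
    -- For L < 0 the interval is empty.
    · exact ⟨1, one_pos, fun r _ _ => by simp [Set.Icc_eq_empty_of_lt hL, StrictMonoOn]⟩
    · obtain ⟨ε, hε, h⟩ := exists_strictMonoOn_exactEntropy hfg hω hns (div_nonneg hL hR.le)
      exact ⟨ε, hε, fun r hr hr' => (h r hr hr').comp (hmono.strictMonoOn _)
        fun ρ hρ => ⟨div_nonneg hρ.1 hR.le, div_le_div_of_nonneg_right hρ.2 hR.le⟩⟩
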